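/- A closed axis-parallel square of side length $1$ in the plane is called a unit square. An instance of \textsc{Unique Square Set Cover} consists of a finite set $P\subset\mathbb R^2$ of $n$ points and a finite set $D$ of $m$ unit squares, given by the coordinates of the points and of the centres of the squares. A feasible solution is a subset $S\subseteq D$ such that every point of $P$ lies in at least one square of $S$; let $u(S)$ denote the number of points of $P$ that lie in exactly one square of $S$. The goal is to find a feasible solution $S$ that maximizes $u(S)$. For every fixed $\varepsilon>0$ there is a polynomial-time $(1+\varepsilon)$-approximation algorithm for \textsc{Unique Square Set Cover}. That is, for every real $\varepsilon>0$ there are a program of the real RAM (exact real arithmetic, unit cost per operation; one may even restrict the arithmetic operations to additions and subtractions, the real constants to $0$ and $1$, and the use of reals in the control flow to comparisons, so that there is no multiplication and no rounding) and a polynomial $q$ such that, for all $n,m\ge 0$ and every instance with $n$ points and $m$ unit squares, the program halts after at most $q(n+m)$ steps and, whenever the instance has a feasible solution, outputs a feasible solution $S$ with $$u(T)\le(1+\varepsilon)\,u(S)\qquad\text{for every feasible solution }T .$$ -/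

import Mathlib

namespace UniqueSquareCover

/-! ## The optimization problem -/

/-- The closed axis-parallel square of side length one with centre `c`. -/
def unitSquare (c : ℝ × ℝ) : Set (ℝ × ℝ) :=
  {x | |x.1 - c.1| ≤ 1 / 2 ∧ |x.2 - c.2| ≤ 1 / 2}

/-- `S` is a feasible solution for the points `P` and the unit squares with centres in `D`:
it selects some of the given squares, and every point is covered by a selected one. -/
def IsFeasible (P D S : Finset (ℝ × ℝ)) : Prop :=
  S ⊆ D ∧ ∀ p ∈ P, ∃ c ∈ S, p ∈ unitSquare c

open Classical in
/-- The points of `P` that lie in exactly one of the unit squares with centres in `S`. -/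
noncomputable def uniquelyCovered (P S : Finset (ℝ × ℝ)) : Finset (ℝ × ℝ) :=
  P.filter fun p => ∃! c, c ∈ S ∧ p ∈ unitSquare c

/-- `S` is feasible, and no feasible solution covers more than `ρ` times as many points
uniquely as `S` does. -/
def IsApproxSolution (ρ : ℝ) (P D S : Finset (ℝ × ℝ)) : Prop :=
  IsFeasible P D S ∧ ∀ T, IsFeasible P D T →
    ((uniquelyCovered P T).card : ℝ) ≤ ρ * ((uniquelyCovered P S).card : ℝ)

/-! ## The machine model

Programs of a real RAM with unit cost per step. The memory consists of arrays of natural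
numbers and arrays of real numbers. The only arithmetic operations are addition and
subtraction, the only constants are natural numbers and the reals `0` and `1`, and real numbers
influence the control flow through comparisons only. In particular there is no multiplication
and no rounding, so that the unit-cost measure is a reasonable one: in one step
the length of the numbers in memory grows at most by a constant that depends on the program. -/

/-- The memory: `nat a i` and `real a i` are the cells with index `i` of the arrays with
name `a`. Array names are fixed in the program text, indices are computed at run time. -/
structure Store where
  nat : ℕ → ℕ → ℕ
  real : ℕ → ℕ → ℝ

/-- Expressions with values in the natural numbers (subtraction is truncated). -/
inductive NatExpr
  | const (k : ℕ)
  | read (a : ℕ) (i : NatExpr)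
  | add (e f : NatExpr)
  | sub (e f : NatExpr)

/-- Expressions with values in the real numbers. -/
inductive RealExpr
  | zero
  | one
  | read (a : ℕ) (i : NatExpr)
  | add (e f : RealExpr)
  | sub (e f : RealExpr)

/-- Tests, used for branching. -/
inductive Test
  | natLe (e f : NatExpr)
  | realLe (e f : RealExpr)
  | neg (b : Test)
  | conj (b b' : Test)

/-- Programs. -/
inductive Prog
  | skip
  | setNat (a : ℕ) (i e : NatExpr)
  | setReal (a : ℕ) (i : NatExpr) (e : RealExpr)
  | seq (c d : Prog)
  | ite (b : Test) (c d : Prog)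
  | loop (b : Test) (c : Prog)

/-- The value of a natural number expression. -/
def NatExpr.eval (s : Store) : NatExpr → ℕ
  | const k => k
  | read a i => s.nat a (i.eval s)
  | add e f => e.eval s + f.eval s
  | sub e f => e.eval s - f.eval s

/-- The value of a real expression. -/
noncomputable def RealExpr.eval (s : Store) : RealExpr → ℝ
  | zero => 0
  | one => 1
  | read a i => s.real a (i.eval s)
  | add e f => e.eval s + f.eval s
  | sub e f => e.eval s - f.eval s

/-- The truth value of a test. -/
def Test.Holds (s : Store) : Test → Prop
  | natLe e f => e.eval s ≤ f.eval s
  | realLe e f => e.eval s ≤ f.eval s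
  | neg b => ¬ b.Holds s
  | conj b b' => b.Holds s ∧ b'.Holds s

/-- Overwrite one cell of an array of natural numbers. -/
def Store.setNat (s : Store) (a i v : ℕ) : Store :=
  { s with nat := Function.update s.nat a (Function.update (s.nat a) i v) }

/-- Overwrite one cell of an array of real numbers. -/
def Store.setReal (s : Store) (a i : ℕ) (v : ℝ) : Store :=
  { s with real := Function.update s.real a (Function.update (s.real a) i v) }

/-- `Runs c s t s'`: the program `c`, started with memory `s`, halts after exactly `t` steps with
memory `s'`. Each executed assignment, `skip` or test is one step; the expressions in it have a
size that is fixed by the program, so this is the number of elementary operations up to a constant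
factor that depends only on the program. -/
inductive Runs : Prog → Store → ℕ → Store → Prop
  | skip (s : Store) : Runs .skip s 1 s
  | setNat (s : Store) (a : ℕ) (i e : NatExpr) :
      Runs (.setNat a i e) s 1 (s.setNat a (i.eval s) (e.eval s))
  | setReal (s : Store) (a : ℕ) (i : NatExpr) (e : RealExpr) :
      Runs (.setReal a i e) s 1 (s.setReal a (i.eval s) (e.eval s))
  | seq {c d : Prog} {s s' s'' : Store} {t t' : ℕ} (hc : Runs c s t s') (hd : Runs d s' t' s'') :
      Runs (.seq c d) s (t + t') s''
  | iteTrue {b : Test} {c d : Prog} {s s' : Store} {t : ℕ} (hb : b.Holds s) (hc : Runs c s t s') :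
      Runs (.ite b c d) s (t + 1) s'
  | iteFalse {b : Test} {c d : Prog} {s s' : Store} {t : ℕ} (hb : ¬ b.Holds s)
      (hd : Runs d s t s') : Runs (.ite b c d) s (t + 1) s'
  | loopStop {b : Test} {c : Prog} {s : Store} (hb : ¬ b.Holds s) : Runs (.loop b c) s 1 s
  | loopStep {b : Test} {c : Prog} {s s' s'' : Store} {t t' : ℕ} (hb : b.Holds s)
      (hc : Runs c s t s') (hl : Runs (.loop b c) s' t' s'') :
      Runs (.loop b c) s (t + t' + 1) s''

/-- The model is deterministic: running time and final memory are determined by the program and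
the initial memory. -/
theorem Runs.deterministic {c : Prog} {s s₁ : Store} {t₁ : ℕ} (h₁ : Runs c s t₁ s₁) :
    ∀ {t₂ : ℕ} {s₂ : Store}, Runs c s t₂ s₂ → t₁ = t₂ ∧ s₁ = s₂ := by
  induction h₁ with
  | skip s => intro t₂ s₂ h; cases h; exact ⟨rfl, rfl⟩
  | setNat s a i e => intro t₂ s₂ h; cases h; exact ⟨rfl, rfl⟩
  | setReal s a i e => intro t₂ s₂ h; cases h; exact ⟨rfl, rfl⟩
  | seq _ _ ihc ihd =>
    intro t₂ s₂ h
    cases h with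
    | seq hc' hd' =>
      obtain ⟨rfl, rfl⟩ := ihc hc'
      obtain ⟨rfl, rfl⟩ := ihd hd'
      exact ⟨rfl, rfl⟩
  | iteTrue hb _ ih =>
    intro t₂ s₂ h
    cases h with
    | iteTrue _ hc' => obtain ⟨rfl, rfl⟩ := ih hc'; exact ⟨rfl, rfl⟩
    | iteFalse hb' _ => exact absurd hb hb'
  | iteFalse hb _ ih =>
    intro t₂ s₂ h
    cases h with
    | iteTrue hb' _ => exact absurd hb' hb
    | iteFalse _ hd' => obtain ⟨rfl, rfl⟩ := ih hd'; exact ⟨rfl, rfl⟩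
  | loopStop hb =>
    intro t₂ s₂ h
    cases h with
    | loopStop _ => exact ⟨rfl, rfl⟩
    | loopStep hb' _ _ => exact absurd hb' hb
  | loopStep hb _ _ ihc ihl =>
    intro t₂ s₂ h
    cases h with
    | loopStop hb' => exact absurd hb hb'
    | loopStep _ hc' hl' =>
      obtain ⟨rfl, rfl⟩ := ihc hc'
      obtain ⟨rfl, rfl⟩ := ihl hl'
      exact ⟨rfl, rfl⟩

/-! ## Input and output -/

/-- The initial memory for the points `P` and the unit squares with centres `D`, each given as a
list. The natural number array `0` holds the two lengths, the real arrays `0`, `1` hold the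
coordinates of the points, and the real arrays `2`, `3` those of the centres; all other cells
are zero. -/
noncomputable def inputStore (P D : List (ℝ × ℝ)) : Store where
  nat a i :=
    match a, i with
    | 0, 0 => P.length
    | 0, 1 => D.length
    | _, _ => 0
  real a i :=
    match a with
    | 0 => (P.getD i 0).1
    | 1 => (P.getD i 0).2
    | 2 => (D.getD i 0).1
    | 3 => (D.getD i 0).2
    | _ => 0

/-- The solution read off from the final memory: the `j`-th square (counted from zero) is selected
if and only if cell `j` of the natural number array `1` is nonzero. -/
noncomputable def outputSet (D : List (ℝ × ℝ)) (s : Store) : Finset (ℝ × ℝ) :=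
  ((Finset.range D.length).filter fun j => s.nat 1 j ≠ 0).image fun j => D.getD j 0

end UniqueSquareCover

/-! The proof combines the shifting strategy with an exact dynamic program. After doubling the
coordinates, a square has side length 2. Cut each axis into blocks of length 2; a square whose lower
left corner lies in block (i, j) can only contain points of the blocks with first index i or i + 1
and second index j or j + 1. Fix a constant k and a shift s < k, and group the blocks into cells of
k × k blocks. For each cell separately, choose squares among those that can reach it so that its
points are covered, and take the union of all choices. This union is feasible, and a point outside
the first and last row and column of its cell can only be met by squares belonging to that cell
alone, so its multiplicity is known inside the cell. Each point is on the boundary of its cell for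
at most four of the k shifts, so some shift keeps all but a fraction 4 / k of the points that a
given solution covers uniquely (`Sweep.exists_shift`). The resulting ratio k / (k - 4) is at most 1
+ ε for large k.

A cell is solved exactly by sweeping all its columns at once, ordered by the offset inside the
block. With ties broken suitably, incidence in one direction means: same block and the square comes
first, or next block and the point comes first (`abs_sub_le_half_iff_meets`). So when a point is
reached, the squares of a given block that matter are either those already passed or those still to
come, and what remains is a threshold condition in the other coordinate. The two extreme values of
the selected squares of each block, past and future, therefore decide whether a point is covered
never, once or more often (`Sweep.covCount_iff`). The values for future squares are guessed and
verified as the sweep proceeds.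

For fixed k a state consists of boundedly many numbers of linear size, so solutions become paths in
a layered graph of polynomial size; the shift is a constant component of the state.
`Sweep.gain_le_unique` and `Sweep.unique_le_gain` compare path weights with unique coverage in the
two directions, and `wp_pathProg` finds a heaviest path. As the machine has no floor, multiplication
or division, blocks are found by repeated scanning (`wp_anchorProg`), and quotients and remainders
of indices are tabulated by nested loops (`wp_tabulate`). -/

namespace UniqueSquareCover

/-! ## Running times and program logic -/

/-- An upper bound for the running time if no loop makes more than `R` iterations. -/
def Prog.cost (R : ℕ) : Prog → ℕ
  | .skip => 1
  | .setNat _ _ _ => 1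
  | .setReal _ _ _ => 1
  | .seq c d => c.cost R + d.cost R
  | .ite _ c d => c.cost R + d.cost R + 1
  | .loop _ c => R * (c.cost R + 1) + 1

/-- `Prog.cost` as a polynomial in the bound for the loops. -/
noncomputable def Prog.costPoly : Prog → Polynomial ℕ
  | .skip => 1
  | .setNat _ _ _ => 1
  | .setReal _ _ _ => 1
  | .seq c d => c.costPoly + d.costPoly
  | .ite _ c d => c.costPoly + d.costPoly + 1
  | .loop _ c => Polynomial.X * (c.costPoly + 1) + 1

theorem Prog.eval_costPoly (R : ℕ) (c : Prog) : c.costPoly.eval R = c.cost R := by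
  induction c <;> simp_all [Prog.costPoly, Prog.cost]

/-- Total correctness, with running time at most `c.cost R`. -/
def Wp (R : ℕ) (c : Prog) (Q : Store → Prop) (s : Store) : Prop :=
  ∃ t s', Runs c s t s' ∧ t ≤ c.cost R ∧ Q s'

variable {R : ℕ} {Q Q' : Store → Prop} {s : Store} {c d : Prog}

theorem Wp.mono (h : Wp R c Q s) (hQ : ∀ s, Q s → Q' s) : Wp R c Q' s := by
  obtain ⟨t, s', h₁, h₂, h₃⟩ := h
  exact ⟨t, s', h₁, h₂, hQ _ h₃⟩

theorem wp_skip (h : Q s) : Wp R .skip Q s := ⟨1, s, .skip s, le_rfl, h⟩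

theorem wp_setNat {a : ℕ} {i e : NatExpr} (h : Q (s.setNat a (i.eval s) (e.eval s))) :
    Wp R (.setNat a i e) Q s := ⟨1, _, .setNat s a i e, le_rfl, h⟩

theorem wp_setReal {a : ℕ} {i : NatExpr} {e : RealExpr}
    (h : Q (s.setReal a (i.eval s) (e.eval s))) :
    Wp R (.setReal a i e) Q s := ⟨1, _, .setReal s a i e, le_rfl, h⟩

theorem wp_seq (h : Wp R c (Wp R d Q) s) : Wp R (.seq c d) Q s := by
  obtain ⟨t, s', h₁, h₂, t', s'', h₃, h₄, h₅⟩ := h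
  exact ⟨t + t', s'', .seq h₁ h₃, by simp only [Prog.cost]; omega, h₅⟩

theorem wp_ite {b : Test} (h₁ : b.Holds s → Wp R c Q s) (h₂ : ¬ b.Holds s → Wp R d Q s) :
    Wp R (.ite b c d) Q s := by
  by_cases hb : b.Holds s
  · obtain ⟨t, s', h₁, h₂, h₃⟩ := h₁ hb
    exact ⟨t + 1, s', .iteTrue hb h₁, by simp only [Prog.cost]; omega, h₃⟩
  · obtain ⟨t, s', h₁, h₂, h₃⟩ := h₂ hb
    exact ⟨t + 1, s', .iteFalse hb h₁, by simp only [Prog.cost]; omega, h₃⟩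

/-- Sequential composition of a list of programs. -/
def block : List Prog → Prog
  | [] => .skip
  | c :: l => .seq c (block l)

theorem wp_block_nil (h : Q s) : Wp R (block []) Q s := wp_skip h

theorem wp_block_cons {l : List Prog} (h : Wp R c (Wp R (block l) Q) s) :
    Wp R (block (c :: l)) Q s := wp_seq h

/-- The scalar register with name `a`. -/
def reg (a : ℕ) : NatExpr := .read a (.const 0)

@[simp] theorem eval_reg (a : ℕ) (s : Store) : (reg a).eval s = s.nat a 0 := rfl
@[simp] theorem eval_const (k : ℕ) (s : Store) : (NatExpr.const k).eval s = k := rfl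
@[simp] theorem eval_read (a : ℕ) (i : NatExpr) (s : Store) :
    (NatExpr.read a i).eval s = s.nat a (i.eval s) := rfl
@[simp] theorem eval_add (e f : NatExpr) (s : Store) :
    (NatExpr.add e f).eval s = e.eval s + f.eval s := rfl
@[simp] theorem eval_sub (e f : NatExpr) (s : Store) :
    (NatExpr.sub e f).eval s = e.eval s - f.eval s := rfl
@[simp] theorem real_eval_zero (s : Store) : RealExpr.zero.eval s = 0 := rfl
@[simp] theorem real_eval_one (s : Store) : RealExpr.one.eval s = 1 := rfl
@[simp] theorem real_eval_read (a : ℕ) (i : NatExpr) (s : Store) :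
    (RealExpr.read a i).eval s = s.real a (i.eval s) := rfl
@[simp] theorem real_eval_add (e f : RealExpr) (s : Store) :
    (RealExpr.add e f).eval s = e.eval s + f.eval s := rfl
@[simp] theorem real_eval_sub (e f : RealExpr) (s : Store) :
    (RealExpr.sub e f).eval s = e.eval s - f.eval s := rfl
@[simp] theorem holds_natLe (e f : NatExpr) (s : Store) :
    (Test.natLe e f).Holds s ↔ e.eval s ≤ f.eval s := Iff.rfl
@[simp] theorem holds_realLe (e f : RealExpr) (s : Store) :
    (Test.realLe e f).Holds s ↔ e.eval s ≤ f.eval s := Iff.rfl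
@[simp] theorem holds_neg (b : Test) (s : Store) : b.neg.Holds s ↔ ¬ b.Holds s := Iff.rfl
@[simp] theorem holds_conj (b b' : Test) (s : Store) :
    (b.conj b').Holds s ↔ b.Holds s ∧ b'.Holds s := Iff.rfl

@[simp] theorem nat_setNat (s : Store) (a i v b j : ℕ) :
    (s.setNat a i v).nat b j = if b = a ∧ j = i then v else s.nat b j := by
  by_cases hb : b = a
  · subst hb
    by_cases hj : j = i
    · subst hj; simp [Store.setNat]
    · simp [Store.setNat, hj]
  · simp [Store.setNat, hb]

theorem nat_setNat_of_ne (s : Store) {a b : ℕ} (i v : ℕ) (h : b ≠ a) :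
    (s.setNat a i v).nat b = s.nat b := by simp [Store.setNat, h]

@[simp] theorem real_setNat (s : Store) (a i v : ℕ) : (s.setNat a i v).real = s.real := rfl
@[simp] theorem nat_setReal (s : Store) (a i : ℕ) (v : ℝ) : (s.setReal a i v).nat = s.nat := rfl

@[simp] theorem real_setReal (s : Store) (a i : ℕ) (v : ℝ) (b j : ℕ) :
    (s.setReal a i v).real b j = if b = a ∧ j = i then v else s.real b j := by
  by_cases hb : b = a
  · subst hb
    by_cases hj : j = i
    · subst hj; simp [Store.setReal]
    · simp [Store.setReal, hj]
  · simp [Store.setReal, hb]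

theorem real_setReal_of_ne (s : Store) {a b : ℕ} (i : ℕ) (v : ℝ) (h : b ≠ a) :
    (s.setReal a i v).real b = s.real b := by simp [Store.setReal, h]

/-- `s'` differs from `s` at most in the arrays of natural numbers with names in `A` and the
arrays of real numbers with names in `B`. -/
def Frame (A B : Set ℕ) (s s' : Store) : Prop :=
  (∀ a, a ∉ A → s'.nat a = s.nat a) ∧ ∀ a, a ∉ B → s'.real a = s.real a

theorem Frame.refl (A B : Set ℕ) (s : Store) : Frame A B s s :=
  ⟨fun _ _ => rfl, fun _ _ => rfl⟩

theorem Frame.trans {A B : Set ℕ} {s s' s'' : Store} (h : Frame A B s s')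
    (h' : Frame A B s' s'') : Frame A B s s'' :=
  ⟨fun a ha => (h'.1 a ha).trans (h.1 a ha), fun a ha => (h'.2 a ha).trans (h.2 a ha)⟩

theorem Frame.mono {A B A' B' : Set ℕ} {s s' : Store} (h : Frame A B s s') (hA : A ⊆ A')
    (hB : B ⊆ B') : Frame A' B' s s' :=
  ⟨fun a ha => h.1 a fun h' => ha (hA h'), fun a ha => h.2 a fun h' => ha (hB h')⟩

theorem Frame.setNat {A B : Set ℕ} {s s' : Store} (h : Frame A B s s') {a : ℕ} (i v : ℕ)
    (ha : a ∈ A) : Frame A B s (s'.setNat a i v) :=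
  ⟨fun b hb => by
    rw [nat_setNat_of_ne _ _ _ (fun hba => hb (by rwa [hba])), h.1 b hb], h.2⟩

theorem Frame.setReal {A B : Set ℕ} {s s' : Store} (h : Frame A B s s') {a i : ℕ} {v : ℝ}
    (ha : a ∈ B) : Frame A B s (s'.setReal a i v) :=
  ⟨h.1, fun b hb => by
    rw [real_setReal_of_ne _ _ _ (fun hba => hb (by rwa [hba])), h.2 b hb]⟩

/-- Run `c` with the register `r` set to `0, 1, …` up to `b`, exclusively. -/
def forUp (r : ℕ) (b : NatExpr) (c : Prog) : Prog :=
  .seq (.setNat r (.const 0) (.const 0))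
    (.loop (.neg (.natLe b (reg r)))
      (.seq c (.setNat r (.const 0) (.add (reg r) (.const 1)))))

/-- The invariant is indexed by the number of completed iterations and may not depend on the counter
(`hset`). The bound is evaluated anew at each test, hence `hbound`. -/
theorem wp_forUp {r n : ℕ} {b : NatExpr} (Inv : ℕ → Store → Prop) (hn : n ≤ R)
    (hinit : Inv 0 s)
    (hset : ∀ i s x, Inv i s → Inv i (s.setNat r 0 x))
    (hbound : ∀ i s, Inv i s → b.eval s = n)
    (hbody : ∀ i s, i < n → Inv i s → s.nat r 0 = i →
      Wp R c (fun s' => s'.nat r 0 = i ∧ Inv (i + 1) s') s)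
    (hpost : ∀ s, Inv n s → Q s) : Wp R (forUp r b c) Q s := by
  -- Induction on the number `m` of remaining iterations; each costs the body, one increment and one
  -- test.
  have key : ∀ m i s, i + m = n → Inv i s → s.nat r 0 = i →
      ∃ t s', Runs (.loop (.neg (.natLe b (reg r)))
        (.seq c (.setNat r (.const 0) (.add (reg r) (.const 1))))) s t s' ∧
        t ≤ m * (c.cost R + 1 + 1) + 1 ∧ Inv n s' := by
    intro m
    induction m with
    | zero =>
      intro i s hi hI hr
      obtain rfl : i = n := hi
      refine ⟨1, s, .loopStop ?_, by simp, hI⟩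
      simp [hbound _ _ hI, hr]
    | succ m ih =>
      intro i s hi hI hr
      obtain ⟨t, s', h₁, h₂, h₃, h₄⟩ := hbody i s (by omega) hI hr
      obtain ⟨t', s'', h₅, h₆, h₇⟩ := ih (i + 1) (s'.setNat r 0 (s'.nat r 0 + 1)) (by omega)
        (hset _ _ _ h₄) (by simp [h₃])
      refine ⟨(t + 1) + t' + 1, s'', .loopStep ?_ (.seq h₁ (.setNat _ _ _ _)) h₅, ?_, h₇⟩
      · simp [hbound _ _ hI, hr]; omega
      · rw [Nat.succ_mul]; omega
  obtain ⟨t, s', h₁, h₂, h₃⟩ := key n 0 (s.setNat r 0 0) (by simp) (hset _ _ _ hinit) (by simp)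
  refine ⟨1 + t, s', .seq (.setNat _ _ _ _) h₁, ?_, hpost _ h₃⟩
  have : n * (c.cost R + 1 + 1) ≤ R * (c.cost R + 1 + 1) := Nat.mul_le_mul_right _ hn
  simp only [forUp, Prog.cost]
  omega

/-! ### Derived tests and expressions -/

/-- The test `e < f`. -/
def Test.lt (e f : NatExpr) : Test := .neg (.natLe f e)
/-- The test `e = f`. -/
def Test.eq (e f : NatExpr) : Test := .conj (.natLe e f) (.natLe f e)
/-- Disjunction of tests. -/
def Test.or (b b' : Test) : Test := .neg (.conj (.neg b) (.neg b'))
/-- Implication between tests. -/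
def Test.imp (b b' : Test) : Test := .neg (.conj b (.neg b'))
/-- Case distinction between tests. -/
def Test.cond (b c d : Test) : Test := .conj (.imp b c) (.imp (.neg b) d)
/-- Conjunction of a list of tests. -/
def Test.all : List Test → Test
  | [] => .natLe (.const 0) (.const 0)
  | b :: l => .conj b (Test.all l)

@[simp] theorem holds_lt (e f : NatExpr) (s : Store) :
    (Test.lt e f).Holds s ↔ e.eval s < f.eval s := by simp [Test.lt]
@[simp] theorem holds_eq (e f : NatExpr) (s : Store) :
    (Test.eq e f).Holds s ↔ e.eval s = f.eval s := by simp [Test.eq, le_antisymm_iff]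
@[simp] theorem holds_or (b b' : Test) (s : Store) :
    (b.or b').Holds s ↔ b.Holds s ∨ b'.Holds s := by simp [Test.or]; tauto
@[simp] theorem holds_imp (b b' : Test) (s : Store) :
    (b.imp b').Holds s ↔ (b.Holds s → b'.Holds s) := by simp [Test.imp]
@[simp] theorem holds_cond (b c d : Test) (s : Store) :
    (b.cond c d).Holds s ↔ (b.Holds s → c.Holds s) ∧ (¬ b.Holds s → d.Holds s) := by
  simp [Test.cond]

theorem holds_all (l : List Test) (s : Store) : (Test.all l).Holds s ↔ ∀ b ∈ l, b.Holds s := by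
  induction l <;> simp_all [Test.all]

/-- Conjunction of a finite family of tests. -/
noncomputable def Test.forall {ι : Type*} [Fintype ι] (f : ι → Test) : Test :=
  .all (Finset.univ.toList.map f)

@[simp] theorem holds_forall {ι : Type*} [Fintype ι] (f : ι → Test) (s : Store) :
    (Test.forall f).Holds s ↔ ∀ i, (f i).Holds s := by
  simp [Test.forall, holds_all]

/-! ### Nested loops -/

/-- Nested loops, one for each element of the list. -/
def nest {ι : Type*} (r : ι → ℕ) (b : ι → NatExpr) (c : Prog) : List ι → Prog
  | [] => c
  | i :: l => forUp (r i) (b i) (nest r b c l)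

/-- The number of iterations of nested loops with bounds `β`. -/
def nestSize {ι : Type*} (β : ι → ℕ) : List ι → ℕ
  | [] => 1
  | i :: l => β i * nestSize β l

/-- The number of iterations of nested loops before the one with counters `x`. -/
def nestIndex {ι : Type*} (β x : ι → ℕ) : List ι → ℕ
  | [] => 0
  | i :: l => x i * nestSize β l + nestIndex β x l

theorem nestIndex_congr {ι : Type*} {β x y : ι → ℕ} {l : List ι} (h : ∀ i ∈ l, x i = y i) :
    nestIndex β x l = nestIndex β y l := by
  induction l <;> simp_all [nestIndex]

theorem nestIndex_lt {ι : Type*} {β x : ι → ℕ} {l : List ι} (h : ∀ i ∈ l, x i < β i) :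
    nestIndex β x l < nestSize β l := by
  induction l with
  | nil => simp [nestIndex, nestSize]
  | cons i l ih =>
    have h₁ := ih fun j hj => h j (by simp [hj])
    have h₂ : x i + 1 ≤ β i := h i (by simp)
    have := Nat.mul_le_mul_right (nestSize β l) h₂
    simp only [nestIndex, nestSize]
    rw [Nat.add_mul] at this
    omega

/-- `nestIndex` is a number in mixed radix, so its digits can be recovered by division with
remainder by `nestSize`. -/
theorem nestIndex_inj {ι : Type*} {β x y : ι → ℕ} {l : List ι} (hx : ∀ i ∈ l, x i < β i)
    (hy : ∀ i ∈ l, y i < β i) (h : nestIndex β x l = nestIndex β y l) : ∀ i ∈ l, x i = y i := by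
  induction l with
  | nil => simp
  | cons i l ih =>
    have h₁ : nestIndex β x l < nestSize β l := nestIndex_lt fun j hj => hx j (by simp [hj])
    have h₂ : nestIndex β y l < nestSize β l := nestIndex_lt fun j hj => hy j (by simp [hj])
    simp only [nestIndex] at h
    have h₃ : nestIndex β x l = nestIndex β y l := by
      have := congrArg (· % nestSize β l) h
      simpa [Nat.mul_add_mod_of_lt h₁, Nat.mul_add_mod_of_lt h₂] using this
    have h₄ : x i = y i := by
      rw [h₃] at h
      exact Nat.eq_of_mul_eq_mul_right (by omega) (Nat.add_right_cancel h)
    intro j hj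
    rcases List.mem_cons.1 hj with rfl | hj
    · exact h₄
    · exact ih (fun j hj => hx j (by simp [hj])) (fun j hj => hy j (by simp [hj])) h₃ j hj

/-- Nested counters run through the vectors in lexicographic order, so the rank `nestIndex` of the
current vector can index the invariant. -/
theorem wp_nest {ι : Type*} [DecidableEq ι] {r : ι → ℕ} (hr : Function.Injective r)
    {b : ι → NatExpr} {β : ι → ℕ} {l : List ι} (hl : l.Nodup) (Inv : ℕ → Store → Prop)
    (hR : ∀ i ∈ l, β i ≤ R) (hinit : Inv 0 s)
    (hset : ∀ j s i x, i ∈ l → Inv j s → Inv j (s.setNat (r i) 0 x))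
    (hbound : ∀ i ∈ l, ∀ j s, Inv j s → (b i).eval s = β i)
    (hbody : ∀ x : ι → ℕ, ∀ s, (∀ i ∈ l, x i < β i) → (∀ i ∈ l, s.nat (r i) 0 = x i) →
      Inv (nestIndex β x l) s →
      Wp R c (fun s' => (∀ i ∈ l, s'.nat (r i) 0 = x i) ∧ Inv (nestIndex β x l + 1) s') s)
    (hpost : ∀ s, Inv (nestSize β l) s → Q s) : Wp R (nest r b c l) Q s := by
  induction l generalizing Inv Q s with
  | nil =>
    obtain h := hbody (fun _ => 0) s (by simp) (by simp) hinit
    exact h.mono fun s hs => hpost s hs.2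
  | cons i l ih =>
    have hil : i ∉ l := (List.nodup_cons.1 hl).1
    refine wp_forUp (n := β i) (fun j s => Inv (j * nestSize β l) s) (hR i (by simp))
      (by simpa using hinit) (fun j s x h => hset _ _ i x (by simp) h)
      (fun j s h => hbound i (by simp) _ s h) ?_ (fun s h => hpost s (by simpa [nestSize] using h))
    intro j s hj hI hrj
    refine ih (List.nodup_cons.1 hl).2
      (fun j' s => s.nat (r i) 0 = j ∧ Inv (j * nestSize β l + j') s)
      (fun i' hi' => hR i' (by simp [hi'])) ⟨hrj, by simpa using hI⟩ ?_ ?_ ?_ ?_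
    · intro j' s i' x hi' ⟨h₁, h₂⟩
      refine ⟨?_, hset _ _ i' x (by simp [hi']) h₂⟩
      have : r i ≠ r i' := fun h => hil (hr h ▸ hi')
      simpa [this] using h₁
    · exact fun i' hi' j' s h => hbound i' (by simp [hi']) _ s h.2
    · intro x s hx hxr ⟨h₁, h₂⟩
      have hcong : ∀ i' ∈ l, x i' = Function.update x i j i' := fun i' hi' => by
        rw [Function.update_of_ne]; rintro rfl; exact hil hi'
      have hidx : nestIndex β (Function.update x i j) (i :: l) =
          j * nestSize β l + nestIndex β x l := by
        simp [nestIndex, nestIndex_congr hcong]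
      have := hbody (Function.update x i j) s ?_ ?_ (by rwa [hidx])
      · refine this.mono fun s' ⟨h₃, h₄⟩ => ⟨?_, ?_, ?_⟩
        · intro i' hi'
          rw [h₃ i' (by simp [hi']), ← hcong i' hi']
        · simpa using h₃ i (by simp)
        · rwa [hidx, add_assoc] at h₄
      · intro i' hi'
        rcases List.mem_cons.1 hi' with rfl | hi'
        · simpa using hj
        · rw [← hcong i' hi']; exact hx i' hi'
      · intro i' hi'
        rcases List.mem_cons.1 hi' with rfl | hi'
        · simpa using h₁
        · rw [← hcong i' hi']; exact hxr i' hi'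
    · intro s ⟨h₁, h₂⟩
      refine ⟨h₁, ?_⟩
      rwa [Nat.succ_mul]

/-- Store the registers `r i` in the arrays `tab i` at the index given by the register `q`. -/
def writeRow {ι : Type*} (q : ℕ) (tab r : ι → ℕ) : List ι → Prog
  | [] => .skip
  | i :: l => .seq (.setNat (tab i) (reg q) (reg (r i))) (writeRow q tab r l)

/-- List all vectors of natural numbers within the bounds `b` in the arrays `tab`. -/
def tabulate {ι : Type*} (q : ℕ) (tab r : ι → ℕ) (b : ι → NatExpr) (l : List ι) : Prog :=
  block [.setNat q (.const 0) (.const 0),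
    nest r b (block [writeRow q tab r l,
      .setNat q (.const 0) (.add (reg q) (.const 1))]) l]

theorem wp_writeRow {ι : Type*} {q : ℕ} {tab r : ι → ℕ} (htr : ∀ i j, tab i ≠ r j)
    (htq : ∀ i, tab i ≠ q) (l : List ι) (j : ℕ) (x : ι → ℕ) (s : Store) (hj : s.nat q 0 = j)
    (hx : ∀ i ∈ l, s.nat (r i) 0 = x i) (ht : Function.Injective tab) :
    Wp R (writeRow q tab r l) (fun s' => Frame (Set.range tab) ∅ s s' ∧
      (∀ i ∈ l, s'.nat (tab i) j = x i) ∧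
      (∀ i, i ∉ l → s'.nat (tab i) = s.nat (tab i)) ∧
      ∀ i j', j' ≠ j → s'.nat (tab i) j' = s.nat (tab i) j') s := by
  induction l generalizing s with
  | nil => exact wp_skip ⟨Frame.refl _ _ _, by simp, by simp, by simp⟩
  | cons i l ih =>
    refine wp_seq (wp_setNat ?_)
    refine (ih _ ?_ ?_).mono ?_
    · rw [nat_setNat_of_ne _ _ _ (htq i).symm, hj]
    · intro i' hi'
      rw [nat_setNat_of_ne _ _ _ (htr i i').symm, hx i' (by simp [hi'])]
    · rintro s' ⟨h₁, h₂, h₃, h₄⟩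
      refine ⟨((Frame.refl _ _ s).setNat _ _ (Set.mem_range_self i)).trans h₁, ?_, ?_, ?_⟩
      · intro i' hi'
        by_cases hl : i' ∈ l
        · exact h₂ i' hl
        · obtain rfl : i' = i := by simpa [hl] using hi'
          rw [h₃ i' hl]
          simp [hj, hx i' (by simp)]
      · intro i' hi'
        rw [h₃ i' (fun h => hi' (by simp [h])), nat_setNat_of_ne]
        intro h
        exact hi' (by simp [ht h])
      · intro i' j' hj'
        rw [h₄ i' j' hj']
        simp [hj, hj']

/-- A substitute for division: the tables return the mixed radix digits of an index. It is used both
to split layer numbers into cell and step and to enumerate the states. -/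
theorem wp_tabulate {ι : Type*} [DecidableEq ι] {q : ℕ} {tab r : ι → ℕ} {b : ι → NatExpr}
    {l : List ι} (hl : l.Nodup) (hr : Function.Injective r) (ht : Function.Injective tab)
    (htr : ∀ i j, tab i ≠ r j) (htq : ∀ i, tab i ≠ q) (hrq : ∀ i, r i ≠ q) {β : ι → ℕ} (s : Store)
    (hR : ∀ i ∈ l, β i ≤ R)
    (hb : ∀ i ∈ l, ∀ s', Frame ({q} ∪ Set.range tab ∪ Set.range r) ∅ s s' → (b i).eval s' = β i) :
    Wp R (tabulate q tab r b l) (fun s' => Frame ({q} ∪ Set.range tab ∪ Set.range r) ∅ s s' ∧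
      s'.nat q 0 = nestSize β l ∧ ∀ x : ι → ℕ, (∀ i ∈ l, x i < β i) →
        ∀ i ∈ l, s'.nat (tab i) (nestIndex β x l) = x i) s := by
  refine wp_block_cons (wp_setNat (wp_block_cons ?_))
  refine wp_nest hr hl (β := β) (fun j s' => Frame ({q} ∪ Set.range tab ∪ Set.range r) ∅ s s' ∧
      s'.nat q 0 = j ∧ ∀ x : ι → ℕ, (∀ i ∈ l, x i < β i) → nestIndex β x l < j →
        ∀ i ∈ l, s'.nat (tab i) (nestIndex β x l) = x i) hR ?_ ?_ ?_ ?_ ?_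
  · exact ⟨(Frame.refl _ _ s).setNat _ _ (by simp), by simp, by simp⟩
  · rintro j s' i x hi ⟨h₁, h₂, h₃⟩
    refine ⟨h₁.setNat _ _ (by simp), ?_, fun y hy hyj i' hi' => ?_⟩
    · rw [nat_setNat_of_ne _ _ _ (hrq i).symm, h₂]
    · rw [nat_setNat_of_ne _ _ _ (htr i' i), h₃ y hy hyj i' hi']
  · exact fun i hi j s' h => hb i hi s' h.1
  · rintro x s' hx hxr ⟨h₁, h₂, h₃⟩
    refine wp_block_cons ((wp_writeRow htr htq l _ x s' h₂ hxr ht).mono ?_)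
    rintro s'' ⟨h₄, h₅, h₆, h₇⟩
    have hr'' : ∀ i, s''.nat (r i) = s'.nat (r i) :=
      fun i => h₄.1 _ (by rintro ⟨i', hi'⟩; exact htr i' i hi')
    have hq'' : s''.nat q = s'.nat q := h₄.1 _ (by rintro ⟨i', hi'⟩; exact htq i' hi')
    refine wp_block_cons (wp_setNat (wp_block_nil ⟨?_, ?_, ?_, ?_⟩))
    · intro i hi
      rw [nat_setNat_of_ne _ _ _ (hrq i), hr'', hxr i hi]
    · exact (h₁.trans (h₄.mono (fun a ha => by simp_all) (by simp))).setNat _ _ (by simp)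
    · simp [hq'', h₂]
    · intro y hy hyj i hi
      rw [nat_setNat_of_ne _ _ _ (htq i)]
      by_cases hyx : nestIndex β y l = nestIndex β x l
      · rw [hyx, h₅ i hi, nestIndex_inj hy hx hyx i hi]
      · rw [h₇ i _ hyx]
        exact h₃ y hy (by omega) i hi
  · rintro s' ⟨h₁, h₂, h₃⟩
    exact wp_block_nil ⟨h₁, h₂, fun x hx => h₃ x hx (nestIndex_lt hx)⟩

end UniqueSquareCover

namespace UniqueSquareCover

variable {R : ℕ}

/-! ## Normalization of the coordinates -/

/-- Store the doubled left (lower) sides of the squares and the doubled coordinates of the points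
in the real arrays `4` and `5`, and their number in the register `2`. -/
def loadProg : Prog :=
  block [.setNat 2 (.const 0) (.add (reg 0) (.read 0 (.const 1))),
    forUp 3 (.read 0 (.const 1)) (block [
      .setReal 4 (reg 3) (.sub (.add (.read 2 (reg 3)) (.read 2 (reg 3))) .one),
      .setReal 5 (reg 3) (.sub (.add (.read 3 (reg 3)) (.read 3 (reg 3))) .one)]),
    forUp 3 (reg 0) (block [
      .setReal 4 (.add (.read 0 (.const 1)) (reg 3)) (.add (.read 0 (reg 3)) (.read 0 (reg 3))),
      .setReal 5 (.add (.read 0 (.const 1)) (reg 3)) (.add (.read 1 (reg 3)) (.read 1 (reg 3)))])]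

theorem wp_loadProg {n m : ℕ} (s : Store) (hn : s.nat 0 0 = n) (hm : s.nat 0 1 = m)
    (hR : n + m ≤ R) :
    Wp R loadProg (fun s' => Frame {2, 3} {4, 5} s s' ∧ s'.nat 2 0 = n + m ∧
      (∀ j < m, s'.real 4 j = s.real 2 j + s.real 2 j - 1 ∧
        s'.real 5 j = s.real 3 j + s.real 3 j - 1) ∧
      ∀ i < n, s'.real 4 (m + i) = s.real 0 i + s.real 0 i ∧
        s'.real 5 (m + i) = s.real 1 i + s.real 1 i) s := by
  refine wp_block_cons (wp_setNat (wp_block_cons ?_))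
  refine wp_forUp (n := m) (fun t s' => Frame {2, 3} {4, 5} s s' ∧ s'.nat 2 0 = n + m ∧
    ∀ j < t, s'.real 4 j = s.real 2 j + s.real 2 j - 1 ∧
        s'.real 5 j = s.real 3 j + s.real 3 j - 1) (by omega) ?_ ?_ ?_ ?_ ?_
  · exact ⟨(Frame.refl _ _ s).setNat _ _ (by simp), by simp [hn, hm], by simp⟩
  · rintro i s' x ⟨h₁, h₂, h₃⟩
    exact ⟨h₁.setNat _ _ (by simp), by simpa using h₂, by simpa using h₃⟩
  · rintro i s' ⟨h₁, -⟩
    simp [h₁.1 0 (by simp), hm]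
  · rintro i s' hi ⟨h₁, h₂, h₃⟩ hr
    refine wp_block_cons (wp_setReal (wp_block_cons (wp_setReal (wp_block_nil ?_))))
    refine ⟨by simpa using hr, (h₁.setReal (by simp)).setReal (by simp), by simpa using h₂, ?_⟩
    intro j hj
    have e2 := h₁.2 2 (by simp)
    have e3 := h₁.2 3 (by simp)
    by_cases hji : j = i
    · subst hji; simp [hr, e2, e3]
    · have := h₃ j (by omega)
      simpa [hr, hji] using this
  · rintro s₁ ⟨h₁, h₂, h₃⟩
    refine wp_block_cons ?_
    refine wp_forUp (n := n) (fun t s' => Frame {2, 3} {4, 5} s s' ∧ s'.nat 2 0 = n + m ∧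
      (∀ j < m, s'.real 4 j = s.real 2 j + s.real 2 j - 1 ∧
        s'.real 5 j = s.real 3 j + s.real 3 j - 1) ∧
      ∀ i < t, s'.real 4 (m + i) = s.real 0 i + s.real 0 i ∧
        s'.real 5 (m + i) = s.real 1 i + s.real 1 i) (by omega) ⟨h₁, h₂, h₃, by simp⟩ ?_ ?_ ?_ ?_
    · rintro i s' x ⟨h₁, h₂, h₃, h₄⟩
      exact ⟨h₁.setNat _ _ (by simp), by simpa using h₂, by simpa using h₃, by simpa using h₄⟩
    · rintro i s' ⟨h₁, -⟩
      simp [h₁.1 0 (by simp), hn]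
    · rintro i s' hi ⟨h₁, h₂, h₃, h₄⟩ hr
      refine wp_block_cons (wp_setReal (wp_block_cons (wp_setReal (wp_block_nil ?_))))
      have e := h₁.1 0 (by simp)
      refine ⟨by simpa using hr, (h₁.setReal (by simp)).setReal (by simp), by simpa using h₂,
        ?_, ?_⟩
      · intro j hj
        have : j ≠ m + i := by omega
        simpa [hr, e, hm, this] using h₃ j hj
      · intro j hj
        have e2 := h₁.2 0 (by simp)
        have e3 := h₁.2 1 (by simp)
        by_cases hji : j = i
        · subst hji; simp [hr, e, hm, e2, e3]
        · have := h₄ j (by omega)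
          simpa [hr, e, hm, hji] using this
    · exact fun s' h => wp_block_nil h

/-! ### Block decomposition without a floor function -/

/-- How the block indices `a`, `a'` of two blocks determine their positions `g`, `g'`. -/
def Compat (a : ℕ) (g : ℝ) (a' : ℕ) (g' : ℝ) : Prop :=
  (a = a' → g = g') ∧ (a' = a + 1 → g' = g + 2) ∧ (a + 2 ≤ a' → g + 4 ≤ g')

/-- Invariant of the decomposition into blocks of length two: the values `x e` below `g` have been
assigned a block index and a distance from the left end of the block. -/
structure AnchorInv (N k t : ℕ) (x : ℕ → ℝ) (I : ℕ → ℕ) (F : ℕ → ℝ) (g : ℝ) (c : ℕ) : Prop where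
  le_c : k ≤ c
  c_le : c ≤ k + 2 * t
  label : ∀ e < N, x e < g →
    0 ≤ F e ∧ F e < 2 ∧ k ≤ I e ∧ I e < c ∧ Compat (I e) (x e - F e) c g
  pair : ∀ e < N, ∀ e' < N, x e < g → x e' < g →
    Compat (I e) (x e - F e) (I e') (x e' - F e')
  -- Each pass that is still needed absorbs at least one value, so `N` passes exhaust them all.
  progress : (∀ e < N, x e < g) ∨
    (t ≤ {e ∈ Finset.range N | x e < g}.card ∧ ∃ e < N, g ≤ x e ∧ x e < g + 2)

/-- By `hg` no value lies between `g + 2` and `g'`, so skipping this stretch loses nothing. A gap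
raises the index by two, which prevents blocks that are not adjacent from getting consecutive
indices. -/
theorem AnchorInv.step {N k t : ℕ} {x : ℕ → ℝ} {I I' : ℕ → ℕ} {F F' : ℕ → ℝ} {g g' : ℝ}
    {c c' : ℕ} (h : AnchorInv N k t x I F g c)
    (hin : ∀ e < N, g ≤ x e → x e < g + 2 → I' e = c ∧ F' e = x e - g)
    (hout : ∀ e < N, x e < g → I' e = I e ∧ F' e = F e)
    (hc : c < c') (hc' : c' ≤ c + 2) (hcg : Compat c g c' g')
    (hg : ∀ e < N, x e < g' ↔ x e < g + 2)
    (hp : (∀ e < N, x e < g') ∨ ∃ e < N, g' ≤ x e ∧ x e < g' + 2) :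
    AnchorInv N k (t + 1) x I' F' g' c' := by
  have hgg : g + 2 ≤ g' := by
    rcases Nat.lt_or_ge c' (c + 2) with h' | h'
    · rw [hcg.2.1 (by omega)]
    · linarith [hcg.2.2 h']
  have hlab : ∀ e < N, x e < g' →
      0 ≤ F' e ∧ F' e < 2 ∧ k ≤ I' e ∧ I' e < c' ∧ Compat (I' e) (x e - F' e) c' g' := by
    intro e he hx
    rcases lt_or_ge (x e) g with hxg | hxg
    · obtain ⟨h₁, h₂⟩ := hout e he hxg
      obtain ⟨h₃, h₄, h₅, h₆, h₇⟩ := h.label e he hxg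
      rw [h₁, h₂]
      refine ⟨h₃, h₄, h₅, by omega, by omega, by omega, fun _ => ?_⟩
      rcases Nat.lt_or_ge (I e + 1) c with h' | h'
      · linarith [h₇.2.2 (by omega)]
      · linarith [h₇.2.1 (by omega)]
    · obtain ⟨h₁, h₂⟩ := hin e he hxg ((hg e he).1 hx)
      have := (hg e he).1 hx
      rw [h₁, h₂, sub_sub_cancel]
      exact ⟨by linarith, by linarith, h.le_c, hc, hcg⟩
  refine ⟨by have := h.le_c; omega, by have := h.c_le; omega, hlab, ?_, ?_⟩
  · intro e he e' he' hx hx'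
    rcases lt_or_ge (x e) g with hxg | hxg
    · obtain ⟨h₁, h₂⟩ := hout e he hxg
      rcases lt_or_ge (x e') g with hxg' | hxg'
      · obtain ⟨h₃, h₄⟩ := hout e' he' hxg'
        rw [h₁, h₂, h₃, h₄]
        exact h.pair e he e' he' hxg hxg'
      · obtain ⟨h₃, h₄⟩ := hin e' he' hxg' ((hg e' he').1 hx')
        rw [h₁, h₂, h₃, h₄, sub_sub_cancel]
        exact (h.label e he hxg).2.2.2.2
    · obtain ⟨h₁, h₂⟩ := hin e he hxg ((hg e he).1 hx)
      rcases lt_or_ge (x e') g with hxg' | hxg'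
      · obtain ⟨h₃, h₄⟩ := hout e' he' hxg'
        have := (h.label e' he' hxg').2.2.2.1
        rw [h₁, h₂, h₃, h₄]
        exact ⟨by omega, by omega, by omega⟩
      · obtain ⟨h₃, h₄⟩ := hin e' he' hxg' ((hg e' he').1 hx')
        rw [h₁, h₂, h₃, h₄, sub_sub_cancel, sub_sub_cancel]
        exact ⟨by simp, by omega, by omega⟩
  · rcases hp with hp | hp
    · exact .inl hp
    · rcases h.progress with h' | ⟨h₁, e, he, h₂, h₃⟩
      · exact .inl fun e he => by linarith [h' e he]
      · refine .inr ⟨?_, hp⟩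
        -- The value `e` lies in the block that is now closed, so the count grows by at least one.
        have : {e ∈ Finset.range N | x e < g} ⊂ {e ∈ Finset.range N | x e < g'} := by
          refine Finset.ssubset_iff_subset_ne.2 ⟨?_, ?_⟩
          · intro e' he'
            simp only [Finset.mem_filter] at he' ⊢
            exact ⟨he'.1, by linarith [he'.2]⟩
          · intro heq
            have : e ∈ {e ∈ Finset.range N | x e < g} := by
              rw [heq]; simp [he]; linarith
            simp at this
            linarith [this.2]
        have := Finset.card_lt_card this
        omega

/-- The decomposition of the values in the real array `x` into blocks of length two, with block
indices (starting at `k`) in `I` and distances from the left end of the block in `F`. -/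
def anchorProg (k x I F : ℕ) : Prog :=
  let X : RealExpr := .read x (reg 3)
  let g : RealExpr := .read 8 (.const 0)
  let h : RealExpr := .read 9 (.const 0)
  let two : RealExpr := .add .one .one
  block [.setReal 8 (.const 0) (.read x (.const 0)),
    forUp 3 (reg 2) (.ite (.realLe X g) (.setReal 8 (.const 0) X) .skip),
    .setNat 7 (.const 0) (.const k),
    forUp 5 (reg 2) (block [
      .setNat 6 (.const 0) (.const 0),
      forUp 3 (reg 2) (block [
        .ite (.conj (.realLe g X) (.neg (.realLe (.add g two) X)))
          (block [.setNat I (reg 3) (reg 7), .setReal F (reg 3) (.sub X g)]) .skip,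
        .ite (.conj (.realLe (.add g two) X)
            (.neg (.conj (.natLe (.const 1) (reg 6)) (.realLe h X))))
          (block [.setReal 9 (.const 0) X, .setNat 6 (.const 0) (.const 1)]) .skip]),
      .ite (.natLe (.const 1) (reg 6))
        (.ite (.realLe (.add g (.add two two)) h)
          (block [.setReal 8 (.const 0) h, .setNat 7 (.const 0) (.add (reg 7) (.const 2))])
          (block [.setReal 8 (.const 0) (.add g two),
            .setNat 7 (.const 0) (.add (reg 7) (.const 1))]))
        (block [.setReal 8 (.const 0) (.add g (.add two two)),
          .setNat 7 (.const 0) (.add (reg 7) (.const 2))])])]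

/-- Outcome of one pass over the values with the current block starting at `g`: `f` tells whether
some value is beyond the block, and `h` is the smallest such value. -/
structure ScanInv (j : ℕ) (x : ℕ → ℝ) (g : ℝ) (c : ℕ) (I I' : ℕ → ℕ) (F F' : ℕ → ℝ) (f : ℕ)
    (h : ℝ) : Prop where
  inside : ∀ e < j, g ≤ x e → x e < g + 2 → I' e = c ∧ F' e = x e - g
  outside : ∀ e, x e < g → I' e = I e ∧ F' e = F e
  none : f = 0 → ∀ e < j, x e < g + 2
  found : 1 ≤ f → (∃ e < j, x e = h) ∧ g + 2 ≤ h ∧ ∀ e < j, g + 2 ≤ x e → h ≤ x e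

/-- Skipping empty stretches keeps the block indices linear in `N` however far apart the coordinates
are. Starting them at `k` later makes the subtraction of a shift below `k` harmless. -/
theorem wp_anchorProg {N k x I F : ℕ} (hx8 : x ≠ 8) (hx9 : x ≠ 9) (hxF : x ≠ F) (hF8 : F ≠ 8)
    (hF9 : F ≠ 9) (hI2 : I ≠ 2) (hI3 : I ≠ 3) (hI5 : I ≠ 5) (hI6 : I ≠ 6) (hI7 : I ≠ 7)
    (s : Store) (hN : s.nat 2 0 = N) (hR : N ≤ R) :
    Wp R (anchorProg k x I F) (fun s' => Frame {3, 5, 6, 7, I} {8, 9, F} s s' ∧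
      (∀ e < N, 0 ≤ s'.real F e ∧ s'.real F e < 2 ∧ k ≤ s'.nat I e ∧ s'.nat I e ≤ k + 2 * N) ∧
      ∀ e < N, ∀ e' < N, Compat (s'.nat I e) (s.real x e - s'.real F e) (s'.nat I e')
        (s.real x e' - s'.real F e')) s := by
  have frx : ∀ {s'}, Frame {3, 5, 6, 7, I} {8, 9, F} s s' → s'.real x = s.real x :=
    fun h => h.2 x (by simp [hx8, hx9, hxF])
  have frN : ∀ {s'}, Frame {3, 5, 6, 7, I} {8, 9, F} s s' → s'.nat 2 0 = N :=
    fun h => by rw [h.1 2 (by simp [hI2.symm]), hN]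
  refine wp_block_cons (wp_setReal (wp_block_cons ?_))
  -- The first block starts at the smallest value.
  refine wp_forUp (n := N) (fun t s' => Frame {3, 5, 6, 7, I} {8, 9, F} s s' ∧
    (0 < N → ∃ e < N, s'.real 8 0 = s.real x e) ∧ ∀ e < t, s'.real 8 0 ≤ s.real x e)
    hR ?_ ?_ ?_ ?_ ?_
  · exact ⟨(Frame.refl _ _ s).setReal (by simp), fun h => ⟨0, h, by simp⟩, by simp⟩
  · rintro i s' y ⟨h₁, h₂, h₃⟩
    exact ⟨h₁.setNat _ _ (by simp), by simpa using h₂, by simpa using h₃⟩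
  · rintro i s' ⟨h₁, -⟩
    exact frN h₁
  · rintro i s' hi ⟨h₁, h₂, h₃⟩ hr
    have ex := frx h₁
    refine wp_ite (fun hb => wp_setReal ?_) (fun hb => wp_skip ?_)
    · simp only [holds_realLe, real_eval_read, eval_reg, eval_const, hr, ex] at hb
      refine ⟨by simpa using hr, h₁.setReal (by simp), fun _ => ⟨i, hi, by simp [hr, ex]⟩, ?_⟩
      intro e he
      simp only [real_setReal, real_eval_read, eval_reg, hr, ex, eval_const, and_self, if_true]
      rcases Nat.lt_succ_iff_lt_or_eq.1 he with he | rfl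
      · exact hb.trans (h₃ e he)
      · exact le_rfl
    · simp only [holds_realLe, real_eval_read, eval_reg, eval_const, hr, ex] at hb
      refine ⟨hr, h₁, h₂, ?_⟩
      intro e he
      rcases Nat.lt_succ_iff_lt_or_eq.1 he with he | rfl
      · exact h₃ e he
      · exact (not_le.1 hb).le
  rintro s₁ ⟨h₁, h₂, h₃⟩
  refine wp_block_cons (wp_setNat (wp_block_cons ?_))
  refine wp_forUp (n := N) (fun t s' => Frame {3, 5, 6, 7, I} {8, 9, F} s s' ∧
    AnchorInv N k t (s.real x) (s'.nat I) (s'.real F) (s'.real 8 0) (s'.nat 7 0))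
    hR ?_ ?_ ?_ ?_ ?_
  · refine ⟨h₁.setNat _ _ (by simp), by simp, by simp, ?_, ?_, ?_⟩
    · intro e he hx
      exact absurd (h₃ e he) (by simpa using hx)
    · intro e he e' he' hx
      exact absurd (h₃ e he) (by simpa using hx)
    · rcases Nat.eq_zero_or_pos N with rfl | hpos
      · exact .inl (by simp)
      · obtain ⟨e, he, hge⟩ := h₂ hpos
        exact .inr ⟨by simp, e, he, by simp [hge]⟩
  · rintro i s' y ⟨h₁, h₂⟩
    exact ⟨h₁.setNat _ _ (by simp), by
      rw [nat_setNat_of_ne _ _ _ hI5]; simpa using h₂⟩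
  · rintro i s' ⟨h₁, -⟩
    exact frN h₁
  · rintro t s₂ ht ⟨f₂, inv⟩ hr₂
    refine wp_block_cons (wp_setNat (wp_block_cons ?_))
    refine wp_forUp (n := N) (fun j s' => Frame {3, 5, 6, 7, I} {8, 9, F} s s' ∧
      s'.nat 5 0 = t ∧ s'.nat 7 0 = s₂.nat 7 0 ∧ s'.real 8 0 = s₂.real 8 0 ∧
      ScanInv j (s.real x) (s₂.real 8 0) (s₂.nat 7 0) (s₂.nat I) (s'.nat I) (s₂.real F)
        (s'.real F) (s'.nat 6 0) (s'.real 9 0)) hR ?_ ?_ ?_ ?_ ?_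
    · refine ⟨f₂.setNat _ _ (by simp), by simp [hr₂], by simp, by simp, by simp, ?_, by simp,
        by simp⟩
      intro e _
      simp [hI6]
    · rintro i s' y ⟨f₁, g₁, g₂, g₃, g₄⟩
      refine ⟨f₁.setNat _ _ (by simp), by simpa using g₁, by simpa using g₂, by simpa using g₃, ?_⟩
      rw [nat_setNat_of_ne _ _ _ hI3]
      simpa using g₄
    · rintro i s' ⟨f₁, -⟩
      exact frN f₁
    · rintro j s₃ hj ⟨f₃, g₁, g₂, g₃, sc⟩ hr₃
      have ex := frx f₃
      refine wp_block_cons (Wp.mono (Q := fun s' => Frame {3, 5, 6, 7, I} {8, 9, F} s s' ∧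
        s'.nat 5 0 = t ∧ s'.nat 7 0 = s₂.nat 7 0 ∧ s'.real 8 0 = s₂.real 8 0 ∧ s'.nat 3 0 = j ∧
        s'.nat 6 0 = s₃.nat 6 0 ∧ s'.real 9 0 = s₃.real 9 0 ∧
        (∀ e < j + 1, s₂.real 8 0 ≤ s.real x e → s.real x e < s₂.real 8 0 + 2 →
          s'.nat I e = s₂.nat 7 0 ∧ s'.real F e = s.real x e - s₂.real 8 0) ∧
        (∀ e, s.real x e < s₂.real 8 0 → s'.nat I e = s₂.nat I e ∧ s'.real F e = s₂.real F e)) ?_ ?_)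
      · refine wp_ite (fun hb => ?_) (fun hb => wp_skip ?_)
        · simp only [holds_conj, holds_realLe, real_eval_read, eval_reg, eval_const, hr₃, ex, g₃,
            holds_neg, real_eval_add, real_eval_one] at hb
          refine wp_block_cons (wp_setNat (wp_block_cons (wp_setReal (wp_block_nil ?_))))
          refine ⟨(f₃.setNat _ _ (by simp)).setReal (by simp), by simp [hI5.symm, g₁],
            by simp [hI7.symm, g₂], by simp [hF8.symm, g₃], by simp [hI3.symm, hr₃],
            by simp [hI6.symm], by simp [hF9.symm], ?_, ?_⟩
          · intro e he h₄ h₅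
            by_cases hej : e = j
            · subst hej; simp [hr₃, g₂, g₃, ex, hI3.symm]
            · have := sc.inside e (by omega) h₄ h₅
              simpa [hr₃, hej, hI3.symm] using this
          · intro e h₄
            have hej : e ≠ j := by rintro rfl; linarith [hb.1]
            simpa [hr₃, hej, hI3.symm] using sc.outside e h₄
        · simp only [holds_conj, holds_realLe, real_eval_read, eval_reg, eval_const, hr₃, ex, g₃,
            holds_neg, real_eval_add, real_eval_one] at hb
          refine ⟨f₃, g₁, g₂, g₃, hr₃, rfl, rfl, ?_, sc.outside⟩
          intro e he h₄ h₅
          by_cases hej : e = j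
          · subst hej
            exact absurd ⟨h₄, by rw [not_le]; linarith⟩ hb
          · exact sc.inside e (by omega) h₄ h₅
      · rintro s₄ ⟨f₄, q₁, q₂, q₃, q₄, q₅, q₆, q₇, q₈⟩
        have ex := frx f₄
        refine wp_block_cons (wp_ite (fun hb => ?_) (fun hb => wp_skip (wp_block_nil ?_)))
        · refine wp_block_cons (wp_setReal (wp_block_cons (wp_setNat
            (wp_block_nil (wp_block_nil ?_)))))
          simp only [holds_conj, holds_realLe, real_eval_read, eval_reg, eval_const, q₄, ex, q₃,
            holds_neg, real_eval_add, real_eval_one, q₅, q₆, holds_natLe] at hb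
          refine ⟨by simp [q₄], (f₄.setReal (by simp)).setNat _ _ (by simp), by simp [q₁],
            by simp [q₂], by simp [q₃], ?_, ?_, by simp, ?_⟩
          · intro e he h₄ h₅
            simpa [hI6, hF9] using q₇ e he h₄ h₅
          · intro e h₄
            simpa [hI6, hF9] using q₈ e h₄
          · intro _
            simp only [real_setNat, real_setReal, and_self, if_true, real_eval_read, eval_reg, q₄,
              ex, eval_const]
            refine ⟨⟨j, by omega, rfl⟩, by linarith [hb.1], ?_⟩
            intro e he h₄
            rcases Nat.lt_succ_iff_lt_or_eq.1 he with he | rfl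
            · by_cases hf : 1 ≤ s₃.nat 6 0
              · have h₅ : ¬ s₃.real 9 0 ≤ s.real x j := fun h => hb.2 ⟨hf, h⟩
                linarith [(sc.found hf).2.2 e he h₄]
              · linarith [sc.none (by omega) e he]
            · exact le_rfl
        · simp only [holds_conj, holds_realLe, real_eval_read, eval_reg, eval_const, q₄, ex, q₃,
            holds_neg, real_eval_add, real_eval_one, q₅, q₆, holds_natLe] at hb
          refine ⟨q₄, f₄, q₁, q₂, q₃, q₇, q₈, ?_, ?_⟩
          · intro hf e he
            rw [q₅] at hf
            rcases Nat.lt_succ_iff_lt_or_eq.1 he with he | rfl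
            · exact sc.none hf e he
            · by_contra hcon
              exact hb ⟨by linarith, by omega⟩
          · intro hf
            rw [q₅] at hf
            rw [q₆]
            obtain ⟨⟨e, he, h₄⟩, h₅, h₆⟩ := sc.found hf
            refine ⟨⟨e, by omega, h₄⟩, h₅, ?_⟩
            intro e he h₇
            rcases Nat.lt_succ_iff_lt_or_eq.1 he with he | rfl
            · exact h₆ e he h₇
            · by_contra hcon
              exact hb ⟨by linarith, fun h => hcon h.2⟩
    · rintro s₃ ⟨f₃, g₁, g₂, g₃, sc⟩
      refine wp_block_cons (wp_ite (fun hb => wp_ite (fun hb' => ?_) (fun hb' => ?_)) (fun hb => ?_))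
      all_goals
        refine wp_block_cons (wp_setReal (wp_block_cons (wp_setNat
            (wp_block_nil (wp_block_nil ⟨by simp [g₁],
              (f₃.setReal (by simp)).setNat _ _ (by simp), ?_⟩)))))
        simp only [holds_natLe, eval_reg, eval_const] at hb
        simp only [nat_setNat_of_ne _ _ _ hI7, real_setNat, real_setReal_of_ne _ _ _ hF8, nat_setNat,
          nat_setReal, real_setReal, and_self, if_true, eval_reg, real_eval_read, real_eval_add,
          real_eval_one, eval_const, eval_add, g₂, g₃]
      -- The next value is at least `g + 4`: a fresh block starts there, and the index jumps by two.
      · simp only [holds_realLe, real_eval_read, eval_const, real_eval_add, real_eval_one, g₃] at hb'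
        obtain ⟨⟨e, he, h₄⟩, h₅, h₆⟩ := sc.found hb
        refine inv.step sc.inside (fun e _ => sc.outside e) (by omega) (by omega)
          ⟨by omega, by omega, fun _ => by linarith⟩ ?_ (.inr ⟨e, he, by rw [h₄], by linarith⟩)
        intro e he
        constructor
        · intro h
          by_contra hcon
          linarith [h₆ e he (by linarith)]
        · intro h
          linarith
      -- The next value is below `g + 4`: it falls into the adjacent block at `g + 2`.
      · simp only [holds_realLe, real_eval_read, eval_const, real_eval_add, real_eval_one, g₃] at hb'
        obtain ⟨⟨e, he, h₄⟩, h₅, h₆⟩ := sc.found hb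
        refine inv.step sc.inside (fun e _ => sc.outside e) (by omega) (by omega)
          ⟨by omega, fun _ => by ring, by omega⟩ ?_ (.inr ⟨e, he, by linarith, by linarith⟩)
        intro e he
        constructor <;> intro h <;> linarith
      -- No value is left beyond the block; `g + 4` only has to exceed them all.
      · have := sc.none (by omega)
        refine inv.step sc.inside (fun e _ => sc.outside e) (by omega) (by omega)
          ⟨by omega, by omega, fun _ => by linarith⟩ ?_ (.inl fun e he => by linarith [this e he])
        intro e he
        constructor <;> intro h <;> linarith [this e he]
  · rintro s' ⟨f₁, inv⟩
    have hall : ∀ e < N, s.real x e < s'.real 8 0 := by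
      rcases inv.progress with h | ⟨h, -⟩
      · exact h
      · have h₅ : {e ∈ Finset.range N | s.real x e < s'.real 8 0} = Finset.range N :=
          Finset.eq_of_subset_of_card_le (Finset.filter_subset _ _) (by simpa using h)
        intro e he
        have : e ∈ {e ∈ Finset.range N | s.real x e < s'.real 8 0} := by rw [h₅]; simpa using he
        exact (Finset.mem_filter.1 this).2
    refine wp_block_nil ⟨f₁, fun e he => ?_, fun e he e' he' => ?_⟩
    · obtain ⟨h₁, h₂, h₃, h₄, -⟩ := inv.label e he (hall e he)
      have := inv.c_le
      exact ⟨h₁, h₂, h₃, by omega⟩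
    · exact inv.pair e he e' he' (hall e he) (hall e' he')

end UniqueSquareCover

/-! ### The sweep order, and incidence in terms of ranks -/

namespace UniqueSquareCover

variable {R : ℕ}

/-- The order of the sweep: by the position in the block, then by decreasing block index, then by
index. -/
def Prec (F : ℕ → ℝ) (I : ℕ → ℕ) (e' e : ℕ) : Prop :=
  F e' < F e ∨ (F e' = F e ∧ (I e < I e' ∨ (I e = I e' ∧ e' < e)))

theorem Prec.irrefl {F : ℕ → ℝ} {I : ℕ → ℕ} (e : ℕ) : ¬ Prec F I e e := by
  simp [Prec]

theorem Prec.trans {F : ℕ → ℝ} {I : ℕ → ℕ} {a b c : ℕ} (h : Prec F I a b) (h' : Prec F I b c) :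
    Prec F I a c := by
  rcases h with h | ⟨h₁, h₂⟩ <;> rcases h' with h' | ⟨h₃, h₄⟩
  · exact .inl (h.trans h')
  · exact .inl (h₃ ▸ h)
  · exact .inl (h₁ ▸ h')
  · exact .inr ⟨h₁.trans h₃, by omega⟩

theorem Prec.trichotomy (F : ℕ → ℝ) (I : ℕ → ℕ) (a b : ℕ) : Prec F I a b ∨ a = b ∨ Prec F I b a := by
  rcases lt_trichotomy (F a) (F b) with h | h | h
  · exact .inl (.inl h)
  · have : (I b < I a ∨ (I b = I a ∧ a < b)) ∨ a = b ∨ (I a < I b ∨ (I a = I b ∧ b < a)) := by omega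
    rcases this with h' | h' | h'
    · exact .inl (.inr ⟨h, h'⟩)
    · exact .inr (.inl h')
    · exact .inr (.inr (.inr ⟨h.symm, h'⟩))
  · exact .inr (.inr (.inl h))

open Classical in
/-- The position of `e` in the order of the sweep. -/
noncomputable def rankOf (N : ℕ) (F : ℕ → ℝ) (I : ℕ → ℕ) (e : ℕ) : ℕ :=
  {e' ∈ Finset.range N | Prec F I e' e}.card

theorem rankOf_lt_of_prec {N : ℕ} {F : ℕ → ℝ} {I : ℕ → ℕ} {a b : ℕ} (ha : a < N)
    (h : Prec F I a b) : rankOf N F I a < rankOf N F I b := by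
  classical
  refine Finset.card_lt_card (Finset.ssubset_iff_subset_ne.2 ⟨fun e he => ?_, fun heq => ?_⟩)
  · simp only [Finset.mem_filter] at he ⊢
    exact ⟨he.1, he.2.trans h⟩
  · have : a ∈ {e' ∈ Finset.range N | Prec F I e' a} := by rw [heq]; simp [ha, h]
    exact Prec.irrefl a (Finset.mem_filter.1 this).2

theorem rankOf_lt_iff {N : ℕ} {F : ℕ → ℝ} {I : ℕ → ℕ} {a b : ℕ} (ha : a < N) (hb : b < N) :
    rankOf N F I a < rankOf N F I b ↔ Prec F I a b := by
  refine ⟨fun h => ?_, rankOf_lt_of_prec ha⟩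
  rcases Prec.trichotomy F I a b with h' | rfl | h'
  · exact h'
  · omega
  · have := rankOf_lt_of_prec hb h'
    omega

theorem rankOf_inj {N : ℕ} {F : ℕ → ℝ} {I : ℕ → ℕ} {a b : ℕ} (ha : a < N) (hb : b < N)
    (h : rankOf N F I a = rankOf N F I b) : a = b := by
  rcases Prec.trichotomy F I a b with h' | rfl | h'
  · have := rankOf_lt_of_prec ha h'; omega
  · rfl
  · have := rankOf_lt_of_prec hb h'; omega

theorem rankOf_lt {N : ℕ} {F : ℕ → ℝ} {I : ℕ → ℕ} {a : ℕ} (ha : a < N) : rankOf N F I a < N := by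
  classical
  have : {e' ∈ Finset.range N | Prec F I e' a} ⊂ Finset.range N := by
    refine Finset.ssubset_iff_subset_ne.2 ⟨Finset.filter_subset _ _, fun heq => ?_⟩
    have : a ∈ {e' ∈ Finset.range N | Prec F I e' a} := by rw [heq]; simpa using ha
    exact Prec.irrefl a (Finset.mem_filter.1 this).2
  simpa [rankOf] using Finset.card_lt_card this

theorem exists_rankOf_eq {N : ℕ} (F : ℕ → ℝ) (I : ℕ → ℕ) {t : ℕ} (ht : t < N) :
    ∃ e < N, rankOf N F I e = t := by
  have : Finset.image (rankOf N F I) (Finset.range N) = Finset.range N := by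
    refine Finset.eq_of_subset_of_card_le ?_ ?_
    · intro e he
      obtain ⟨a, ha, rfl⟩ := Finset.mem_image.1 he
      simpa using rankOf_lt (by simpa using ha)
    · rw [Finset.card_image_of_injOn]
      intro a ha b hb h
      exact rankOf_inj (by simpa using ha) (by simpa using hb) h
  have h : t ∈ Finset.image (rankOf N F I) (Finset.range N) := by rw [this]; simpa using ht
  obtain ⟨e, he, h⟩ := Finset.mem_image.1 h
  exact ⟨e, by simpa using he, h⟩

/-- Compute the positions in the order of the sweep, and the inverse permutation. -/
def rankProg (F I τ o : ℕ) : Prog :=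
  forUp 3 (reg 2) (block [.setNat 6 (.const 0) (.const 0),
    forUp 4 (reg 2) (.ite
      (.or (.neg (.realLe (.read F (reg 3)) (.read F (reg 4))))
        (.conj (.conj (.realLe (.read F (reg 4)) (.read F (reg 3)))
            (.realLe (.read F (reg 3)) (.read F (reg 4))))
          (.or (.lt (.read I (reg 3)) (.read I (reg 4)))
            (.conj (.eq (.read I (reg 3)) (.read I (reg 4))) (.lt (reg 4) (reg 3))))))
      (.setNat 6 (.const 0) (.add (reg 6) (.const 1))) .skip),
    .setNat τ (reg 3) (reg 6), .setNat o (reg 6) (reg 3)])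

/-- Counting predecessors replaces sorting; since ranks are distinct, writing the inverse
permutation never overwrites an earlier entry. -/
theorem wp_rankProg {N F I τ o : ℕ} (hI : I ∉ ({3, 4, 6, τ, o} : Set ℕ)) (hτo : τ ≠ o)
    (hτ : τ ∉ ({2, 3, 4, 6} : Set ℕ)) (ho : o ∉ ({2, 3, 4, 6} : Set ℕ))
    (s : Store) (hN : s.nat 2 0 = N) (hR : N ≤ R) :
    Wp R (rankProg F I τ o) (fun s' => Frame {3, 4, 6, τ, o} ∅ s s' ∧
      ∀ e < N, s'.nat τ e = rankOf N (s.real F) (s.nat I) e ∧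
        s'.nat o (rankOf N (s.real F) (s.nat I) e) = e) s := by
  classical
  simp only [Set.mem_insert_iff, Set.mem_singleton_iff, not_or] at hτ ho
  obtain ⟨hτ2, hτ3, hτ4, hτ6⟩ := hτ
  obtain ⟨ho2, ho3, ho4, ho6⟩ := ho
  have frN : ∀ {s'}, Frame {3, 4, 6, τ, o} ∅ s s' → s'.nat 2 0 = N :=
    fun h => by rw [h.1 2 (by simp [Ne.symm hτ2, Ne.symm ho2]), hN]
  refine wp_forUp (n := N) (fun t s' => Frame {3, 4, 6, τ, o} ∅ s s' ∧
      ∀ e < t, s'.nat τ e = rankOf N (s.real F) (s.nat I) e ∧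
        s'.nat o (rankOf N (s.real F) (s.nat I) e) = e) hR
    ⟨Frame.refl _ _ _, by simp⟩ ?_ (fun i s' h => frN h.1) ?_ (fun s h => h)
  · rintro i s' x ⟨h₁, h₂⟩
    exact ⟨h₁.setNat _ _ (by simp), by simpa [hτ3, ho3] using h₂⟩
  rintro e s₁ he ⟨h₁, h₂⟩ hr₁
  refine wp_block_cons (wp_setNat (wp_block_cons ?_))
  refine wp_forUp (n := N) (fun j s' => Frame {3, 4, 6, τ, o} ∅ s s' ∧ s'.nat 3 0 = e ∧
      s'.nat τ = s₁.nat τ ∧ s'.nat o = s₁.nat o ∧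
      s'.nat 6 0 = {e' ∈ Finset.range j | Prec (s.real F) (s.nat I) e' e}.card) hR
    ?_ ?_ (fun i s' h => frN h.1) ?_ ?_
  · refine ⟨h₁.setNat _ _ (by simp), by simp [hr₁], ?_, ?_, by simp⟩
    · rw [nat_setNat_of_ne _ _ _ hτ6]
    · rw [nat_setNat_of_ne _ _ _ ho6]
  · rintro j s' x ⟨g₁, g₂, g₃, g₄, g₅⟩
    refine ⟨g₁.setNat _ _ (by simp), by simpa using g₂, ?_, ?_, by simpa using g₅⟩
    · rw [nat_setNat_of_ne _ _ _ hτ4, g₃]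
    · rw [nat_setNat_of_ne _ _ _ ho4, g₄]
  · rintro j s₂ hj ⟨g₁, g₂, g₃, g₄, g₅⟩ hr₂
    have eF := g₁.2 F (by simp)
    have eI := g₁.1 I hI
    have hcard : {e' ∈ Finset.range (j + 1) | Prec (s.real F) (s.nat I) e' e}.card =
        {e' ∈ Finset.range j | Prec (s.real F) (s.nat I) e' e}.card +
          if Prec (s.real F) (s.nat I) j e then 1 else 0 := by
      rw [Finset.range_add_one, Finset.filter_insert]
      split_ifs <;> simp
    refine wp_ite (fun hb => wp_setNat ?_) (fun hb => wp_skip ?_)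
    all_goals
      simp only [holds_or, holds_neg, holds_realLe, real_eval_read, eval_reg, g₂, hr₂, eF, not_le,
        holds_conj, ← le_antisymm_iff, holds_lt, holds_eq, eval_read, eI] at hb
    · change Prec (s.real F) (s.nat I) j e at hb
      refine ⟨by simpa using hr₂, g₁.setNat _ _ (by simp), by simpa using g₂, ?_, ?_, ?_⟩
      · rw [nat_setNat_of_ne _ _ _ hτ6, g₃]
      · rw [nat_setNat_of_ne _ _ _ ho6, g₄]
      · simp [hcard, hb, g₅]
    · change ¬ Prec (s.real F) (s.nat I) j e at hb
      refine ⟨hr₂, g₁, g₂, g₃, g₄, ?_⟩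
      simp [hcard, hb, g₅]
  · rintro s₂ ⟨g₁, g₂, g₃, g₄, g₅⟩
    change _ = rankOf N _ _ e at g₅
    refine wp_block_cons (wp_setNat (wp_block_cons (wp_setNat (wp_block_nil ?_))))
    refine ⟨by simp [Ne.symm hτ3, Ne.symm ho3, g₂], (g₁.setNat _ _ (by simp)).setNat _ _ (by simp),
      ?_⟩
    intro e' he'
    simp only [nat_setNat, hτo, false_and, if_false, eval_reg, g₂, g₅, true_and, Ne.symm hτ3,
      Ne.symm hτ6, hτo.symm]
    by_cases hee : e' = e
    · subst hee; simp
    · have hne : rankOf N (s.real F) (s.nat I) e' ≠ rankOf N (s.real F) (s.nat I) e :=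
        fun h => hee (rankOf_inj (by omega) he h)
      have := h₂ e' (by omega)
      simpa [hee, hne, g₃, g₄] using this

/-- Incidence in one coordinate, expressed by block indices and positions in the sweep. -/
def Meets (aQ tQ aP tP : ℕ) : Prop := (aP = aQ ∧ tQ < tP) ∨ (aP = aQ + 1 ∧ tP < tQ)

/-- In the same block the square covers iff its offset is at most that of the point, in the next
block iff it is at least that; other blocks are out of reach. Squares are closed, so equal offsets
must count as incidence in both cases. In the same block, the index breaks the tie, and squares are
numbered before points (`hjp`); otherwise the larger block index comes first, which puts the point
before the square. -/
theorem abs_sub_le_half_iff_meets {N : ℕ} {x F : ℕ → ℝ} {I : ℕ → ℕ} {j p : ℕ} {c q : ℝ}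
    (hjp : j < p) (hp : p < N) (hF : ∀ e < N, 0 ≤ F e ∧ F e < 2)
    (hI : ∀ e < N, ∀ e' < N, Compat (I e) (x e - F e) (I e') (x e' - F e'))
    (hj : x j = c + c - 1) (hq : x p = q + q) :
    |q - c| ≤ 1 / 2 ↔ Meets (I j) (rankOf N F I j) (I p) (rankOf N F I p) := by
  have hjN : j < N := hjp.trans hp
  rw [Meets, rankOf_lt_iff hjN hp, rankOf_lt_iff hp hjN, abs_le]
  have h₁ := hI j hjN p hp
  have h₂ := hI p hp j hjN
  have h₃ := hF j hjN
  have h₄ := hF p hp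
  unfold Prec
  rcases lt_trichotomy (I p) (I j) with h | h | h
  · have : ¬ (-(1 / 2) ≤ q - c) := by
      rcases Nat.lt_or_ge (I p + 1) (I j) with h' | h'
      · linarith [h₂.2.2 (by omega)]
      · linarith [h₂.2.1 (by omega)]
    constructor
    · exact fun h' => absurd h'.1 this
    · omega
  · have h₅ := h₁.1 h.symm
    have e₁ : I j = I p ∧ j < p := ⟨h.symm, hjp⟩
    have e₂ : I p ≠ I j + 1 := by omega
    simp only [h, true_and, lt_irrefl, hjp, and_true, false_or]
    constructor
    · rintro ⟨h₆, h₇⟩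
      left
      exact lt_or_eq_of_le (by linarith)
    · rintro (h₆ | ⟨h₆, -⟩)
      · have : F j ≤ F p := by rcases h₆ with h₆ | h₆ <;> linarith
        constructor <;> linarith
      · omega
  · rcases Nat.lt_or_ge (I j + 1) (I p) with h' | h'
    · have := h₁.2.2 (by omega)
      constructor
      · rintro ⟨h₆, h₇⟩; linarith
      · omega
    · have h₅ := h₁.2.1 (by omega)
      constructor
      · rintro ⟨h₆, h₇⟩
        refine .inr ⟨by omega, ?_⟩
        rcases lt_or_eq_of_le (show F p ≤ F j by linarith) with h₈ | h₈
        · exact .inl h₈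
        · exact .inr ⟨h₈, .inl h⟩
      · rintro (h₆ | ⟨-, h₆⟩)
        · omega
        · have : F p ≤ F j := by rcases h₆ with h₆ | h₆ <;> linarith
          constructor <;> linarith

/-- Replace the coordinates by block indices and positions in the sweep. -/
def normProg (k : ℕ) : Prog :=
  block [loadProg, anchorProg k 4 10 6, anchorProg k 5 13 7, rankProg 6 10 11 12,
    rankProg 7 13 14 15]

/-- The arrays of `s` describe the combinatorial structure of the instance with `n` points and
`m` squares whose coordinates are `px`, `py`, `cx`, `cy`. -/
structure Normalized (k n m : ℕ) (px py cx cy : ℕ → ℝ) (s : Store) : Prop where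
  size : s.nat 2 0 = n + m
  blockX : ∀ e < n + m, k ≤ s.nat 10 e ∧ s.nat 10 e ≤ k + 2 * (n + m)
  blockY : ∀ e < n + m, k ≤ s.nat 13 e ∧ s.nat 13 e ≤ k + 2 * (n + m)
  rankX : ∀ e < n + m, s.nat 11 e < n + m ∧ s.nat 12 (s.nat 11 e) = e
  exists_rankX : ∀ t < n + m, ∃ e < n + m, s.nat 11 e = t
  rankY : ∀ e < n + m, s.nat 14 e < n + m
  meetsX : ∀ j < m, ∀ i < n, |px i - cx j| ≤ 1 / 2 ↔
    Meets (s.nat 10 j) (s.nat 11 j) (s.nat 10 (m + i)) (s.nat 11 (m + i))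
  meetsY : ∀ j < m, ∀ i < n, |py i - cy j| ≤ 1 / 2 ↔
    Meets (s.nat 13 j) (s.nat 14 j) (s.nat 13 (m + i)) (s.nat 14 (m + i))

theorem wp_normProg {k n m : ℕ} (s : Store) (hn : s.nat 0 0 = n) (hm : s.nat 0 1 = m)
    (hR : n + m ≤ R) :
    Wp R (normProg k) (fun s' => Frame {a | 2 ≤ a ∧ a < 16} Set.univ s s' ∧
      Normalized k n m (s.real 0) (s.real 1) (s.real 2) (s.real 3) s') s := by
  refine wp_block_cons ((wp_loadProg s hn hm hR).mono ?_)
  rintro s₁ ⟨f₁, hN₁, hD, hP⟩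
  refine wp_block_cons ((wp_anchorProg (by simp) (by simp) (by simp) (by simp) (by simp) (by simp)
    (by simp) (by simp) (by simp) (by simp) s₁ hN₁ hR).mono ?_)
  rintro s₂ ⟨f₂, a₁, a₂⟩
  have hN₂ : s₂.nat 2 0 = n + m := by rw [f₂.1 2 (by simp), hN₁]
  refine wp_block_cons ((wp_anchorProg (by simp) (by simp) (by simp) (by simp) (by simp) (by simp)
    (by simp) (by simp) (by simp) (by simp) s₂ hN₂ hR).mono ?_)
  rintro s₃ ⟨f₃, b₁, b₂⟩
  have hN₃ : s₃.nat 2 0 = n + m := by rw [f₃.1 2 (by simp), hN₂]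
  refine wp_block_cons ((wp_rankProg (by simp) (by simp) (by simp) (by simp) s₃ hN₃ hR).mono ?_)
  rintro s₄ ⟨f₄, c₁⟩
  have hN₄ : s₄.nat 2 0 = n + m := by rw [f₄.1 2 (by simp), hN₃]
  refine wp_block_cons ((wp_rankProg (by simp) (by simp) (by simp) (by simp) s₄ hN₄ hR).mono ?_)
  rintro s₅ ⟨f₅, d₁⟩
  have e1 : s₅.nat 10 = s₂.nat 10 := by
    rw [f₅.1 10 (by simp), f₄.1 10 (by simp), f₃.1 10 (by simp)]
  have e2 : s₅.nat 13 = s₃.nat 13 := by rw [f₅.1 13 (by simp), f₄.1 13 (by simp)]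
  have e3 : s₅.nat 11 = s₄.nat 11 := f₅.1 11 (by simp)
  have e4 : s₅.nat 12 = s₄.nat 12 := f₅.1 12 (by simp)
  have e5 : s₃.nat 10 = s₂.nat 10 := f₃.1 10 (by simp)
  have e6 : s₃.real 6 = s₂.real 6 := f₃.2 6 (by simp)
  have e7 : s₄.real 7 = s₃.real 7 := f₄.2 7 (by simp)
  have e8 : s₄.nat 13 = s₃.nat 13 := f₄.1 13 (by simp)
  have e9 : s₂.real 5 = s₁.real 5 := f₂.2 5 (by simp)
  rw [e5, e6] at c₁
  rw [e7, e8] at d₁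
  rw [e9] at b₂
  refine wp_block_nil ⟨?_, ?_, ?_, ?_, ?_, ?_, ?_, ?_, ?_⟩
  · refine ((((f₁.mono ?_ ?_).trans (f₂.mono ?_ ?_)).trans (f₃.mono ?_ ?_)).trans
      (f₄.mono ?_ ?_)).trans (f₅.mono ?_ ?_) <;>
    simp [Set.insert_subset_iff]
  · rw [f₅.1 2 (by simp), hN₄]
  · intro e he
    rw [e1]; exact ⟨(a₁ e he).2.2.1, (a₁ e he).2.2.2⟩
  · intro e he
    rw [e2]; exact ⟨(b₁ e he).2.2.1, (b₁ e he).2.2.2⟩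
  · intro e he
    rw [e3, e4, (c₁ e he).1]
    exact ⟨rankOf_lt he, (c₁ e he).2⟩
  · intro t ht
    obtain ⟨e, he, h⟩ := exists_rankOf_eq (s₂.real 6) (s₂.nat 10) ht
    exact ⟨e, he, by rw [e3, (c₁ e he).1, h]⟩
  · intro e he
    rw [(d₁ e he).1]
    exact rankOf_lt he
  · intro j hj i hi
    rw [e1, e3, (c₁ j (by omega)).1, (c₁ (m + i) (by omega)).1]
    exact abs_sub_le_half_iff_meets (x := s₁.real 4) (by omega) (by omega)
      (fun e he => ⟨(a₁ e he).1, (a₁ e he).2.1⟩) a₂ (hD j hj).1 (hP i hi).1 |>.trans (by rfl)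
  · intro j hj i hi
    rw [e2, (d₁ j (by omega)).1, (d₁ (m + i) (by omega)).1]
    exact abs_sub_le_half_iff_meets (x := s₁.real 5) (by omega) (by omega)
      (fun e he => ⟨(b₁ e he).1, (b₁ e he).2.1⟩) b₂ (hD j hj).2 (hP i hi).2

end UniqueSquareCover

namespace UniqueSquareCover

variable {R : ℕ}

/-! ## Longest paths in layered graphs -/

/-- `π` is a path through the layers `0, …, L`, each with the vertices `0, …, M - 1`. -/
def IsPath (M L : ℕ) (E : ℕ → ℕ → ℕ → Prop) (π : ℕ → ℕ) : Prop :=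
  (∀ l ≤ L, π l < M) ∧ ∀ l < L, E l (π l) (π (l + 1))

open Classical in
/-- The number of vertices on the path that satisfy `W`. -/
noncomputable def pathWeight (L : ℕ) (W : ℕ → ℕ → Prop) (π : ℕ → ℕ) : ℕ :=
  {l ∈ Finset.range L | W l (π l)}.card

open Classical in
/-- The weight of a single vertex. -/
noncomputable def vertexWeight (W : ℕ → ℕ → Prop) (l u : ℕ) : ℕ := if W l u then 1 else 0

theorem pathWeight_succ (L : ℕ) (W : ℕ → ℕ → Prop) (π : ℕ → ℕ) :
    pathWeight (L + 1) W π = pathWeight L W π + vertexWeight W L (π L) := by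
  classical
  rw [pathWeight, Finset.range_add_one, Finset.filter_insert]
  unfold vertexWeight pathWeight
  split_ifs <;> simp

theorem cell_inj {M l l' u u' : ℕ} (hu : u < M) (hu' : u' < M) (h : l * M + u = l' * M + u') :
    l = l' ∧ u = u' := by
  have h₁ : u = u' := by
    have := congrArg (· % M) h
    simpa [Nat.mul_add_mod_of_lt hu, Nat.mul_add_mod_of_lt hu'] using this
  subst h₁
  exact ⟨Nat.eq_of_mul_eq_mul_right (by omega) (Nat.add_right_cancel h), rfl⟩

/-- `V (l * M + u)` is `0` if no path to the vertex `u` in layer `l` is known, and otherwise one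
more than the largest known weight of such a path; `bp` holds the predecessors. -/
structure TableInv (M : ℕ) (E : ℕ → ℕ → ℕ → Prop) (W : ℕ → ℕ → Prop) (V bp : ℕ → ℕ)
    (done : ℕ → ℕ → ℕ → Prop) : Prop where
  base : ∀ u < M, V u = 1
  sound : ∀ l, ∀ v < M, 1 ≤ V ((l + 1) * M + v) →
    bp ((l + 1) * M + v) < M ∧ E l (bp ((l + 1) * M + v)) v ∧
    1 ≤ V (l * M + bp ((l + 1) * M + v)) ∧
    V ((l + 1) * M + v) ≤
      V (l * M + bp ((l + 1) * M + v)) + vertexWeight W l (bp ((l + 1) * M + v))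
  complete : ∀ l, ∀ u < M, ∀ v < M, done l u v → E l u v → 1 ≤ V (l * M + u) →
    V (l * M + u) + vertexWeight W l u ≤ V ((l + 1) * M + v)

section Table

variable {M L : ℕ} {E : ℕ → ℕ → ℕ → Prop} {W : ℕ → ℕ → Prop} {V bp : ℕ → ℕ}
  {done done' : ℕ → ℕ → ℕ → Prop}

theorem TableInv.mono (h : TableInv M E W V bp done)
    (hd : ∀ l, ∀ u < M, ∀ v < M, done' l u v → done l u v) : TableInv M E W V bp done' :=
  ⟨h.base, h.sound, fun l u hu v hv hdone => h.complete l u hu v hv (hd l u hu v hv hdone)⟩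

/-- Edges treated so far start in layers up to `l`, so raising a value in layer `l + 1` leaves their
sources unchanged and preserves `complete`; `sound` survives because values only grow. -/
theorem TableInv.relax (h : TableInv M E W V bp done) {l u v : ℕ} (hu : u < M) (hv : v < M)
    (hdone : ∀ l' u' v', done l' u' v' → l' ≤ l)
    (hE : E l u v) (hV : 1 ≤ V (l * M + u))
    (hlt : V ((l + 1) * M + v) < V (l * M + u) + vertexWeight W l u) :
    TableInv M E W
      (fun j => if j = (l + 1) * M + v then V (l * M + u) + vertexWeight W l u else V j)
      (fun j => if j = (l + 1) * M + v then u else bp j)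
      (fun l' u' v' => done l' u' v' ∨ (l' = l ∧ u' = u ∧ v' = v)) := by
  have key : ∀ l' u', u' < M →
      V (l' * M + u') ≤ (if l' * M + u' = (l + 1) * M + v then
        V (l * M + u) + vertexWeight W l u else V (l' * M + u')) := by
    intro l' u' hu'
    split_ifs with h'
    · rw [h']; exact hlt.le
    · exact le_rfl
  have low : ∀ l' u', u' < M → l' ≤ l → ¬ l' * M + u' = (l + 1) * M + v := by
    intro l' u' hu' hl' h'
    have := (cell_inj hu' hv h').1
    omega
  refine ⟨?_, ?_, ?_⟩
  · intro u' hu'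
    have := low 0 u' hu' (by omega)
    simp only [zero_mul, zero_add] at this
    simp only [this, if_false]
    exact h.base u' hu'
  · intro l' v' hv' h₁
    by_cases heq : (l' + 1) * M + v' = (l + 1) * M + v
    · obtain ⟨h₂, rfl⟩ := cell_inj hv' hv heq
      obtain rfl : l' = l := by omega
      simp only [if_true]
      rw [if_neg (low l' u hu le_rfl)]
      exact ⟨hu, hE, hV, le_rfl⟩
    · simp only [if_neg heq] at h₁ ⊢
      obtain ⟨h₂, h₃, h₄, h₅⟩ := h.sound l' v' hv' h₁
      have := key l' _ h₂
      exact ⟨h₂, h₃, h₄.trans this, h₅.trans (Nat.add_le_add_right this _)⟩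
  · intro l' u' hu' v' hv' hd hE' h₁
    have hl' : l' ≤ l := by
      rcases hd with hd | hd
      · exact hdone _ _ _ hd
      · omega
    simp only [if_neg (low l' u' hu' hl')] at h₁ ⊢
    rcases hd with hd | ⟨rfl, rfl, rfl⟩
    · exact (h.complete l' u' hu' v' hv' hd hE' h₁).trans (key (l' + 1) v' hv')
    · simp

theorem TableInv.skip (h : TableInv M E W V bp done) {l u v : ℕ}
    (hn : E l u v → 1 ≤ V (l * M + u) →
      V (l * M + u) + vertexWeight W l u ≤ V ((l + 1) * M + v)) :
    TableInv M E W V bp (fun l' u' v' => done l' u' v' ∨ (l' = l ∧ u' = u ∧ v' = v)) := by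
  refine ⟨h.base, h.sound, ?_⟩
  rintro l' u' hu' v' hv' (hd | ⟨rfl, rfl, rfl⟩) hE' h₁
  · exact h.complete l' u' hu' v' hv' hd hE' h₁
  · exact hn hE' h₁

/-- When all edges are relaxed, the values bound all path weights from above;
`TableInv.isPath_of_bp` provides a path that attains the bound. -/
theorem TableInv.le_of_isPath (h : TableInv M E W V bp (fun l _ _ => l < L)) {π : ℕ → ℕ}
    (hπ : IsPath M L E π) : ∀ l ≤ L, 1 + pathWeight l W π ≤ V (l * M + π l) := by
  intro l
  induction l with
  | zero => intro _; simp [pathWeight, h.base _ (hπ.1 0 (by omega))]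
  | succ l ih =>
    intro hl
    have h₁ := ih (by omega)
    have := h.complete l (π l) (hπ.1 l (by omega)) (π (l + 1)) (hπ.1 _ hl) (by omega)
      (hπ.2 l (by omega)) (by omega)
    rw [pathWeight_succ]
    omega

theorem TableInv.isPath_of_bp (h : TableInv M E W V bp done) {π : ℕ → ℕ}
    (hL : π L < M) (hV : 1 ≤ V (L * M + π L))
    (hbp : ∀ l < L, π l = bp ((l + 1) * M + π (l + 1))) :
    IsPath M L E π ∧ V (L * M + π L) ≤ 1 + pathWeight L W π := by
  have key : ∀ j l, l + j = L → π l < M ∧ 1 ≤ V (l * M + π l) := by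
    intro j
    induction j with
    | zero => intro l hl; obtain rfl : l = L := hl; exact ⟨hL, hV⟩
    | succ j ih =>
      intro l hl
      obtain ⟨h₁, h₂⟩ := ih (l + 1) (by omega)
      obtain ⟨h₃, -, h₄, -⟩ := h.sound l _ h₁ h₂
      rw [hbp l (by omega)]
      exact ⟨h₃, h₄⟩
  refine ⟨⟨fun l hl => (key (L - l) l (by omega)).1, fun l hl => ?_⟩, ?_⟩
  · obtain ⟨h₁, h₂⟩ := key (L - (l + 1)) (l + 1) (by omega)
    have := (h.sound l _ h₁ h₂).2.1
    rwa [← hbp l hl] at this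
  · have : ∀ l ≤ L, V (l * M + π l) ≤ 1 + pathWeight l W π := by
      intro l
      induction l with
      | zero => intro hl; simp [h.base _ (key L 0 (by omega)).1]
      | succ l ih =>
        intro hl
        obtain ⟨h₁, h₂⟩ := key (L - (l + 1)) (l + 1) (by omega)
        have h₃ := (h.sound l _ h₁ h₂).2.2.2
        rw [← hbp l hl] at h₃
        have := ih (by omega)
        rw [pathWeight_succ]
        omega
    exact this L le_rfl

end Table

/-- Relax the edge from vertex `24` in layer `23` to vertex `25` in the next layer. -/
def relaxProg (E W : Test) : Prog :=
  let old : NatExpr := .read 27 (.add (reg 22) (reg 24))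
  let new : NatExpr := .add (.add (reg 22) (reg 20)) (reg 25)
  .ite (.conj E (.natLe (.const 1) old))
    (block [.setNat 26 (.const 0) old,
      .ite W (.setNat 26 (.const 0) (.add (reg 26) (.const 1))) .skip,
      .ite (.lt (.read 27 new) (reg 26))
        (block [.setNat 27 new (reg 26), .setNat 28 new (reg 24)]) .skip])
    .skip

/-- Fill the tables `27` (path weights) and `28` (predecessors), for `20` vertices per layer and
`21` layers. -/
def fillProg (E W : Test) : Prog :=
  block [.setNat 22 (.const 0) (.const 0),
    forUp 24 (reg 20) (.setNat 27 (reg 24) (.const 1)),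
    forUp 23 (reg 21) (block [
      forUp 24 (reg 20) (forUp 25 (reg 20) (relaxProg E W)),
      -- Register `22` is the row offset `l * M`, kept up to date by additions.
      .setNat 22 (.const 0) (.add (reg 22) (reg 20))])]

/-- Find the best final vertex and follow the path to it backwards, marking the index `mk` in the
output for each vertex that satisfies `C`. -/
def traceProg (C : Test) (mk : NatExpr) : Prog :=
  block [.setNat 29 (.const 0) (.const 0),
    forUp 25 (reg 20) (.ite
      (.lt (.read 27 (.add (reg 22) (reg 29))) (.read 27 (.add (reg 22) (reg 25))))
      (.setNat 29 (.const 0) (reg 25)) .skip),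
    forUp 23 (reg 21) (block [
      .setNat 29 (.const 0) (.read 28 (.add (reg 22) (reg 29))),
      .setNat 22 (.const 0) (.sub (reg 22) (reg 20)),
      .setNat 26 (.const 0) (.sub (.sub (reg 21) (reg 23)) (.const 1)),
      .ite C (.setNat 1 mk (.const 1)) .skip])]

/-- The names of the arrays that the search for a longest path modifies. -/
def pathScratch : Set ℕ := {1, 22, 23, 24, 25, 26, 27, 28, 29}

theorem wp_relaxProg {E W : Test} {M l u v : ℕ} {Ep : ℕ → ℕ → ℕ → Prop} {Wq : ℕ → ℕ → Prop}
    {done : ℕ → ℕ → ℕ → Prop} (s₀ s : Store) (hs : Frame pathScratch ∅ s₀ s)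
    (hout : s.nat 1 = s₀.nat 1) (hu : u < M) (hv : v < M)
    (hE : ∀ s, Frame pathScratch ∅ s₀ s → (E.Holds s ↔ Ep (s.nat 23 0) (s.nat 24 0) (s.nat 25 0)))
    (hW : ∀ s, Frame pathScratch ∅ s₀ s → (W.Holds s ↔ Wq (s.nat 23 0) (s.nat 24 0)))
    (h20 : s₀.nat 20 0 = M) (h22 : s.nat 22 0 = l * M) (h23 : s.nat 23 0 = l)
    (h24 : s.nat 24 0 = u) (h25 : s.nat 25 0 = v)
    (hdone : ∀ l' u' v', done l' u' v' → l' ≤ l)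
    (inv : TableInv M Ep Wq (s.nat 27) (s.nat 28) done) :
    Wp R (relaxProg E W) (fun s' => Frame pathScratch ∅ s₀ s' ∧ s'.nat 1 = s₀.nat 1 ∧
      s'.nat 22 0 = l * M ∧ s'.nat 23 0 = l ∧ s'.nat 24 0 = u ∧ s'.nat 25 0 = v ∧
      TableInv M Ep Wq (s'.nat 27) (s'.nat 28)
        (fun l' u' v' => done l' u' v' ∨ (l' = l ∧ u' = u ∧ v' = v))) s := by
  have h20' : ∀ {s}, Frame pathScratch ∅ s₀ s → s.nat 20 0 = M := fun h => by
    rw [h.1 20 (by simp [pathScratch]), h20]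
  have hnew : l * M + M + v = (l + 1) * M + v := by rw [Nat.succ_mul]
  refine wp_ite (fun hb => ?_) (fun hb => wp_skip ?_)
  · simp only [holds_conj, hE s hs, h23, h24, h25, holds_natLe, eval_const, eval_read, eval_add,
      eval_reg, h22] at hb
    refine wp_block_cons (wp_setNat (wp_block_cons ?_))
    have hs₁ := hs.setNat (a := 26) 0 (s.nat 27 (l * M + u)) (by simp [pathScratch])
    refine Wp.mono (Q := fun s' => Frame pathScratch ∅ s₀ s' ∧ s'.nat 1 = s₀.nat 1 ∧
      s'.nat 22 0 = l * M ∧ s'.nat 23 0 = l ∧ s'.nat 24 0 = u ∧ s'.nat 25 0 = v ∧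
      s'.nat 27 = s.nat 27 ∧ s'.nat 28 = s.nat 28 ∧
      s'.nat 26 0 = s.nat 27 (l * M + u) + vertexWeight Wq l u) ?_ ?_
    · simp only [eval_read, eval_add, eval_reg, eval_const, h22, h24]
      refine wp_ite (fun hw => wp_setNat ?_) (fun hw => wp_skip ?_)
      · have hw' : Wq l u := by simpa [h23, h24] using (hW _ hs₁).1 hw
        refine ⟨hs₁.setNat _ _ (by simp [pathScratch]), ?_, by simp [h22], by simp [h23],
          by simp [h24], by simp [h25], ?_, ?_, by simp [vertexWeight, hw']⟩
        all_goals simp [nat_setNat_of_ne, hout]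
      · have hw' : ¬ Wq l u := by simpa [h23, h24] using (hW _ hs₁).not.1 hw
        refine ⟨hs₁, ?_, by simp [h22], by simp [h23],
          by simp [h24], by simp [h25], ?_, ?_, by simp [vertexWeight, hw']⟩
        all_goals simp [nat_setNat_of_ne, hout]
    · rintro s₂ ⟨f₂, g₁, g₂, g₃, g₄, g₅, g₆, g₇, g₈⟩
      refine wp_block_cons (wp_ite (fun hb' => ?_) (fun hb' => wp_skip (wp_block_nil ?_)))
      · simp only [holds_lt, eval_read, eval_add, eval_reg, g₂, g₅, h20' f₂, hnew, g₆, g₈] at hb'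
        refine wp_block_cons (wp_setNat (wp_block_cons (wp_setNat
          (wp_block_nil (wp_block_nil ?_)))))
        refine ⟨(f₂.setNat _ _ (by simp [pathScratch])).setNat _ _ (by simp [pathScratch]),
          ?_, by simp [g₂], by simp [g₃], by simp [g₄], by simp [g₅], ?_⟩
        · simp [nat_setNat_of_ne, g₁]
        · convert inv.relax hu hv hdone hb.1 hb.2 hb' using 1
          · funext j
            simp [g₂, h20' f₂, g₅, hnew, g₈, g₆]
          · funext j
            simp [g₂, h20' f₂, g₅, hnew, g₄, g₇]
      · simp only [holds_lt, eval_read, eval_add, eval_reg, g₂, g₅, h20' f₂, hnew, g₆, g₈,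
          not_lt] at hb'
        refine ⟨f₂, g₁, g₂, g₃, g₄, g₅, ?_⟩
        rw [g₆, g₇]
        exact inv.skip fun _ _ => hb'
  · simp only [holds_conj, hE s hs, h23, h24, h25, holds_natLe, eval_const, eval_read, eval_add,
      eval_reg, h22] at hb
    exact ⟨hs, hout, h22, h23, h24, h25, inv.skip fun h h' => absurd ⟨h, h'⟩ hb⟩

/-- The three loop invariants record the relaxed edges: those of all earlier layers, and in layer
`l` those lexicographically before `(u, v)`. By `h27`, all vertices beyond layer `0` are initially
unreached. -/
theorem wp_fillProg {E W : Test} {M L : ℕ} {Ep : ℕ → ℕ → ℕ → Prop} {Wq : ℕ → ℕ → Prop}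
    (s₀ : Store)
    (hE : ∀ s, Frame pathScratch ∅ s₀ s → (E.Holds s ↔ Ep (s.nat 23 0) (s.nat 24 0) (s.nat 25 0)))
    (hW : ∀ s, Frame pathScratch ∅ s₀ s → (W.Holds s ↔ Wq (s.nat 23 0) (s.nat 24 0)))
    (h20 : s₀.nat 20 0 = M) (h21 : s₀.nat 21 0 = L) (hM : M ≤ R) (hL : L ≤ R)
    (h27 : ∀ i, s₀.nat 27 i = 0) :
    Wp R (fillProg E W) (fun s' => Frame pathScratch ∅ s₀ s' ∧ s'.nat 1 = s₀.nat 1 ∧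
      s'.nat 22 0 = L * M ∧
      TableInv M Ep Wq (s'.nat 27) (s'.nat 28) (fun l _ _ => l < L)) s₀ := by
  have h20' : ∀ {s}, Frame pathScratch ∅ s₀ s → s.nat 20 0 = M := fun h => by
    rw [h.1 20 (by simp [pathScratch]), h20]
  have h21' : ∀ {s}, Frame pathScratch ∅ s₀ s → s.nat 21 0 = L := fun h => by
    rw [h.1 21 (by simp [pathScratch]), h21]
  refine wp_block_cons (wp_setNat (wp_block_cons ?_))
  refine wp_forUp (n := M) (fun i s => Frame pathScratch ∅ s₀ s ∧ s.nat 1 = s₀.nat 1 ∧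
    s.nat 22 0 = 0 ∧ ∀ j, s.nat 27 j = if j < i then 1 else 0) hM ?_ ?_ ?_ ?_ ?_
  · refine ⟨(Frame.refl _ _ _).setNat _ _ (by simp [pathScratch]), by simp [nat_setNat_of_ne],
      by simp, by simp [h27]⟩
  · rintro i s x ⟨f, g₁, g₂, g₃⟩
    exact ⟨f.setNat _ _ (by simp [pathScratch]), by simpa [nat_setNat_of_ne] using g₁,
      by simpa using g₂, by simpa using g₃⟩
  · exact fun i s h => h20' h.1
  · rintro i s hi ⟨f, g₁, g₂, g₃⟩ hr
    refine wp_setNat ⟨by simpa using hr, f.setNat _ _ (by simp [pathScratch]),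
      by simpa [nat_setNat_of_ne] using g₁, by simpa using g₂, ?_⟩
    intro j
    simp only [nat_setNat, eval_reg, hr, eval_const, true_and, g₃]
    grind
  rintro s₁ ⟨f₁, a₁, a₂, a₃⟩
  refine wp_block_cons ?_
  refine wp_forUp (n := L) (fun l s => Frame pathScratch ∅ s₀ s ∧ s.nat 1 = s₀.nat 1 ∧
    s.nat 22 0 = l * M ∧ TableInv M Ep Wq (s.nat 27) (s.nat 28) (fun l' _ _ => l' < l)) hL
    ?_ ?_ ?_ ?_ ?_
  · refine ⟨f₁, a₁, by simp [a₂], ?_, ?_, ?_⟩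
    · intro u hu; simp [a₃, hu]
    · intro l v hv h
      have : M ≤ (l + 1) * M := Nat.le_mul_of_pos_left _ (by omega)
      rw [a₃, if_neg (by omega)] at h
      omega
    · intro l u hu v hv h; omega
  · rintro i s x ⟨f, g₁, g₂, g₃⟩
    exact ⟨f.setNat _ _ (by simp [pathScratch]), by simpa [nat_setNat_of_ne] using g₁,
      by simpa using g₂, by simpa [nat_setNat_of_ne] using g₃⟩
  · exact fun i s h => h21' h.1
  · rintro l s hl ⟨f, g₁, g₂, g₃⟩ hr
    refine wp_block_cons ?_
    refine wp_forUp (n := M) (fun u s => Frame pathScratch ∅ s₀ s ∧ s.nat 1 = s₀.nat 1 ∧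
      s.nat 22 0 = l * M ∧ s.nat 23 0 = l ∧ TableInv M Ep Wq (s.nat 27) (s.nat 28)
        (fun l' u' _ => l' < l ∨ (l' = l ∧ u' < u))) hM ?_ ?_ ?_ ?_ ?_
    · exact ⟨f, g₁, g₂, hr, g₃.mono (by omega)⟩
    · rintro i s x ⟨f, g₁, g₂, g₃, g₄⟩
      exact ⟨f.setNat _ _ (by simp [pathScratch]), by simpa [nat_setNat_of_ne] using g₁,
        by simpa using g₂, by simpa using g₃, by simpa [nat_setNat_of_ne] using g₄⟩
    · exact fun i s h => h20' h.1
    · rintro u s hu ⟨f, g₁, g₂, g₃, g₄⟩ hr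
      refine wp_forUp (n := M) (fun v s => Frame pathScratch ∅ s₀ s ∧ s.nat 1 = s₀.nat 1 ∧
        s.nat 22 0 = l * M ∧ s.nat 23 0 = l ∧ s.nat 24 0 = u ∧
        TableInv M Ep Wq (s.nat 27) (s.nat 28)
          (fun l' u' v' => l' < l ∨ (l' = l ∧ (u' < u ∨ (u' = u ∧ v' < v))))) hM ?_ ?_ ?_ ?_ ?_
      · exact ⟨f, g₁, g₂, g₃, hr, g₄.mono (by omega)⟩
      · rintro i s x ⟨f, g₁, g₂, g₃, g₄, g₅⟩
        exact ⟨f.setNat _ _ (by simp [pathScratch]), by simpa [nat_setNat_of_ne] using g₁,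
          by simpa using g₂, by simpa using g₃, by simpa using g₄,
          by simpa [nat_setNat_of_ne] using g₅⟩
      · exact fun i s h => h20' h.1
      · rintro v s hv ⟨f, g₁, g₂, g₃, g₄, g₅⟩ hr
        refine (wp_relaxProg s₀ s f g₁ hu hv hE hW h20 g₂ g₃ g₄ hr ?_ g₅).mono ?_
        · omega
        · rintro s' ⟨f', q₁, q₂, q₃, q₄, q₅, q₆⟩
          exact ⟨q₅, f', q₁, q₂, q₃, q₄, q₆.mono (by omega)⟩
      · rintro s ⟨f, g₁, g₂, g₃, g₄, g₅⟩
        exact ⟨g₄, f, g₁, g₂, g₃, g₅.mono (by omega)⟩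
    · rintro s ⟨f, g₁, g₂, g₃, g₄⟩
      refine wp_block_cons (wp_setNat (wp_block_nil ?_))
      refine ⟨by simpa using g₃, f.setNat _ _ (by simp [pathScratch]),
        by simpa [nat_setNat_of_ne] using g₁, by simp [g₂, h20' f, Nat.succ_mul], ?_⟩
      simpa [nat_setNat_of_ne] using g₄.mono (by omega)
  · exact fun s h => wp_block_nil h

/-- Find a longest path. -/
def pathProg (E W C : Test) (mk : NatExpr) : Prog := block [fillProg E W, traceProg C mk]

/-- The tests need their meanings `Ep`, `Wq`, `Cp` only on memories that differ from `s₀` in scratch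
arrays, the only ones that occur during the search. -/
theorem wp_pathProg {E W C : Test} {mk : NatExpr} {M L : ℕ} {Ep : ℕ → ℕ → ℕ → Prop}
    {Wq Cp : ℕ → ℕ → Prop} {mp : ℕ → ℕ} (s₀ : Store)
    (hE : ∀ s, Frame pathScratch ∅ s₀ s → (E.Holds s ↔ Ep (s.nat 23 0) (s.nat 24 0) (s.nat 25 0)))
    (hW : ∀ s, Frame pathScratch ∅ s₀ s → (W.Holds s ↔ Wq (s.nat 23 0) (s.nat 24 0)))
    (hC : ∀ s, Frame pathScratch ∅ s₀ s → (C.Holds s ↔ Cp (s.nat 26 0) (s.nat 29 0)))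
    (hmk : ∀ s, Frame pathScratch ∅ s₀ s → mk.eval s = mp (s.nat 26 0))
    (h20 : s₀.nat 20 0 = M) (h21 : s₀.nat 21 0 = L) (hM : M ≤ R) (hL : L ≤ R)
    (h27 : ∀ i, s₀.nat 27 i = 0) (h1 : ∀ i, s₀.nat 1 i = 0) :
    Wp R (pathProg E W C mk) (fun s' => (∃ π, IsPath M L Ep π) →
      ∃ π, IsPath M L Ep π ∧ (∀ π', IsPath M L Ep π' → pathWeight L Wq π' ≤ pathWeight L Wq π) ∧
        ∀ j, s'.nat 1 j ≠ 0 ↔ ∃ l < L, Cp l (π l) ∧ mp l = j) s₀ := by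
  have h20' : ∀ {s}, Frame pathScratch ∅ s₀ s → s.nat 20 0 = M := fun h => by
    rw [h.1 20 (by simp [pathScratch]), h20]
  have h21' : ∀ {s}, Frame pathScratch ∅ s₀ s → s.nat 21 0 = L := fun h => by
    rw [h.1 21 (by simp [pathScratch]), h21]
  refine wp_block_cons ((wp_fillProg s₀ hE hW h20 h21 hM hL h27).mono ?_)
  rintro s₁ ⟨f₁, a₁, a₂, inv⟩
  refine wp_block_cons (wp_block_cons (wp_setNat (wp_block_cons ?_)))
  refine wp_forUp (n := M) (fun v s => Frame pathScratch ∅ s₀ s ∧ s.nat 1 = s₀.nat 1 ∧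
    s.nat 22 0 = L * M ∧ s.nat 27 = s₁.nat 27 ∧ s.nat 28 = s₁.nat 28 ∧
    (0 < M → s.nat 29 0 < M) ∧
    ∀ v' < v, s₁.nat 27 (L * M + v') ≤ s₁.nat 27 (L * M + s.nat 29 0)) hM ?_ ?_ ?_ ?_ ?_
  · exact ⟨f₁.setNat _ _ (by simp [pathScratch]), by simp [nat_setNat_of_ne, a₁], by simp [a₂],
      by simp [nat_setNat_of_ne], by simp [nat_setNat_of_ne], by simp, by simp⟩
  · rintro i s x ⟨f, g₁, g₂, g₃, g₄, g₅, g₆⟩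
    exact ⟨f.setNat _ _ (by simp [pathScratch]), by simpa [nat_setNat_of_ne] using g₁,
      by simpa using g₂, by simpa [nat_setNat_of_ne] using g₃,
      by simpa [nat_setNat_of_ne] using g₄, by simpa using g₅, by simpa using g₆⟩
  · exact fun i s h => h20' h.1
  · rintro v s hv ⟨f, g₁, g₂, g₃, g₄, g₅, g₆⟩ hr
    refine wp_ite (fun hb => wp_setNat ?_) (fun hb => wp_skip ?_)
    all_goals simp only [holds_lt, eval_read, eval_add, eval_reg, g₂, g₃, hr] at hb
    · refine ⟨by simpa using hr, f.setNat _ _ (by simp [pathScratch]),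
        by simpa [nat_setNat_of_ne] using g₁,
        by simpa using g₂, by simpa [nat_setNat_of_ne] using g₃,
        by simpa [nat_setNat_of_ne] using g₄, by simp [hr, hv], ?_⟩
      intro v' hv'
      simp only [nat_setNat, eval_reg, eval_const, and_self, if_true, hr]
      rcases Nat.lt_succ_iff_lt_or_eq.1 hv' with h | rfl
      · exact (g₆ v' h).trans hb.le
      · exact le_rfl
    · refine ⟨hr, f, g₁, g₂, g₃, g₄, g₅, ?_⟩
      intro v' hv'
      rcases Nat.lt_succ_iff_lt_or_eq.1 hv' with h | rfl
      · exact g₆ v' h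
      · exact not_lt.1 hb
  rintro s₂ ⟨f₂, b₁, b₂, b₃, b₄, b₅, b₆⟩
  -- `ρ t` is the vertex in layer `L - t` when tracing back from the best final vertex.
  let ρ : ℕ → ℕ := fun t => Nat.rec (s₂.nat 29 0) (fun t x => s₁.nat 28 ((L - t) * M + x)) t
  have hρ0 : ρ 0 = s₂.nat 29 0 := rfl
  have hρ : ∀ t, ρ (t + 1) = s₁.nat 28 ((L - t) * M + ρ t) := fun t => rfl
  refine wp_block_cons ?_
  refine wp_forUp (n := L) (fun t s => Frame pathScratch ∅ s₀ s ∧ s.nat 22 0 = (L - t) * M ∧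
    s.nat 28 = s₁.nat 28 ∧ s.nat 29 0 = ρ t ∧
    ∀ j, s.nat 1 j ≠ 0 ↔ ∃ t' < t, Cp (L - t' - 1) (ρ (t' + 1)) ∧ mp (L - t' - 1) = j) hL
    ?_ ?_ ?_ ?_ ?_
  · exact ⟨f₂, by simpa using b₂, b₄, hρ0.symm, by simp [b₁, h1]⟩
  · rintro i s x ⟨f, g₁, g₂, g₃, g₄⟩
    exact ⟨f.setNat _ _ (by simp [pathScratch]), by simpa using g₁,
      by simpa [nat_setNat_of_ne] using g₂, by simpa using g₃, by simpa using g₄⟩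
  · exact fun i s h => h21' h.1
  · rintro t s ht ⟨f, g₁, g₂, g₃, g₄⟩ hr
    refine wp_block_cons (wp_setNat (wp_block_cons (wp_setNat (wp_block_cons (wp_setNat
      (wp_block_cons ?_))))))
    generalize hs' : ((s.setNat 29 _ _).setNat 22 _ _).setNat 26 _ _ = s'
    have f' : Frame pathScratch ∅ s₀ s' := by
      rw [← hs']
      exact ((f.setNat _ _ (by simp [pathScratch])).setNat _ _
        (by simp [pathScratch])).setNat _ _ (by simp [pathScratch])
    have q₁ : s'.nat 23 0 = t := by rw [← hs']; simp [hr]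
    have q₂ : s'.nat 22 0 = (L - (t + 1)) * M := by
      rw [← hs']
      simp [g₁, h20' f, ← Nat.sub_sub, Nat.sub_mul]
    have q₃ : s'.nat 28 = s₁.nat 28 := by rw [← hs']; simp [nat_setNat_of_ne, g₂]
    have q₄ : s'.nat 29 0 = ρ (t + 1) := by
      rw [← hs', hρ]
      simp [g₁, g₂, g₃]
    have q₅ : s'.nat 26 0 = L - t - 1 := by rw [← hs']; simp [h21' f, hr]
    have q₆ : s'.nat 1 = s.nat 1 := by rw [← hs']; simp [nat_setNat_of_ne]
    refine wp_ite (fun hb => wp_setNat (wp_block_nil ?_)) (fun hb => wp_skip (wp_block_nil ?_))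
    all_goals rw [hC s' f', q₅, q₄] at hb
    · refine ⟨by simpa using q₁, f'.setNat _ _ (by simp [pathScratch]), by simpa using q₂,
        by simpa [nat_setNat_of_ne] using q₃, by simpa using q₄, ?_⟩
      intro j
      simp only [nat_setNat, true_and, hmk s' f', q₅, eval_const, q₆]
      constructor
      · intro h
        by_cases hj : j = mp (L - t - 1)
        · exact ⟨t, by omega, hb, hj.symm⟩
        · rw [if_neg hj] at h
          obtain ⟨t', h₁, h₂⟩ := (g₄ j).1 h
          exact ⟨t', by omega, h₂⟩
      · rintro ⟨t', h₁, h₂, h₃⟩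
        by_cases hj : j = mp (L - t - 1)
        · simp [hj]
        · rw [if_neg hj]
          have : t' ≠ t := by rintro rfl; exact hj h₃.symm
          exact (g₄ j).2 ⟨t', by omega, h₂, h₃⟩
    · refine ⟨q₁, f', q₂, q₃, q₄, ?_⟩
      intro j
      rw [q₆, g₄]
      constructor
      · rintro ⟨t', h₁, h₂⟩
        exact ⟨t', by omega, h₂⟩
      · rintro ⟨t', h₁, h₂⟩
        have : t' ≠ t := by rintro rfl; exact hb h₂.1
        exact ⟨t', by omega, h₂⟩
  · rintro s₃ ⟨-, -, -, -, g₄⟩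
    refine wp_block_nil (wp_block_nil ?_)
    rintro ⟨π', hπ'⟩
    have hLM := hπ'.1 L le_rfl
    have hbest : ∀ π', IsPath M L Ep π' → 1 + pathWeight L Wq π' ≤ s₁.nat 27 (L * M + ρ 0) :=
      fun π' h => (inv.le_of_isPath h L le_rfl).trans (b₆ _ (h.1 L le_rfl))
    obtain ⟨h₁, h₂⟩ := inv.isPath_of_bp (L := L) (π := fun l => ρ (L - l)) (by
      simp only [Nat.sub_self]
      exact b₅ (by omega)) (by
      have := hbest π' hπ'
      simp only [Nat.sub_self]
      omega) (by
      intro l hl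
      have : L - l = L - (l + 1) + 1 := by omega
      rw [this, hρ]
      congr 3
      omega)
    refine ⟨_, h₁, fun π'' h => ?_, fun j => (g₄ j).trans ?_⟩
    · have := hbest π'' h
      simp only [Nat.sub_self] at h₂
      omega
    · constructor
      · rintro ⟨t, h₃, h₄, h₅⟩
        refine ⟨L - t - 1, by omega, ?_, h₅⟩
        have : L - (L - t - 1) = t + 1 := by omega
        rwa [this]
      · rintro ⟨l, h₃, h₄, h₅⟩
        refine ⟨L - l - 1, by omega, ?_, ?_⟩
        · have e₁ : L - (L - l - 1) - 1 = l := by omega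
          have e₂ : L - l - 1 + 1 = L - l := by omega
          rwa [e₁, e₂]
        · have e₁ : L - (L - l - 1) - 1 = l := by omega
          rwa [e₁]

end UniqueSquareCover

namespace UniqueSquareCover

/-! ## The sweep

The points and squares are listed in the order of the sweep, so that the position in the sweep
takes the place of the first coordinate. -/

/-- The combinatorial data of an instance: `sq t` tells whether the `t`-th event is a square, `I t`
and `J t` are its block indices, and `y t` is its position in the sweep in the other direction. -/
structure Sweep where
  N : ℕ
  sq : ℕ → Prop
  I : ℕ → ℕ
  J : ℕ → ℕ
  y : ℕ → ℕ

/-- The components of a state: the shift (`inl true`), whether the next square is selected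
(`inl false`), and for each group of squares with the same block indices relative to the cell the
two largest values (last component) of the selected ones; either `y + 1` or `N - y` is used as
value (third component), for the squares before or after the current position in the sweep
(fourth component). -/
abbrev Key (k : ℕ) : Type := Bool ⊕ (Fin (k + 1) × Fin (k + 1) × Bool × Bool × Bool)

/-! ### Counting up to two by the two largest values -/

/-- `(a', b')` are the two largest numbers among `a ≥ b` and `x`. -/
def Ins (x a b a' b' : ℕ) : Prop := a' = max a x ∧ b' = max b (min a x)

/-- The number of those among `a` and `b` that are at least `θ`. -/
def countGe (θ a b : ℕ) : ℕ := (1 - (θ - a)) + (1 - (θ - b))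

/-- The two largest values determine how many values reach `θ`, up to two. The condition `1 ≤ θ`
keeps the default value `0` from being counted. -/
theorem countGe_past {x h g : ℕ → ℕ} {n : ℕ} (h0 : h 0 = 0) (g0 : g 0 = 0)
    (hs : ∀ t < n, Ins (x t) (h t) (g t) (h (t + 1)) (g (t + 1))) :
    ∀ t ≤ n, g t ≤ h t ∧ ∀ θ, 1 ≤ θ → countGe θ (h t) (g t) =
      min 2 {q ∈ Finset.range n | q < t ∧ θ ≤ x q}.card := by
  intro t
  induction t with
  | zero => intro _; simp only [h0, g0, countGe]; simp; omega
  | succ t ih =>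
    intro ht
    obtain ⟨h₁, h₂⟩ := ih (by omega)
    obtain ⟨e₁, e₂⟩ := hs t (by omega)
    refine ⟨by omega, fun θ hθ => ?_⟩
    have : {q ∈ Finset.range n | q < t + 1 ∧ θ ≤ x q}.card =
        {q ∈ Finset.range n | q < t ∧ θ ≤ x q}.card + if θ ≤ x t then 1 else 0 := by
      by_cases hx : θ ≤ x t
      · have : {q ∈ Finset.range n | q < t + 1 ∧ θ ≤ x q} =
            insert t {q ∈ Finset.range n | q < t ∧ θ ≤ x q} := by
          ext q; simp only [Finset.mem_filter, Finset.mem_range, Finset.mem_insert]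
          constructor
          · rintro ⟨a, b, c⟩; by_cases hq : q = t
            · exact .inl hq
            · exact .inr ⟨a, by omega, c⟩
          · rintro (rfl | ⟨a, b, c⟩)
            · exact ⟨by omega, by omega, hx⟩
            · exact ⟨a, by omega, c⟩
        rw [this, Finset.card_insert_of_notMem (by simp), if_pos hx]
      · rw [if_neg hx, add_zero]
        congr 1
        ext q; simp only [Finset.mem_filter, Finset.mem_range]
        constructor
        · rintro ⟨a, b, c⟩
          refine ⟨a, ?_, c⟩
          by_contra hq
          exact hx (by rwa [show t = q by omega])
        · rintro ⟨a, b, c⟩; exact ⟨a, by omega, c⟩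
    have := h₂ θ hθ
    unfold countGe at this ⊢
    rw [e₁, e₂]
    split_ifs at * <;> omega

/-- Time reversal: a future list that loses each element as it passes is a past list read backwards.
-/
theorem countGe_future {x h g : ℕ → ℕ} {n : ℕ} (h0 : h n = 0) (g0 : g n = 0)
    (hs : ∀ t < n, Ins (x t) (h (t + 1)) (g (t + 1)) (h t) (g t)) :
    ∀ t ≤ n, ∀ θ, 1 ≤ θ → countGe θ (h t) (g t) =
      min 2 {q ∈ Finset.range n | t ≤ q ∧ θ ≤ x q}.card := by
  intro t ht θ hθ
  have := (countGe_past (x := fun j => x (n - 1 - j)) (h := fun j => h (n - j))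
    (g := fun j => g (n - j)) (n := n) (by simpa using h0) (by simpa using g0) (by
      intro j hj
      have h₁ := hs (n - 1 - j) (by omega)
      have e₁ : n - 1 - j + 1 = n - j := by omega
      have e₂ : n - 1 - j = n - (j + 1) := by omega
      rw [e₁] at h₁
      rw [e₂] at h₁ ⊢
      exact h₁) (n - t) (by omega)).2 θ hθ
  simp only [show n - (n - t) = t by omega] at this
  rw [this]
  congr 1
  refine Finset.card_bij' (fun q _ => n - 1 - q) (fun q _ => n - 1 - q) ?_ ?_ ?_ ?_
  · intro q hq
    simp only [Finset.mem_filter, Finset.mem_range] at hq ⊢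
    exact ⟨by omega, by omega, hq.2.2⟩
  · intro q hq
    simp only [Finset.mem_filter, Finset.mem_range] at hq ⊢
    refine ⟨by omega, by omega, ?_⟩
    rw [show n - 1 - (n - 1 - q) = q by omega]
    exact hq.2.2
  · intro q hq
    simp only [Finset.mem_filter, Finset.mem_range] at hq
    omega
  · intro q hq
    simp only [Finset.mem_filter, Finset.mem_range] at hq
    omega

namespace Sweep

variable (S : Sweep) {k : ℕ}

/-- The square `q` contains the point `p`. -/
def Cov (q p : ℕ) : Prop := Meets (S.I q) q (S.I p) p ∧ Meets (S.J q) (S.y q) (S.J p) (S.y p)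

/-- The value of a square. -/
def val (up : Bool) (t : ℕ) : ℕ := if up then S.y t + 1 else S.N - S.y t

/-- The smallest value that a square needs in order to contain a point. -/
def thr (up : Bool) (t : ℕ) : ℕ := if up then S.y t + 2 else S.N - S.y t + 1

/-- Update of the component of the state that belongs to a group of squares; `c` tells whether the
square is selected. -/
def ChanMove (c : Prop) (t a₀ b₀ : ℕ) (δ δ' : Key k → ℕ) : Prop :=
  ∀ (gi gj : Fin (k + 1)) (up : Bool),
    ((c ∧ S.I t = a₀ + gi ∧ S.J t = b₀ + gj) →
      Ins (S.val up t) (δ (.inr (gi, gj, up, true, true))) (δ (.inr (gi, gj, up, true, false)))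
        (δ' (.inr (gi, gj, up, true, true))) (δ' (.inr (gi, gj, up, true, false))) ∧
      -- The roles of `δ` and `δ'` are swapped here: the passing square leaves the future, so the
      -- old pair arises from the new one by insertion.
      Ins (S.val up t) (δ' (.inr (gi, gj, up, false, true)))
        (δ' (.inr (gi, gj, up, false, false)))
        (δ (.inr (gi, gj, up, false, true))) (δ (.inr (gi, gj, up, false, false)))) ∧
    (¬ (c ∧ S.I t = a₀ + gi ∧ S.J t = b₀ + gj) →
      Ins 0 (δ (.inr (gi, gj, up, true, true))) (δ (.inr (gi, gj, up, true, false)))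
        (δ' (.inr (gi, gj, up, true, true))) (δ' (.inr (gi, gj, up, true, false))) ∧
      Ins 0 (δ' (.inr (gi, gj, up, false, true)))
        (δ' (.inr (gi, gj, up, false, false)))
        (δ (.inr (gi, gj, up, false, true))) (δ (.inr (gi, gj, up, false, false))))

/-- The number of squares of one group that contain the point `t`, at most two being counted. -/
def pairCount (δ : Key k → ℕ) (gi gj : Fin (k + 1)) (up past : Bool) (t : ℕ) : ℕ :=
  countGe (S.thr up t) (δ (.inr (gi, gj, up, past, true))) (δ (.inr (gi, gj, up, past, false)))

/-- The number of squares that contain the point `t`, which lies in column `a` and row `b` of the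
cell, at most two being counted in each group. -/
def covCount (δ : Key k → ℕ) (t : ℕ) (a b : Fin k) : ℕ :=
  -- Squares start one block earlier than points, so `a.succ` is the column of the point itself,
  -- where past squares count, and `a.castSucc` the previous one, where future squares count.
  -- Likewise for rows: `b.succ` asks for low squares (`up = false`), `b.castSucc` for high ones.
  S.pairCount δ a.succ b.succ false true t + S.pairCount δ a.succ b.castSucc true true t +
    (S.pairCount δ a.castSucc b.succ false false t + S.pairCount δ a.castSucc b.castSucc true false t)

/-- Transition at the event `t` in the cell at `a₀`, `b₀`. -/
def Move (t a₀ b₀ : ℕ) (δ δ' : Key k → ℕ) : Prop :=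
  S.ChanMove (δ (.inl false) = 1) t a₀ b₀ δ δ' ∧
  (δ (.inl false) = 1 →
    S.sq t ∧ (a₀ ≤ S.I t ∧ S.I t ≤ a₀ + k) ∧ (b₀ ≤ S.J t ∧ S.J t ≤ b₀ + k)) ∧
  (¬ S.sq t → ∀ a b : Fin k, (S.I t = a₀ + 1 + a ∧ S.J t = b₀ + 1 + b) → 1 ≤ S.covCount δ t a b)

/-- Transition in step `i` of the cell with the coordinates `z₁`, `z₂`. The first and the last
step of a cell clear the state. -/
def Step (i z₁ z₂ : ℕ) (δ δ' : Key k → ℕ) : Prop :=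
  δ' (.inl true) = δ (.inl true) ∧ δ (.inl true) < k ∧
  -- Steps `0` and `N + 1` enclose the events, and step `i` between them treats event `i - 1`. The
  -- past starts empty and the future ends empty; the initial future is otherwise free, which is the
  -- guess.
  ((i = 0 ∨ S.N < i) → (∀ (gi gj : Fin (k + 1)) (up f : Bool),
      δ (.inr (gi, gj, up, false, f)) = 0 ∧ δ' (.inr (gi, gj, up, true, f)) = 0) ∧
    δ (.inl false) = 0) ∧
  (¬ (i = 0 ∨ S.N < i) →
    S.Move (i - 1) (δ (.inl true) + k * z₁) (δ (.inl true) + k * z₂) δ δ')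

/-- The event in step `i` is a point that is covered exactly once and does not lie in the first or
last row or column of the cell. -/
def Gain (i z₁ z₂ : ℕ) (δ : Key k → ℕ) : Prop :=
  ¬ (i = 0 ∨ S.N < i) ∧ ¬ S.sq (i - 1) ∧ ∃ a b : Fin k,
    ((0 < (a : ℕ) ∧ (a : ℕ) + 1 < k) ∧ (0 < (b : ℕ) ∧ (b : ℕ) + 1 < k)) ∧
    (S.I (i - 1) = δ (.inl true) + k * z₁ + 1 + a ∧
      S.J (i - 1) = δ (.inl true) + k * z₂ + 1 + b) ∧ S.covCount δ (i - 1) a b = 1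

variable {S}

open Classical in
-- `Cov` splits into four exclusive cases, past or future and low or high, each belonging to one
-- group. In each, the sweep position settles the first direction and a threshold on the value the
-- second. Capping the four counts at two does not change whether their sum is zero or one.
theorem covCount_iff {a₀ b₀ : ℕ} {c : ℕ → Prop} {σ : ℕ → Key k → ℕ}
    (hy : ∀ t < S.N, S.y t < S.N)
    (h0 : ∀ gi gj up f, σ 0 (.inr (gi, gj, up, true, f)) = 0)
    (hN : ∀ gi gj up f, σ S.N (.inr (gi, gj, up, false, f)) = 0)
    (hm : ∀ t < S.N, S.ChanMove (c t) t a₀ b₀ (σ t) (σ (t + 1)))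
    {t : ℕ} (ht : t < S.N) (hct : ¬ c t) {a b : Fin k} (ha : S.I t = a₀ + 1 + a)
    (hb : S.J t = b₀ + 1 + b) :
    (1 ≤ S.covCount (σ t) t a b ↔ 1 ≤ {q ∈ Finset.range S.N | c q ∧ S.Cov q t}.card) ∧
    (S.covCount (σ t) t a b = 1 ↔ {q ∈ Finset.range S.N | c q ∧ S.Cov q t}.card = 1) := by
  let x : Fin (k + 1) → Fin (k + 1) → Bool → ℕ → ℕ := fun gi gj up q =>
    if c q ∧ S.I q = a₀ + gi ∧ S.J q = b₀ + gj then S.val up q else 0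
  have hthr : ∀ up, 1 ≤ S.thr up t := by intro up; unfold thr; split_ifs <;> omega
  have hpast : ∀ gi gj up, S.pairCount (σ t) gi gj up true t =
      min 2 {q ∈ Finset.range S.N | q < t ∧ S.thr up t ≤ x gi gj up q}.card := by
    intro gi gj up
    refine (countGe_past (x := x gi gj up) (h := fun t => σ t (.inr (gi, gj, up, true, true)))
      (g := fun t => σ t (.inr (gi, gj, up, true, false))) (h0 _ _ _ _) (h0 _ _ _ _) ?_ t
      ht.le).2 _ (hthr up)
    intro q hq
    have := hm q hq gi gj up
    simp only [x]
    split_ifs with h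
    · exact (this.1 h).1
    · exact (this.2 h).1
  have hfut : ∀ gi gj up, S.pairCount (σ t) gi gj up false t =
      min 2 {q ∈ Finset.range S.N | t ≤ q ∧ S.thr up t ≤ x gi gj up q}.card := by
    intro gi gj up
    refine countGe_future (x := x gi gj up) (h := fun t => σ t (.inr (gi, gj, up, false, true)))
      (g := fun t => σ t (.inr (gi, gj, up, false, false))) (hN _ _ _ _) (hN _ _ _ _) ?_ t
      ht.le _ (hthr up)
    intro q hq
    have := hm q hq gi gj up
    simp only [x]
    split_ifs with h
    · exact (this.1 h).2
    · exact (this.2 h).2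
  have hsum : {q ∈ Finset.range S.N | c q ∧ S.Cov q t}.card =
      {q ∈ Finset.range S.N | q < t ∧ S.thr false t ≤ x a.succ b.succ false q}.card +
      {q ∈ Finset.range S.N | q < t ∧ S.thr true t ≤ x a.succ b.castSucc true q}.card +
      ({q ∈ Finset.range S.N | t ≤ q ∧ S.thr false t ≤ x a.castSucc b.succ false q}.card +
      {q ∈ Finset.range S.N | t ≤ q ∧ S.thr true t ≤ x a.castSucc b.castSucc true q}.card) := by
    simp only [Finset.card_filter, ← Finset.sum_add_distrib]
    refine Finset.sum_congr rfl fun q hq => ?_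
    have hqN := Finset.mem_range.1 hq
    have hyq := hy q hqN
    have hyt := hy t ht
    by_cases hc : c q
    · have hqt : q ≠ t := by rintro rfl; exact hct hc
      simp only [Cov, Meets, x, thr, val, hc, true_and, ha, hb, Fin.val_succ, Fin.val_castSucc]
      grind
    · have : ∀ up, ¬ S.thr up t ≤ 0 := fun up => by have := hthr up; omega
      simp [x, hc, this]
  unfold covCount
  rw [hpast, hpast, hfut, hfut, hsum]
  constructor <;> omega

/-- The numbers of the sweep are in the ranges that the preprocessing guarantees. -/
structure Bounded (S : Sweep) (k : ℕ) : Prop where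
  y_lt : ∀ t < S.N, S.y t < S.N
  I_mem : ∀ t < S.N, k ≤ S.I t ∧ S.I t ≤ k + 2 * S.N
  J_mem : ∀ t < S.N, k ≤ S.J t ∧ S.J t ≤ k + 2 * S.N

/-- The number of layers for a grid of `Z × Z` cells. -/
def layers (S : Sweep) (Z : ℕ) : ℕ := Z * (Z * (S.N + 2))

/-- The transitions between consecutive layers. -/
def LayerStep (S : Sweep) (Z l : ℕ) (δ δ' : Key k → ℕ) : Prop :=
  S.Step (l % (S.N + 2)) (l / (S.N + 2) / Z) (l / (S.N + 2) % Z) δ δ'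

/-- A vertex that contributes to the weight of a path. -/
def LayerGain (S : Sweep) (Z l : ℕ) (δ : Key k → ℕ) : Prop :=
  S.Gain (l % (S.N + 2)) (l / (S.N + 2) / Z) (l / (S.N + 2) % Z) δ

theorem layer_lt {Z z₁ z₂ i : ℕ} (h₁ : z₁ < Z) (h₂ : z₂ < Z) (hi : i < S.N + 2) :
    (z₁ * Z + z₂) * (S.N + 2) + i < S.layers Z := by
  have h₃ : z₁ * Z + z₂ + 1 ≤ Z * Z := by
    have := Nat.mul_le_mul_right Z (show z₁ + 1 ≤ Z from h₁)
    rw [Nat.succ_mul] at this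
    omega
  have := Nat.mul_le_mul_right (S.N + 2) h₃
  rw [Nat.succ_mul, Nat.mul_assoc] at this
  unfold layers
  omega

theorem layer_coords {Z z₁ z₂ i : ℕ} (h₂ : z₂ < Z) (hi : i < S.N + 2) :
    ((z₁ * Z + z₂) * (S.N + 2) + i) % (S.N + 2) = i ∧
    ((z₁ * Z + z₂) * (S.N + 2) + i) / (S.N + 2) / Z = z₁ ∧
    ((z₁ * Z + z₂) * (S.N + 2) + i) / (S.N + 2) % Z = z₂ := by
  have e : ((z₁ * Z + z₂) * (S.N + 2) + i) / (S.N + 2) = z₁ * Z + z₂ := by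
    rw [Nat.mul_comm, Nat.mul_add_div (by omega), Nat.div_eq_of_lt hi, add_zero]
  refine ⟨by rw [Nat.mul_add_mod_of_lt hi], ?_, ?_⟩
  · rw [e, Nat.mul_comm, Nat.mul_add_div (by omega), Nat.div_eq_of_lt h₂, add_zero]
  · rw [e, Nat.mul_add_mod_of_lt h₂]

theorem layer_decomp {Z l : ℕ} (hl : l < S.layers Z) :
    l / (S.N + 2) / Z < Z ∧ l / (S.N + 2) % Z < Z ∧ l % (S.N + 2) < S.N + 2 ∧
    l = (l / (S.N + 2) / Z * Z + l / (S.N + 2) % Z) * (S.N + 2) + l % (S.N + 2) := by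
  have hZ : 0 < Z := by
    rcases Nat.eq_zero_or_pos Z with rfl | h
    · simp [layers] at hl
    · exact h
  refine ⟨?_, Nat.mod_lt _ hZ, Nat.mod_lt _ (by omega), ?_⟩
  · rw [Nat.div_lt_iff_lt_mul hZ, Nat.div_lt_iff_lt_mul (by omega), Nat.mul_assoc]
    exact hl
  · rw [Nat.div_add_mod', Nat.div_add_mod']

/-- The cell of a point. -/
theorem exists_cell {Z s v : ℕ} (hk : 1 ≤ k) (hZ : Z = 2 * S.N + 2) (hs : s < k)
    (hv : k ≤ v ∧ v ≤ k + 2 * S.N) :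
    (v - s - 1) / k < Z ∧ v = s + k * ((v - s - 1) / k) + 1 + (v - s - 1) % k := by
  constructor
  · rw [Nat.div_lt_iff_lt_mul (by omega), hZ]
    have : 2 * S.N + 2 ≤ (2 * S.N + 2) * k := Nat.le_mul_of_pos_right _ hk
    have h2 : k ≤ (2 * S.N + 2) * k := Nat.le_mul_of_pos_left _ (by omega)
    have h3 : (2 * S.N + 2) * k = (2 * S.N + 1) * k + k := by ring
    have h4 : (2 * S.N + 1) * 1 ≤ (2 * S.N + 1) * k := Nat.mul_le_mul_left _ hk
    omega
  -- The subtractions are exact, because `s < k ≤ v`.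
  · have := Nat.div_add_mod (v - s - 1) k
    omega

theorem mul_add_unique {z z' a a' : ℕ} (ha : a < k) (ha' : a' < k)
    (h : k * z + a = k * z' + a') : z = z' ∧ a = a' :=
  cell_inj ha ha' (by rwa [Nat.mul_comm z, Nat.mul_comm z'])

end Sweep

end UniqueSquareCover

/-! ### From paths to feasible solutions -/

namespace UniqueSquareCover

namespace Sweep

variable {S : Sweep} {k Z : ℕ}

/-- The squares selected along a path. -/
def Sel (S : Sweep) (Z : ℕ) (σ : ℕ → Key k → ℕ) (q : ℕ) : Prop :=
  ∃ l < S.layers Z, σ l (.inl false) = 1 ∧ l % (S.N + 2) = q + 1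

section Sound

variable {σ : ℕ → Key k → ℕ}

theorem shift_eq (hσ : ∀ l < S.layers Z, S.LayerStep Z l (σ l) (σ (l + 1))) :
    ∀ l ≤ S.layers Z, σ l (.inl true) = σ 0 (.inl true) := by
  intro l
  induction l with
  | zero => intro _; rfl
  | succ l ih => intro hl; rw [(hσ l (by omega)).1, ih (by omega)]

theorem cell_step (hσ : ∀ l < S.layers Z, S.LayerStep Z l (σ l) (σ (l + 1)))
    {z₁ z₂ i : ℕ} (h₁ : z₁ < Z) (h₂ : z₂ < Z) (hi : i < S.N + 2) :
    S.Step i z₁ z₂ (σ ((z₁ * Z + z₂) * (S.N + 2) + i)) (σ ((z₁ * Z + z₂) * (S.N + 2) + i + 1)) := by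
  have := hσ _ (layer_lt h₁ h₂ hi)
  obtain ⟨e₁, e₂, e₃⟩ := layer_coords (S := S) (z₁ := z₁) h₂ hi
  rwa [LayerStep, e₁, e₂, e₃] at this

theorem cell_move (hσ : ∀ l < S.layers Z, S.LayerStep Z l (σ l) (σ (l + 1)))
    {z₁ z₂ t : ℕ} (h₁ : z₁ < Z) (h₂ : z₂ < Z) (ht : t < S.N) :
    S.Move t (σ 0 (.inl true) + k * z₁) (σ 0 (.inl true) + k * z₂)
      (σ ((z₁ * Z + z₂) * (S.N + 2) + 1 + t)) (σ ((z₁ * Z + z₂) * (S.N + 2) + 1 + (t + 1))) := by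
  have h := (cell_step hσ h₁ h₂ (show t + 1 < S.N + 2 by omega)).2.2.2 (by omega)
  rw [shift_eq hσ _ (layer_lt h₁ h₂ (show t + 1 < S.N + 2 by omega)).le] at h
  rw [show (z₁ * Z + z₂) * (S.N + 2) + 1 + t = (z₁ * Z + z₂) * (S.N + 2) + (t + 1) by omega,
    show (z₁ * Z + z₂) * (S.N + 2) + 1 + (t + 1) = (z₁ * Z + z₂) * (S.N + 2) + (t + 1) + 1 by omega]
  exact h

open Classical in
-- The clearing steps of the cell supply the boundary conditions of `covCount_iff`.
theorem cell_covCount (hσ : ∀ l < S.layers Z, S.LayerStep Z l (σ l) (σ (l + 1)))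
    (hS : S.Bounded k) {z₁ z₂ t : ℕ} (h₁ : z₁ < Z) (h₂ : z₂ < Z)
    (ht : t < S.N) (hsq : ¬ S.sq t) {a b : Fin k}
    (ha : S.I t = σ 0 (.inl true) + k * z₁ + 1 + a)
    (hb : S.J t = σ 0 (.inl true) + k * z₂ + 1 + b) :
    (1 ≤ S.covCount (σ ((z₁ * Z + z₂) * (S.N + 2) + 1 + t)) t a b ↔
      1 ≤ {q ∈ Finset.range S.N |
        σ ((z₁ * Z + z₂) * (S.N + 2) + 1 + q) (.inl false) = 1 ∧ S.Cov q t}.card) ∧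
    (S.covCount (σ ((z₁ * Z + z₂) * (S.N + 2) + 1 + t)) t a b = 1 ↔
      {q ∈ Finset.range S.N |
        σ ((z₁ * Z + z₂) * (S.N + 2) + 1 + q) (.inl false) = 1 ∧ S.Cov q t}.card = 1) := by
  have key := covCount_iff (σ := fun t => σ ((z₁ * Z + z₂) * (S.N + 2) + 1 + t))
    (c := fun q => σ ((z₁ * Z + z₂) * (S.N + 2) + 1 + q) (.inl false) = 1) hS.y_lt ?_ ?_
    (fun q hq => (cell_move hσ h₁ h₂ hq).1) ht
    (fun h => hsq ((cell_move hσ h₁ h₂ ht).2.1 h).1) ha hb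
  · convert key
  · intro gi gj up f
    exact (((cell_step hσ h₁ h₂ (show 0 < S.N + 2 by omega)).2.2.1 (by omega)).1 gi gj up f).2
  · intro gi gj up f
    have := (((cell_step hσ h₁ h₂ (show S.N + 1 < S.N + 2 by omega)).2.2.1 (by omega)).1
      gi gj up f).1
    rwa [show (z₁ * Z + z₂) * (S.N + 2) + (S.N + 1) = (z₁ * Z + z₂) * (S.N + 2) + 1 + S.N by
      omega] at this

theorem sel_cell (hσ : ∀ l < S.layers Z, S.LayerStep Z l (σ l) (σ (l + 1)))
    {q : ℕ} (hq : S.Sel Z σ q) : q < S.N ∧ S.sq q ∧ ∃ z₁ < Z, ∃ z₂ < Z,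
    σ ((z₁ * Z + z₂) * (S.N + 2) + 1 + q) (.inl false) = 1 ∧
    (σ 0 (.inl true) + k * z₁ ≤ S.I q ∧ S.I q ≤ σ 0 (.inl true) + k * z₁ + k) ∧
    (σ 0 (.inl true) + k * z₂ ≤ S.J q ∧ S.J q ≤ σ 0 (.inl true) + k * z₂ + k) := by
  obtain ⟨l, hl, h₁, h₂⟩ := hq
  obtain ⟨d₁, d₂, d₃, d₄⟩ := layer_decomp hl
  -- A clearing step forces the selection bit to `0`, so the step belongs to an event.
  have hqN : q < S.N := by
    by_contra hcon
    have := ((hσ l hl).2.2.1 (by omega)).2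
    omega
  rw [h₂] at d₄
  rw [show (l / (S.N + 2) / Z * Z + l / (S.N + 2) % Z) * (S.N + 2) + (q + 1) =
    (l / (S.N + 2) / Z * Z + l / (S.N + 2) % Z) * (S.N + 2) + 1 + q by omega] at d₄
  have hm := (cell_move hσ d₁ d₂ hqN).2.1
  rw [← d₄] at hm
  refine ⟨hqN, (hm h₁).1, _, d₁, _, d₂, ?_, (hm h₁).2⟩
  rw [← d₄, h₁]

theorem sel_of_cell {z₁ z₂ q : ℕ} (h₁ : z₁ < Z) (h₂ : z₂ < Z) (hq : q < S.N)
    (h : σ ((z₁ * Z + z₂) * (S.N + 2) + 1 + q) (.inl false) = 1) : S.Sel Z σ q := by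
  rw [show (z₁ * Z + z₂) * (S.N + 2) + 1 + q = (z₁ * Z + z₂) * (S.N + 2) + (q + 1) by omega] at h
  exact ⟨_, layer_lt h₁ h₂ (by omega), h, (layer_coords h₂ (by omega)).1⟩

/-- Every point, on the boundary or not, lies in one cell, and the transitions of that cell demand a
cover among its own selected squares. -/
theorem sel_covers (hσ : ∀ l < S.layers Z, S.LayerStep Z l (σ l) (σ (l + 1)))
    (hS : S.Bounded k) (hk : 1 ≤ k) (hZ : Z = 2 * S.N + 2) {p : ℕ} (hp : p < S.N)
    (hsq : ¬ S.sq p) : ∃ q, S.Sel Z σ q ∧ S.Cov q p := by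
  classical
  have hs : σ 0 (.inl true) < k := (hσ 0 (by
    rw [layers, hZ]; positivity)).2.1
  obtain ⟨h₁, h₂⟩ := exists_cell (S := S) hk hZ hs (hS.I_mem p hp)
  obtain ⟨h₃, h₄⟩ := exists_cell (S := S) hk hZ hs (hS.J_mem p hp)
  have hc := (cell_move hσ h₁ h₃ hp).2.2 hsq ⟨_, Nat.mod_lt _ hk⟩ ⟨_, Nat.mod_lt _ hk⟩ ⟨h₂, h₄⟩
  rw [(cell_covCount hσ hS h₁ h₃ hp hsq h₂ h₄).1] at hc
  obtain ⟨q, hq⟩ := Finset.card_pos.1 hc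
  obtain ⟨hq₁, hq₂, hq₃⟩ := Finset.mem_filter.1 hq
  exact ⟨q, sel_of_cell h₁ h₃ (by simpa using hq₁) hq₂, hq₃⟩

/-- A square meeting block `w` starts in block `w` or `w - 1`. If `w` is neither first nor last in
its cell, neither of these is shared with another cell. -/
theorem cell_eq_of_meets {s z z' v w t t' a : ℕ} (hv : s + k * z' ≤ v ∧ v ≤ s + k * z' + k)
    (hw : w = s + k * z + 1 + a) (ha : 0 < a) (ha' : a + 1 < k) (h : Meets v t w t') :
    z' = z := by
  rcases Nat.lt_trichotomy z' z with h' | h' | h'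
  · have := Nat.mul_le_mul_left k (show z' + 1 ≤ z from h')
    rw [Nat.mul_succ] at this
    unfold Meets at h
    omega
  · exact h'
  · have := Nat.mul_le_mul_left k (show z + 1 ≤ z' from h')
    rw [Nat.mul_succ] at this
    unfold Meets at h
    omega

open Classical in
-- The count at an interior point sees only its own cell, and by `cell_eq_of_meets` no square
-- selected in another cell reaches the point. No point is counted twice, as all layers have the
-- same shift and so its block indices determine its cell.
theorem gain_le_unique (hσ : ∀ l < S.layers Z, S.LayerStep Z l (σ l) (σ (l + 1)))
    (hS : S.Bounded k) :
    {l ∈ Finset.range (S.layers Z) | S.LayerGain Z l (σ l)}.card ≤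
      {p ∈ Finset.range S.N | ¬ S.sq p ∧ ∃! q, S.Sel Z σ q ∧ S.Cov q p}.card := by
  have hshift := shift_eq hσ
  refine Finset.card_le_card_of_injOn (fun l => l % (S.N + 2) - 1) ?_ ?_
  · intro l hl
    simp only [Finset.coe_filter, Finset.mem_range, Set.mem_ofPred_eq] at hl ⊢
    obtain ⟨hl, hi, hsq, a, b, ⟨ha, hb⟩, ⟨hIa, hJb⟩, hcnt⟩ := hl
    rw [hshift l hl.le] at hIa hJb
    obtain ⟨d₁, d₂, d₃, d₄⟩ := layer_decomp hl
    have htN : l % (S.N + 2) - 1 < S.N := by omega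
    refine ⟨htN, hsq, ?_⟩
    have hl' : l = (l / (S.N + 2) / Z * Z + l / (S.N + 2) % Z) * (S.N + 2) + 1 +
        (l % (S.N + 2) - 1) := by omega
    have hc := (cell_covCount hσ hS d₁ d₂ htN hsq hIa hJb).2
    rw [← hl', hcnt] at hc
    obtain ⟨q, hq⟩ := Finset.card_eq_one.1 (hc.1 rfl)
    have hqm : q ∈ ({q} : Finset ℕ) := by simp
    rw [← hq, Finset.mem_filter] at hqm
    refine ⟨q, ⟨sel_of_cell d₁ d₂ (by simpa using hqm.1) hqm.2.1, hqm.2.2⟩, ?_⟩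
    rintro q' ⟨hq', hcov⟩
    obtain ⟨e₁, e₂, z₁, hz₁, z₂, hz₂, e₃, e₄, e₅⟩ := sel_cell hσ hq'
    obtain rfl := cell_eq_of_meets e₄ hIa ha.1 ha.2 hcov.1
    obtain rfl := cell_eq_of_meets e₅ hJb hb.1 hb.2 hcov.2
    have : q' ∈ ({q} : Finset ℕ) := by
      rw [← hq, Finset.mem_filter]
      exact ⟨by simpa using e₁, e₃, hcov⟩
    simpa using this
  · intro l hl l' hl' heq
    simp only [Finset.coe_filter, Finset.mem_range, Set.mem_ofPred_eq] at hl hl' heq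
    obtain ⟨hl, hi, hsq, a, b, ⟨ha, hb⟩, ⟨hIa, hJb⟩, hcnt⟩ := hl
    obtain ⟨hl', hi', hsq', a', b', ⟨ha', hb'⟩, ⟨hIa', hJb'⟩, hcnt'⟩ := hl'
    rw [hshift l hl.le] at hIa hJb
    rw [hshift l' hl'.le, ← heq] at hIa' hJb'
    obtain ⟨d₁, d₂, d₃, d₄⟩ := layer_decomp hl
    obtain ⟨d₁', d₂', d₃', d₄'⟩ := layer_decomp hl'
    have e₁ := (mul_add_unique (k := k) a.2 a'.2 (by omega :
      k * (l / (S.N + 2) / Z) + a = k * (l' / (S.N + 2) / Z) + a')).1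
    have e₂ := (mul_add_unique (k := k) b.2 b'.2 (by omega :
      k * (l / (S.N + 2) % Z) + b = k * (l' / (S.N + 2) % Z) + b')).1
    rw [d₄, d₄', e₁, e₂, show l % (S.N + 2) = l' % (S.N + 2) by omega]

end Sound

/-! ### The path of a feasible solution -/

/-- The two largest of the first `t` values of `x`. -/
def top (x : ℕ → ℕ) : ℕ → ℕ × ℕ
  | 0 => (0, 0)
  | t + 1 => (max (top x t).1 (x t), max (top x t).2 (min (top x t).1 (x t)))

theorem top_le {x : ℕ → ℕ} {B : ℕ} (h : ∀ t, x t ≤ B) (t : ℕ) :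
    (top x t).1 ≤ B ∧ (top x t).2 ≤ B := by
  induction t with
  | zero => simp [top]
  | succ t ih => have := h t; simp only [top]; omega

/-- The squares of `T` in a cell. -/
def InCell (S : Sweep) (k : ℕ) (T : ℕ → Prop) (a₀ b₀ t : ℕ) : Prop :=
  T t ∧ (a₀ ≤ S.I t ∧ S.I t ≤ a₀ + k) ∧ (b₀ ≤ S.J t ∧ S.J t ≤ b₀ + k)

open Classical in
/-- The values of the squares of one group that are selected by `c`. -/
noncomputable def groupVal (S : Sweep) (c : ℕ → Prop) (a₀ b₀ gi gj : ℕ) (up : Bool) (t : ℕ) : ℕ :=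
  if c t ∧ S.I t = a₀ + gi ∧ S.J t = b₀ + gj then S.val up t else 0

open Classical in
/-- The state before step `i` in a cell for the selection `c`. -/
noncomputable def stateAt (S : Sweep) (c : ℕ → Prop) (s a₀ b₀ i : ℕ) : Key k → ℕ
  | .inl true => s
  | .inl false => if 0 < i ∧ i ≤ S.N ∧ c (i - 1) then 1 else 0
  | .inr (gi, gj, up, true, true) =>
      if i = 0 then 0 else (top (S.groupVal c a₀ b₀ gi gj up) (i - 1)).1
  | .inr (gi, gj, up, true, false) =>
      if i = 0 then 0 else (top (S.groupVal c a₀ b₀ gi gj up) (i - 1)).2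
  | .inr (gi, gj, up, false, true) => if i = 0 then 0 else
      (top (fun j => S.groupVal c a₀ b₀ gi gj up (S.N - 1 - j)) (S.N + 1 - i)).1
  | .inr (gi, gj, up, false, false) => if i = 0 then 0 else
      (top (fun j => S.groupVal c a₀ b₀ gi gj up (S.N - 1 - j)) (S.N + 1 - i)).2

/-- The future lists are built up from the last event, so one step forward undoes the most recent
insertion. -/
theorem stateAt_chanMove (c : ℕ → Prop) (s a₀ b₀ : ℕ) {t : ℕ} (ht : t < S.N) :
    S.ChanMove (c t) t a₀ b₀ (S.stateAt (k := k) c s a₀ b₀ (1 + t))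
      (S.stateAt c s a₀ b₀ (1 + (t + 1))) := by
  intro gi gj up
  have e₁ : 1 + t - 1 = t := by omega
  have e₂ : 1 + (t + 1) - 1 = t + 1 := by omega
  have e₃ : S.N + 1 - (1 + t) = S.N - 1 - t + 1 := by omega
  have e₄ : S.N + 1 - (1 + (t + 1)) = S.N - 1 - t := by omega
  have e₅ : S.N - 1 - (S.N - 1 - t) = t := by omega
  have e₆ : ¬ (1 + t = 0) := by omega
  have e₇ : ¬ (1 + (t + 1) = 0) := by omega
  constructor <;> intro h
  all_goals
    simp only [stateAt, e₁, e₂, e₃, e₄, e₆, e₇, if_false, top, e₅, Ins, and_self, groupVal, h,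
      if_true]

section Complete

variable {T : ℕ → Prop} {s : ℕ}

/-- The state in layer `l` for the shift `s` and the solution `T`. -/
noncomputable def statePath (S : Sweep) (Z : ℕ) (T : ℕ → Prop) (s l : ℕ) : Key k → ℕ :=
  S.stateAt (S.InCell k T (s + k * (l / (S.N + 2) / Z)) (s + k * (l / (S.N + 2) % Z))) s
    (s + k * (l / (S.N + 2) / Z)) (s + k * (l / (S.N + 2) % Z)) (l % (S.N + 2))

/-- This bounds the numbers that have to be enumerated as components of states. -/
theorem statePath_le (hS : S.Bounded k) (hT : ∀ q, T q → q < S.N) (hs : s < k) (l : ℕ) (χ : Key k) :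
    S.statePath Z T s l χ ≤ S.N + k := by
  have hg : ∀ a₀ b₀ gi gj up t,
      S.groupVal (S.InCell k T a₀ b₀) a₀ b₀ gi gj up t ≤ S.N := by
    intro a₀ b₀ gi gj up t
    unfold groupVal
    split_ifs with h
    · have := hS.y_lt t (hT t h.1.1)
      unfold val
      split_ifs <;> omega
    · omega
  rcases χ with (_ | _) | ⟨gi, gj, up, (_ | _), (_ | _)⟩ <;> simp only [statePath, stateAt]
  · split_ifs <;> omega
  · omega
  all_goals
    split_ifs
    · omega
    · refine le_trans ?_ (Nat.le_add_right _ _)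
      first
        | exact (top_le (hg _ _ _ _ _) _).1
        | exact (top_le (hg _ _ _ _ _) _).2
        | exact (top_le (fun j => hg _ _ _ _ _ _) _).1
        | exact (top_le (fun j => hg _ _ _ _ _ _) _).2

open Classical in
theorem stateAt_covCount (hS : S.Bounded k) (c : ℕ → Prop) (s a₀ b₀ : ℕ) {t : ℕ} (ht : t < S.N)
    (hct : ¬ c t) {a b : Fin k} (ha : S.I t = a₀ + 1 + a) (hb : S.J t = b₀ + 1 + b) :
    (1 ≤ S.covCount (S.stateAt c s a₀ b₀ (1 + t)) t a b ↔
      1 ≤ {q ∈ Finset.range S.N | c q ∧ S.Cov q t}.card) ∧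
    (S.covCount (S.stateAt c s a₀ b₀ (1 + t)) t a b = 1 ↔
      {q ∈ Finset.range S.N | c q ∧ S.Cov q t}.card = 1) := by
  refine covCount_iff (σ := fun t => S.stateAt c s a₀ b₀ (1 + t)) hS.y_lt ?_ ?_
    (fun q hq => stateAt_chanMove c s a₀ b₀ hq) ht hct ha hb
  · rintro gi gj up (_ | _) <;> simp [stateAt, top]
  · rintro gi gj up (_ | _) <;> simp [stateAt, top, show S.N + 1 - (1 + S.N) = 0 by omega]

/-- Here `k + 1` blocks of squares per direction are needed for `k` blocks of points: restricting
`T` to the cell loses no square that reaches one of its points. -/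
theorem inCell_of_cov {a₀ b₀ q p : ℕ} {a b : Fin k} (ha : S.I p = a₀ + 1 + a)
    (hb : S.J p = b₀ + 1 + b) (hq : T q) (h : S.Cov q p) : S.InCell k T a₀ b₀ q := by
  have := a.2
  have := b.2
  simp only [Cov, Meets] at h
  exact ⟨hq, by omega, by omega⟩

/-- The restrictions of `T` to the cells make the same choice about a square in every cell that
contains it. That `T` covers all points gives the positive counts demanded at points. -/
theorem statePath_step (hS : S.Bounded k) (hT : ∀ q, T q → q < S.N ∧ S.sq q)
    (hcov : ∀ p < S.N, ¬ S.sq p → ∃ q, T q ∧ S.Cov q p) (hs : s < k) {l : ℕ}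
    (hl : l < S.layers Z) :
    S.LayerStep Z l (S.statePath (k := k) Z T s l) (S.statePath Z T s (l + 1)) := by
  classical
  obtain ⟨d₁, d₂, d₃, d₄⟩ := layer_decomp hl
  refine ⟨by simp [statePath, stateAt], by simpa [statePath, stateAt] using hs, ?_, ?_⟩
  · intro hi
    refine ⟨fun gi gj up f => ⟨?_, ?_⟩, ?_⟩
    · rcases hi with hi | hi
      · rcases f <;> simp [statePath, stateAt, hi]
      · have : S.N + 1 - l % (S.N + 2) = 0 := by omega
        rcases f <;> simp [statePath, stateAt, this, top]
    · rcases hi with hi | hi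
      · have : (l + 1) % (S.N + 2) = 1 := by rw [Nat.add_mod, hi]; simp
        rcases f <;> simp [statePath, stateAt, this, top]
      · have : (l + 1) % (S.N + 2) = 0 := by
          rw [Nat.add_mod, show l % (S.N + 2) = S.N + 1 by omega]; simp
        rcases f <;> simp [statePath, stateAt, this]
    · simp only [statePath, stateAt]
      rw [if_neg]
      omega
  · intro hi
    obtain ⟨t, ht⟩ : ∃ t, l % (S.N + 2) = 1 + t := ⟨l % (S.N + 2) - 1, by omega⟩
    have htN : t < S.N := by omega
    have hl' : l + 1 = (l / (S.N + 2) / Z * Z + l / (S.N + 2) % Z) * (S.N + 2) + (1 + (t + 1)) := by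
      omega
    obtain ⟨c₁, c₂, c₃⟩ := layer_coords (S := S) (z₁ := l / (S.N + 2) / Z) d₂
      (show 1 + (t + 1) < S.N + 2 by omega)
    rw [← hl'] at c₁ c₂ c₃
    have hsh : S.statePath (k := k) Z T s l (.inl true) = s := rfl
    rw [hsh]
    have h₁ : S.statePath (k := k) Z T s l = S.stateAt (S.InCell k T (s + k * (l / (S.N + 2) / Z))
        (s + k * (l / (S.N + 2) % Z))) s (s + k * (l / (S.N + 2) / Z))
        (s + k * (l / (S.N + 2) % Z)) (1 + t) := by rw [statePath, ht]
    have h₂ : S.statePath (k := k) Z T s (l + 1) =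
        S.stateAt (S.InCell k T (s + k * (l / (S.N + 2) / Z))
        (s + k * (l / (S.N + 2) % Z))) s (s + k * (l / (S.N + 2) / Z))
        (s + k * (l / (S.N + 2) % Z)) (1 + (t + 1)) := by rw [statePath, c₁, c₂, c₃]
    rw [h₁, h₂, show l % (S.N + 2) - 1 = t by omega]
    generalize s + k * (l / (S.N + 2) / Z) = a₀
    generalize s + k * (l / (S.N + 2) % Z) = b₀
    have hch : S.stateAt (k := k) (S.InCell k T a₀ b₀) s a₀ b₀ (1 + t) (.inl false) = 1 ↔
        S.InCell k T a₀ b₀ t := by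
      simp only [stateAt, show 1 + t - 1 = t by omega]
      constructor
      · intro h
        by_contra hcon
        simp [hcon] at h
      · intro h
        rw [if_pos ⟨by omega, by omega, h⟩]
    refine ⟨?_, ?_, ?_⟩
    · rw [hch]
      exact stateAt_chanMove _ _ _ _ htN
    · rw [hch]
      exact fun h => ⟨(hT t h.1).2, h.2⟩
    · rintro hsq a b ⟨ha, hb⟩
      rw [(stateAt_covCount hS _ s a₀ b₀ htN (fun h => hsq (hT t h.1).2) ha hb).1]
      obtain ⟨q, hq, hqt⟩ := hcov t htN hsq
      exact Finset.card_pos.2 ⟨q, Finset.mem_filter.2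
        ⟨by simpa using (hT q hq).1, inCell_of_cov ha hb hq hqt, hqt⟩⟩

/-- The point `p` does not lie in the first or last row or column of its cell, for the shift `s`. -/
def Interior (S : Sweep) (k s p : ℕ) : Prop :=
  (0 < (S.I p - s - 1) % k ∧ (S.I p - s - 1) % k + 1 < k) ∧
  (0 < (S.J p - s - 1) % k ∧ (S.J p - s - 1) % k + 1 < k)

open Classical in
-- The only square of `T` covering an interior point also belongs to the cell of the point, so the
-- layer treating the point in that cell is a gain.
theorem unique_le_gain (hS : S.Bounded k) (hk : 1 ≤ k) (hZ : Z = 2 * S.N + 2)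
    (hT : ∀ q, T q → q < S.N ∧ S.sq q) (hs : s < k) :
    {p ∈ Finset.range S.N | (¬ S.sq p ∧ ∃! q, T q ∧ S.Cov q p) ∧ S.Interior k s p}.card ≤
      {l ∈ Finset.range (S.layers Z) | S.LayerGain Z l (S.statePath (k := k) Z T s l)}.card := by
  refine Finset.card_le_card_of_injOn
    (fun p => ((S.I p - s - 1) / k * Z + (S.J p - s - 1) / k) * (S.N + 2) + (1 + p)) ?_ ?_
  · intro p hp
    simp only [Finset.coe_filter, Finset.mem_range, Set.mem_ofPred_eq] at hp ⊢
    obtain ⟨hp, ⟨hsq, q, ⟨hq, hqp⟩, huniq⟩, hinn⟩ := hp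
    obtain ⟨h₁, h₂⟩ := exists_cell (S := S) hk hZ hs (hS.I_mem p hp)
    obtain ⟨h₃, h₄⟩ := exists_cell (S := S) hk hZ hs (hS.J_mem p hp)
    refine ⟨layer_lt h₁ h₃ (by omega), ?_⟩
    obtain ⟨c₁, c₂, c₃⟩ := layer_coords (S := S) (z₁ := (S.I p - s - 1) / k) h₃
      (show 1 + p < S.N + 2 by omega)
    unfold LayerGain statePath
    rw [c₁, c₂, c₃]
    refine ⟨by omega, by rwa [show 1 + p - 1 = p by omega], ⟨_, Nat.mod_lt _ hk⟩,
      ⟨_, Nat.mod_lt _ hk⟩, hinn, ?_, ?_⟩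
    · rw [show 1 + p - 1 = p by omega]
      exact ⟨h₂, h₄⟩
    · rw [show 1 + p - 1 = p by omega, (stateAt_covCount hS _ s _ _ hp
        (fun h => hsq (hT p h.1).2) h₂ h₄).2, Finset.card_eq_one]
      refine ⟨q, Finset.eq_singleton_iff_unique_mem.2 ⟨?_, ?_⟩⟩
      · exact Finset.mem_filter.2 ⟨by simpa using (hT q hq).1,
          inCell_of_cov (a := ⟨_, Nat.mod_lt _ hk⟩) (b := ⟨_, Nat.mod_lt _ hk⟩) h₂ h₄ hq hqp, hqp⟩
      · intro q' hq'
        obtain ⟨-, h₅, h₆⟩ := Finset.mem_filter.1 hq'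
        exact huniq q' ⟨h₅.1, h₆⟩
  · intro p hp p' hp' heq
    simp only [Finset.coe_filter, Finset.mem_range, Set.mem_ofPred_eq] at hp hp' heq
    have := (cell_inj (show 1 + p < S.N + 2 by omega) (show 1 + p' < S.N + 2 by omega) heq).2
    omega

end Complete

/-! ### Averaging over the shifts -/

/-- Being first in the cell fixes the shift as `v - 1` modulo `k`, being last as `v`; each
coordinate thus spoils at most two shifts. -/
theorem mod_eq_of_boundary {v s : ℕ} (hv : k ≤ v) (hs : s < k)
    (h : ¬ (0 < (v - s - 1) % k ∧ (v - s - 1) % k + 1 < k)) : s = v % k ∨ s = (v - 1) % k := by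
  have h₁ := Nat.div_add_mod (v - s - 1) k
  have h₂ := Nat.mod_lt (v - s - 1) (show 0 < k by omega)
  rcases Nat.eq_zero_or_pos ((v - s - 1) % k) with h₃ | h₃
  · right
    rw [show v - 1 = k * ((v - s - 1) / k) + s by omega, Nat.mul_add_mod, Nat.mod_eq_of_lt hs]
  · left
    have h₄ : (v - s - 1) % k = k - 1 := by omega
    have h₅ : v = k * ((v - s - 1) / k + 1) + s := by rw [Nat.mul_succ]; omega
    conv_rhs => rw [h₅]
    rw [Nat.mul_add_mod, Nat.mod_eq_of_lt hs]

open Classical in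
/-- For some shift, at most the fraction `4 / k` of the points in `U` is not interior. -/
theorem exists_shift (hS : S.Bounded k) (hk : 1 ≤ k) (U : Finset ℕ) (hU : ∀ p ∈ U, p < S.N) :
    ∃ s < k, k * U.card ≤ k * {p ∈ U | S.Interior k s p}.card + 4 * U.card := by
  by_contra! hcon
  -- Two bad residues for each of the two coordinates.
  have hbad : ∀ p ∈ U, {s ∈ Finset.range k | ¬ S.Interior k s p}.card ≤ 4 := by
    intro p hp
    refine (Finset.card_le_card (t := {S.I p % k, (S.I p - 1) % k, S.J p % k, (S.J p - 1) % k})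
      ?_).trans Finset.card_le_four
    intro s hs
    obtain ⟨hs, h⟩ := Finset.mem_filter.1 hs
    rw [Finset.mem_range] at hs
    simp only [Finset.mem_insert, Finset.mem_singleton]
    rcases not_and_or.1 h with h | h
    · rcases mod_eq_of_boundary (hS.I_mem p (hU p hp)).1 hs h with h | h <;> simp [← h]
    · rcases mod_eq_of_boundary (hS.J_mem p (hU p hp)).1 hs h with h | h <;> simp [← h]
  -- Double counting of the pairs of a shift and a point that is not interior for it.
  have hswap : ∑ s ∈ Finset.range k, {p ∈ U | ¬ S.Interior k s p}.card ≤ 4 * U.card := by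
    simp only [Finset.card_filter]
    rw [Finset.sum_comm]
    simp only [← Finset.card_filter]
    calc _ ≤ ∑ p ∈ U, 4 := Finset.sum_le_sum hbad
      _ = _ := by simp [mul_comm]
  have hlt : ∀ s ∈ Finset.range k, 4 * U.card < k * {p ∈ U | ¬ S.Interior k s p}.card := by
    intro s hs
    have h₁ := hcon s (by simpa using hs)
    have h₂ : {p ∈ U | S.Interior k s p}.card + {p ∈ U | ¬ S.Interior k s p}.card = U.card := by
      convert Finset.card_filter_add_card_filter_not (s := U) (fun p => S.Interior k s p)
    have h₃ := congrArg (k * ·) h₂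
    simp only [Nat.mul_add] at h₃
    omega
  have := Finset.sum_lt_sum_of_nonempty (s := Finset.range k) (by simpa using (by omega : k ≠ 0)) hlt
  rw [Finset.sum_const, Finset.card_range, smul_eq_mul, ← Finset.mul_sum] at this
  have := Nat.mul_le_mul_left k hswap
  omega

end Sweep

end UniqueSquareCover

namespace UniqueSquareCover

variable {R k : ℕ}

/-! ## The program -/

/-- The array with the values of the component `χ` of all states. -/
def tab (χ : Key k) : ℕ := 100 + 2 * Encodable.encode χ

/-- The loop counter for the component `χ` of the state. -/
def tabReg (χ : Key k) : ℕ := 101 + 2 * Encodable.encode χ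

/-- The combinatorial data in memory, in the order of the sweep. -/
def sweepOf (s : Store) : Sweep where
  N := s.nat 2 0
  sq t := s.nat 12 t < s.nat 0 1
  I t := s.nat 10 (s.nat 12 t)
  J t := s.nat 13 (s.nat 12 t)
  y t := s.nat 14 (s.nat 12 t)

/-- The state with number `u`. -/
def stateOf (s : Store) (u : ℕ) (χ : Key k) : ℕ := s.nat (tab χ) u

namespace Code

/-- Multiplication with a constant. -/
def mulConst (e : NatExpr) : ℕ → NatExpr
  | 0 => .const 0
  | k + 1 => .add (mulConst e k) e

@[simp] theorem eval_mulConst (s : Store) (e : NatExpr) (k : ℕ) :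
    (mulConst e k).eval s = k * e.eval s := by
  induction k with
  | zero => simp [mulConst]
  | succ k ih => simp [mulConst, ih, Nat.succ_mul]

/-- The component `χ` of the state whose number is in register `r`. -/
def comp (χ : Key k) (r : ℕ) : NatExpr := .read (tab χ) (reg r)

@[simp] theorem eval_comp (s : Store) (χ : Key k) (r : ℕ) :
    (comp χ r).eval s = stateOf s (s.nat r 0) χ := rfl

/-- The step within the cell. -/
def step : NatExpr := .read 32 (reg 23)
/-- The event of the step. -/
def event : NatExpr := .read 12 (.sub step (.const 1))
/-- The position of the cell in the first direction. -/
def cellX (k : ℕ) : NatExpr :=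
  .add (comp (k := k) (.inl true) 24) (mulConst (.read 30 (reg 23)) k)
/-- The position of the cell in the second direction. -/
def cellY (k : ℕ) : NatExpr :=
  .add (comp (k := k) (.inl true) 24) (mulConst (.read 31 (reg 23)) k)
/-- The step clears the state. -/
def isReset : Test := .or (.eq step (.const 0)) (.lt (reg 2) step)
/-- The event is a square. -/
def isSquare : Test := .lt event (.read 0 (.const 1))
/-- The value of a square. -/
def value (up : Bool) : NatExpr :=
  if up then .add (.read 14 event) (.const 1) else .sub (reg 2) (.read 14 event)
/-- The smallest value that a square needs in order to contain a point. -/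
def threshold (up : Bool) : NatExpr :=
  if up then .add (.read 14 event) (.const 2)
  else .add (.sub (reg 2) (.read 14 event)) (.const 1)
/-- The maximum of two expressions. -/
def max (e f : NatExpr) : NatExpr := .add e (.sub f e)
/-- The minimum of two expressions. -/
def min (e f : NatExpr) : NatExpr := .sub e (.sub e f)
/-- The test for `Ins`. -/
def ins (x a b a' b' : NatExpr) : Test := .conj (.eq a' (max a x)) (.eq b' (max b (min a x)))

@[simp] theorem holds_ins (s : Store) (x a b a' b' : NatExpr) :
    (ins x a b a' b').Holds s ↔ Ins (x.eval s) (a.eval s) (b.eval s) (a'.eval s) (b'.eval s) := by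
  have h₁ : ∀ e f : ℕ, e + (f - e) = Max.max e f := by omega
  have h₂ : ∀ e f : ℕ, e - (e - f) = Min.min e f := by omega
  simp [ins, max, min, Ins, h₁, h₂]

/-- The test for one component in `Sweep.ChanMove`. -/
def chanMove (gi gj : Fin (k + 1)) (up : Bool) : Test :=
  .cond (.conj (.eq (comp (k := k) (.inl false) 24) (.const 1))
      (.conj (.eq (.read 10 event) (.add (cellX k) (.const gi)))
        (.eq (.read 13 event) (.add (cellY k) (.const gj)))))
    (.conj (ins (value up) (comp (.inr (gi, gj, up, true, true)) 24)
        (comp (.inr (gi, gj, up, true, false)) 24) (comp (.inr (gi, gj, up, true, true)) 25)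
        (comp (.inr (gi, gj, up, true, false)) 25))
      (ins (value up) (comp (.inr (gi, gj, up, false, true)) 25)
        (comp (.inr (gi, gj, up, false, false)) 25) (comp (.inr (gi, gj, up, false, true)) 24)
        (comp (.inr (gi, gj, up, false, false)) 24)))
    (.conj (ins (.const 0) (comp (.inr (gi, gj, up, true, true)) 24)
        (comp (.inr (gi, gj, up, true, false)) 24) (comp (.inr (gi, gj, up, true, true)) 25)
        (comp (.inr (gi, gj, up, true, false)) 25))
      (ins (.const 0) (comp (.inr (gi, gj, up, false, true)) 25)
        (comp (.inr (gi, gj, up, false, false)) 25) (comp (.inr (gi, gj, up, false, true)) 24)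
        (comp (.inr (gi, gj, up, false, false)) 24)))

/-- The expression for `Sweep.pairCount`. -/
def pairCount (gi gj : Fin (k + 1)) (up past : Bool) : NatExpr :=
  .add (.sub (.const 1) (.sub (threshold up) (comp (.inr (gi, gj, up, past, true)) 24)))
    (.sub (.const 1) (.sub (threshold up) (comp (.inr (gi, gj, up, past, false)) 24)))

/-- The expression for `Sweep.covCount`. -/
def covCount (a b : Fin k) : NatExpr :=
  .add (.add (pairCount a.succ b.succ false true) (pairCount a.succ b.castSucc true true))
    (.add (pairCount a.castSucc b.succ false false) (pairCount a.castSucc b.castSucc true false))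

/-- The event lies in column `a` and row `b` of the cell. -/
def isAt (a b : Fin k) : Test :=
  .conj (.eq (.read 10 event) (.add (.add (cellX k) (.const 1)) (.const a)))
    (.eq (.read 13 event) (.add (.add (cellY k) (.const 1)) (.const b)))

/-- The test for `Sweep.Move`. -/
noncomputable def move (k : ℕ) : Test :=
  .conj (.forall fun g : Fin (k + 1) × Fin (k + 1) × Bool => chanMove g.1 g.2.1 g.2.2)
    (.conj
      (.imp (.eq (comp (k := k) (.inl false) 24) (.const 1))
        (.conj isSquare (.conj
          (.conj (.natLe (cellX k) (.read 10 event))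
            (.natLe (.read 10 event) (.add (cellX k) (.const k))))
          (.conj (.natLe (cellY k) (.read 13 event))
            (.natLe (.read 13 event) (.add (cellY k) (.const k)))))))
      (.imp (.neg isSquare) (.forall fun g : Fin k × Fin k =>
        .imp (isAt g.1 g.2) (.natLe (.const 1) (covCount g.1 g.2)))))

/-- The test for `Sweep.Step`. -/
noncomputable def edge (k : ℕ) : Test :=
  .conj (.eq (comp (k := k) (.inl true) 25) (comp (k := k) (.inl true) 24))
    (.conj (.lt (comp (k := k) (.inl true) 24) (.const k))
      (.cond isReset
        (.conj (.forall fun g : Fin (k + 1) × Fin (k + 1) × Bool × Bool =>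
            .conj (.eq (comp (.inr (g.1, g.2.1, g.2.2.1, false, g.2.2.2)) 24) (.const 0))
              (.eq (comp (.inr (g.1, g.2.1, g.2.2.1, true, g.2.2.2)) 25) (.const 0)))
          (.eq (comp (k := k) (.inl false) 24) (.const 0)))
        (move k)))

/-- The test for `Sweep.Gain`. -/
noncomputable def gain (k : ℕ) : Test :=
  .conj (.neg isReset) (.conj (.neg isSquare) (.neg (.forall fun g : Fin k × Fin k => .neg (.conj
    (.conj (.conj (.lt (.const 0) (.const g.1)) (.lt (.const (g.1 + 1)) (.const k)))
      (.conj (.lt (.const 0) (.const g.2)) (.lt (.const (g.2 + 1)) (.const k))))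
    (.conj (isAt g.1 g.2) (.eq (covCount g.1 g.2) (.const 1)))))))

theorem eval_value (s : Store) (up : Bool) :
    (value up).eval s = (sweepOf s).val up (s.nat 32 (s.nat 23 0) - 1) := by
  cases up <;> rfl

theorem eval_covCount (s : Store) (a b : Fin k) : (covCount a b).eval s =
    (sweepOf s).covCount (stateOf s (s.nat 24 0)) (s.nat 32 (s.nat 23 0) - 1) a b := rfl

/-- The test mirrors the predicate clause by clause, so after evaluation both sides agree by
definition. -/
theorem holds_move (s : Store) : (move k).Holds s ↔
    (sweepOf s).Move (s.nat 32 (s.nat 23 0) - 1)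
      (stateOf (k := k) s (s.nat 24 0) (.inl true) + k * s.nat 30 (s.nat 23 0))
      (stateOf (k := k) s (s.nat 24 0) (.inl true) + k * s.nat 31 (s.nat 23 0))
      (stateOf (k := k) s (s.nat 24 0)) (stateOf s (s.nat 25 0)) := by
  simp only [move, holds_conj, holds_forall, Prod.forall, chanMove, holds_cond, holds_ins,
    eval_value, holds_imp, holds_neg, isSquare, isAt, holds_eq, holds_natLe, holds_lt, eval_comp,
    eval_const, eval_read, eval_add, cellX, cellY, eval_mulConst, eval_reg, eval_covCount]
  exact Iff.rfl

theorem holds_edge (s : Store) : (edge k).Holds s ↔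
    (sweepOf s).Step (s.nat 32 (s.nat 23 0)) (s.nat 30 (s.nat 23 0)) (s.nat 31 (s.nat 23 0))
      (stateOf (k := k) s (s.nat 24 0)) (stateOf s (s.nat 25 0)) := by
  simp only [edge, holds_conj, holds_forall, Prod.forall, holds_cond, holds_move, isReset,
    holds_or, holds_eq, holds_lt, eval_comp, eval_const, eval_read, step, eval_reg]
  exact Iff.rfl

theorem holds_gain (s : Store) : (gain k).Holds s ↔
    (sweepOf s).Gain (s.nat 32 (s.nat 23 0)) (s.nat 30 (s.nat 23 0)) (s.nat 31 (s.nat 23 0))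
      (stateOf (k := k) s (s.nat 24 0)) := by
  simp only [gain, holds_conj, holds_forall, Prod.forall, isReset, isSquare, isAt, holds_neg,
    holds_or, holds_eq, holds_lt, eval_comp, eval_const, eval_read, eval_add, eval_sub, step,
    event, cellX, cellY, eval_mulConst, eval_reg, eval_covCount, not_forall, not_not]
  exact Iff.rfl

end Code

/-- The approximation algorithm. -/
noncomputable def mainProg (k : ℕ) : Prog :=
  block [normProg k,
    .setNat 33 (.const 0) (.add (.add (reg 2) (reg 2)) (.const 2)),
    .setNat 34 (.const 0) (.add (reg 2) (.const 2)),
    .setNat 35 (.const 0) (.add (reg 2) (.const (1 + k))),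
    -- The arrays `30` to `32` give the cell coordinates and the step of each layer, and register
    -- `21` the number of layers; the next table lists all states and leaves their number in
    -- register `20`.
    tabulate 21 (fun j : Fin 3 => 30 + j) (fun j => 40 + j) ![reg 33, reg 33, reg 34] [0, 1, 2],
    tabulate 20 tab tabReg (fun _ => reg 35) (Finset.univ : Finset (Key k)).toList,
    pathProg (Code.edge k) (Code.gain k) (.eq (Code.comp (k := k) (.inl false) 29) (.const 1))
      (.read 12 (.sub (.read 32 (reg 26)) (.const 1)))]

theorem Normalized.congr {n m : ℕ} {px py cx cy : ℕ → ℝ} {s s' : Store}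
    (h : Normalized k n m px py cx cy s)
    (he : ∀ a, 2 ≤ a → a < 16 → s'.nat a = s.nat a) : Normalized k n m px py cx cy s' := by
  have e₁ := he 2 (by simp) (by simp)
  have e₂ := he 10 (by simp) (by simp)
  have e₃ := he 11 (by simp) (by simp)
  have e₄ := he 12 (by simp) (by simp)
  have e₅ := he 13 (by simp) (by simp)
  have e₆ := he 14 (by simp) (by simp)
  obtain ⟨h₁, h₂, h₃, h₄, h₅, h₆, h₇, h₈⟩ := h
  constructor <;> simpa only [e₁, e₂, e₃, e₄, e₅, e₆]

theorem nestSize_const {ι : Type*} (B : ℕ) (l : List ι) :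
    nestSize (fun _ => B) l = B ^ l.length := by
  induction l with
  | nil => rfl
  | cons i l ih => simp [nestSize, ih, pow_succ, mul_comm]

/-- There are `(n + m + 1 + k) ^ Fintype.card (Key k)` states and at most `(2 * (n + m) + 2) ^ 3`
layers, so the power in `hR` bounds all loops. The memory `s₀` is the one in which the path search
starts. -/
theorem wp_mainProg {n m : ℕ} (s : Store) (hn : s.nat 0 0 = n) (hm : s.nat 0 1 = m)
    (hzero : ∀ a i, 1 ≤ a → s.nat a i = 0)
    (hR : (2 * (n + m) + 2 + k) ^ (Fintype.card (Key k) + 3) ≤ R) :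
    Wp R (mainProg k) (fun s' => ∃ s₀ : Store, ∃ M,
      Normalized k n m (s.real 0) (s.real 1) (s.real 2) (s.real 3) s₀ ∧
      s₀.nat 0 1 = m ∧
      (∀ x : Key k → ℕ, (∀ χ, x χ ≤ n + m + k) → ∃ u < M, stateOf s₀ u = x) ∧
      let E : ℕ → ℕ → ℕ → Prop := fun l u v =>
        (sweepOf s₀).LayerStep (k := k) (2 * (n + m) + 2) l (stateOf s₀ u) (stateOf s₀ v)
      let W : ℕ → ℕ → Prop := fun l u =>
        (sweepOf s₀).LayerGain (k := k) (2 * (n + m) + 2) l (stateOf s₀ u)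
      let L := (sweepOf s₀).layers (2 * (n + m) + 2)
      (∃ π, IsPath M L E π) →
      ∃ π, IsPath M L E π ∧ (∀ π', IsPath M L E π' → pathWeight L W π' ≤ pathWeight L W π) ∧
        ∀ j, s'.nat 1 j ≠ 0 ↔ ∃ l < L, stateOf (k := k) s₀ (π l) (.inl false) = 1 ∧
          s₀.nat 12 (l % (n + m + 2) - 1) = j) s := by
  have hpow : ∀ b d, b ≤ 2 * (n + m) + 2 + k → d ≤ Fintype.card (Key k) + 3 → b ^ d ≤ R := by
    intro b d hb hd
    exact ((Nat.pow_le_pow_left hb d).trans (Nat.pow_le_pow_right (by omega) hd)).trans hR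
  have hpow1 : ∀ b, b ≤ 2 * (n + m) + 2 + k → b ≤ R := fun b hb => by
    simpa using hpow b 1 hb (by omega)
  refine wp_block_cons ((wp_normProg s hn hm (hpow1 _ (by omega))).mono ?_)
  rintro s₁ ⟨f₁, hnorm⟩
  refine wp_block_cons (wp_setNat (wp_block_cons (wp_setNat (wp_block_cons (wp_setNat ?_)))))
  generalize hs₂ : ((s₁.setNat 33 _ _).setNat 34 _ _).setNat 35 _ _ = s₂
  have hsz := hnorm.size
  have f₂ : Frame {33, 34, 35} ∅ s₁ s₂ := by
    rw [← hs₂]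
    exact (((Frame.refl _ _ _).setNat _ _ (by simp)).setNat _ _ (by simp)).setNat _ _ (by simp)
  have h33 : s₂.nat 33 0 = 2 * (n + m) + 2 := by rw [← hs₂]; simp [hsz]; omega
  have h34 : s₂.nat 34 0 = n + m + 2 := by rw [← hs₂]; simp [hsz]
  have h35 : s₂.nat 35 0 = n + m + 1 + k := by rw [← hs₂]; simp [hsz]; omega
  refine wp_block_cons ((wp_tabulate (β := ![2 * (n + m) + 2, 2 * (n + m) + 2, n + m + 2])
    (by simp) ?_ ?_ ?_ ?_ ?_ s₂ ?_ ?_).mono ?_)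
  · intro i j h; ext; simpa using h
  · intro i j h; ext; simpa using h
  · intro i j; have := i.2; omega
  · intro i; omega
  · intro i; omega
  · intro i _
    fin_cases i <;> simp <;> exact hpow1 _ (by omega)
  · intro i _ s' f
    have q₁ : s'.nat 33 = s₂.nat 33 := f.1 33 (by
      simp only [Set.mem_union, Set.mem_singleton_iff, Set.mem_range, not_or, not_exists]
      exact ⟨⟨by omega, fun i => by omega⟩, fun i => by omega⟩)
    have q₂ : s'.nat 34 = s₂.nat 34 := f.1 34 (by
      simp only [Set.mem_union, Set.mem_singleton_iff, Set.mem_range, not_or, not_exists]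
      exact ⟨⟨by omega, fun i => by omega⟩, fun i => by omega⟩)
    fin_cases i <;> simp [q₁, q₂, h33, h34]
  rintro s₃ ⟨f₃, h21, htab₃⟩
  have fr₃ : ∀ a, a ≠ 21 → (a < 30 ∨ 33 ≤ a) → (a < 40 ∨ 43 ≤ a) → s₃.nat a = s₂.nat a := by
    intro a h₁ h₂ h₃
    refine f₃.1 a ?_
    simp only [Set.mem_union, Set.mem_singleton_iff, Set.mem_range, not_or, not_exists]
    exact ⟨⟨h₁, fun i => by omega⟩, fun i => by omega⟩
  have henc : Function.Injective (Encodable.encode : Key k → ℕ) := Encodable.encode_injective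
  refine wp_block_cons ((wp_tabulate (β := fun _ => n + m + 1 + k)
    (Finset.nodup_toList _) ?_ ?_ ?_ ?_ ?_ s₃ ?_ ?_).mono ?_)
  · intro i j h
    exact henc (by simp only [tabReg] at h; omega)
  · intro i j h
    exact henc (by simp only [tab] at h; omega)
  · intro i j; simp only [tab, tabReg]; omega
  · intro i; simp only [tab]; omega
  · intro i; simp only [tabReg]; omega
  · intro i _
    exact hpow1 _ (by omega)
  · intro i _ s' f
    have q₁ : s'.nat 35 = s₃.nat 35 := f.1 35 (by
      simp only [Set.mem_union, Set.mem_singleton_iff, Set.mem_range, not_or, not_exists, tab,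
        tabReg]
      exact ⟨⟨by omega, fun i => by omega⟩, fun i => by omega⟩)
    simp [q₁, fr₃ 35 (by omega) (by omega) (by omega), h35]
  rintro s₄ ⟨f₄, h20, htab₄⟩
  have fr₄ : ∀ a, a ≠ 20 → a < 100 → s₄.nat a = s₃.nat a := by
    intro a h₁ h₂
    refine f₄.1 a ?_
    simp only [Set.mem_union, Set.mem_singleton_iff, Set.mem_range, not_or, not_exists, tab,
      tabReg]
    exact ⟨⟨h₁, fun i => by omega⟩, fun i => by omega⟩
  have fr₂ : ∀ a, a < 33 → s₂.nat a = s₁.nat a := fun a ha => f₂.1 a (by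
    simp only [Set.mem_insert_iff, Set.mem_singleton_iff, not_or]; omega)
  have fr : ∀ a, a < 30 → a ≠ 20 → a ≠ 21 → s₄.nat a = s₁.nat a := fun a h₁ h₂ h₃ => by
    rw [fr₄ a h₂ (by omega), fr₃ a h₃ (by omega) (by omega), fr₂ a (by omega)]
  have hnorm₄ : Normalized k n m (s.real 0) (s.real 1) (s.real 2) (s.real 3) s₄ :=
    hnorm.congr fun a _ _ => fr a (by omega) (by omega) (by omega)
  have hL : s₄.nat 21 0 = (sweepOf s₄).layers (2 * (n + m) + 2) := by
    rw [fr₄ 21 (by omega) (by omega), h21]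
    simp [nestSize, Sweep.layers, sweepOf, hnorm₄.size]
  have htab : ∀ l < (sweepOf s₄).layers (2 * (n + m) + 2),
      s₄.nat 30 l = l / (n + m + 2) / (2 * (n + m) + 2) ∧
      s₄.nat 31 l = l / (n + m + 2) % (2 * (n + m) + 2) ∧ s₄.nat 32 l = l % (n + m + 2) := by
    intro l hl
    have hN : (sweepOf s₄).N = n + m := hnorm₄.size
    obtain ⟨d₁, d₂, d₃, d₄⟩ := Sweep.layer_decomp hl
    rw [hN] at d₁ d₂ d₃ d₄
    have := htab₃ ![l / (n + m + 2) / (2 * (n + m) + 2), l / (n + m + 2) % (2 * (n + m) + 2),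
      l % (n + m + 2)] (by
        intro i _
        fin_cases i
        · exact d₁
        · exact d₂
        · exact d₃)
    have hidx : nestIndex ![2 * (n + m) + 2, 2 * (n + m) + 2, n + m + 2]
        ![l / (n + m + 2) / (2 * (n + m) + 2), l / (n + m + 2) % (2 * (n + m) + 2),
          l % (n + m + 2)] [0, 1, 2] = l := by
      conv_rhs => rw [d₄]
      simp [nestIndex, nestSize]
      ring
    rw [hidx] at this
    refine ⟨?_, ?_, ?_⟩
    · rw [fr₄ 30 (by omega) (by omega)]; exact this 0 (by simp)
    · rw [fr₄ 31 (by omega) (by omega)]; exact this 1 (by simp)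
    · rw [fr₄ 32 (by omega) (by omega)]; exact this 2 (by simp)
  -- The search leaves the sweep data and the tables intact, so its tests always refer to `s₄`.
  have hview : ∀ s', Frame pathScratch ∅ s₄ s' → sweepOf s' = sweepOf s₄ ∧
      (∀ u, stateOf (k := k) s' u = stateOf s₄ u) ∧ s'.nat 30 = s₄.nat 30 ∧
      s'.nat 31 = s₄.nat 31 ∧ s'.nat 32 = s₄.nat 32 ∧ s'.nat 12 = s₄.nat 12 := by
    intro s' f
    have e : ∀ a, a ≠ 1 → (a < 22 ∨ 29 < a) → s'.nat a = s₄.nat a := by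
      intro a h₁ h₂
      refine f.1 a ?_
      simp only [pathScratch, Set.mem_insert_iff, Set.mem_singleton_iff]
      omega
    refine ⟨?_, ?_, e 30 (by simp) (by simp), e 31 (by simp) (by simp), e 32 (by simp) (by simp),
      e 12 (by simp) (by simp)⟩
    · simp only [sweepOf, e 2 (by simp) (by simp), e 12 (by simp) (by simp),
        e 0 (by simp) (by simp), e 10 (by simp) (by simp), e 13 (by simp) (by simp),
        e 14 (by simp) (by simp)]
    · intro u; funext χ
      simp only [stateOf, tab]
      rw [e _ (by omega) (by omega)]
  have hM : nestSize (fun _ : Key k => n + m + 1 + k) (Finset.univ : Finset (Key k)).toList ≤ R := by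
    rw [nestSize_const, Finset.length_toList, Finset.card_univ]
    exact hpow _ _ (by omega) (by omega)
  have hLR : (sweepOf s₄).layers (2 * (n + m) + 2) ≤ R := by
    have hN : (sweepOf s₄).N = n + m := hnorm₄.size
    refine le_trans ?_ (hpow (2 * (n + m) + 2) 3 (by omega) (by omega))
    rw [Sweep.layers, hN, pow_succ, pow_succ, pow_one, Nat.mul_assoc]
    exact Nat.mul_le_mul_left _ (Nat.mul_le_mul_left _ (by omega))
  refine wp_block_cons ((wp_pathProg
    (Ep := fun l u v => (sweepOf s₄).Step (s₄.nat 32 l) (s₄.nat 30 l) (s₄.nat 31 l)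
      (stateOf (k := k) s₄ u) (stateOf s₄ v))
    (Wq := fun l u => (sweepOf s₄).Gain (s₄.nat 32 l) (s₄.nat 30 l) (s₄.nat 31 l)
      (stateOf (k := k) s₄ u))
    (Cp := fun _ u => stateOf (k := k) s₄ u (.inl false) = 1)
    (mp := fun l => s₄.nat 12 (s₄.nat 32 l - 1)) s₄ ?_ ?_ ?_ ?_ h20 hL hM hLR ?_ ?_).mono ?_)
  · intro s' f
    obtain ⟨v₁, v₂, v₃, v₄, v₅, v₆⟩ := hview s' f
    rw [Code.holds_edge, v₁, v₂, v₂, v₃, v₄, v₅]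
  · intro s' f
    obtain ⟨v₁, v₂, v₃, v₄, v₅, v₆⟩ := hview s' f
    rw [Code.holds_gain, v₁, v₂, v₃, v₄, v₅]
  · intro s' f
    obtain ⟨v₁, v₂, v₃, v₄, v₅, v₆⟩ := hview s' f
    simp [v₂]
  · intro s' f
    obtain ⟨v₁, v₂, v₃, v₄, v₅, v₆⟩ := hview s' f
    simp [v₅, v₆]
  · intro i
    rw [fr 27 (by omega) (by omega) (by omega), f₁.1 27 (by simp), hzero _ _ (by omega)]
  · intro i
    rw [fr 1 (by omega) (by omega) (by omega), f₁.1 1 (by simp), hzero _ _ (by omega)]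
  intro s' hs'
  refine wp_block_nil ⟨s₄, nestSize (fun _ : Key k => n + m + 1 + k) Finset.univ.toList, hnorm₄, ?_,
    ?_, ?_⟩
  · rw [fr 0 (by omega) (by omega) (by omega), f₁.1 0 (by simp), hm]
  · intro x hx
    have := htab₄ x (fun χ _ => by have := hx χ; omega)
    refine ⟨_, nestIndex_lt (l := (Finset.univ : Finset (Key k)).toList) (x := x)
      (β := fun _ => n + m + 1 + k) (fun χ _ => by have := hx χ; omega), ?_⟩
    funext χ
    exact this χ (by simp)
  · intro E W L
    have hN : (sweepOf s₄).N = n + m := hnorm₄.size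
    have hEiff : ∀ l < L, ∀ u v, (sweepOf s₄).Step (s₄.nat 32 l) (s₄.nat 30 l) (s₄.nat 31 l)
      (stateOf (k := k) s₄ u) (stateOf s₄ v) ↔ E l u v := by
      intro l hl u v
      obtain ⟨t₁, t₂, t₃⟩ := htab l hl
      simp only [E, Sweep.LayerStep, hN, t₁, t₂, t₃]
    have hWiff : ∀ l < L, ∀ u, (sweepOf s₄).Gain (s₄.nat 32 l) (s₄.nat 30 l) (s₄.nat 31 l)
      (stateOf (k := k) s₄ u) ↔ W l u := by
      intro l hl u
      obtain ⟨t₁, t₂, t₃⟩ := htab l hl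
      simp only [W, Sweep.LayerGain, hN, t₁, t₂, t₃]
    have hpath : ∀ M π, IsPath M L (fun l u v => (sweepOf s₄).Step (s₄.nat 32 l) (s₄.nat 30 l)
        (s₄.nat 31 l) (stateOf (k := k) s₄ u) (stateOf s₄ v)) π ↔ IsPath M L E π := fun M π =>
      and_congr_right fun _ => forall₂_congr fun l hl => hEiff l hl _ _
    have hweight : ∀ π, pathWeight L (fun l u => (sweepOf s₄).Gain (s₄.nat 32 l) (s₄.nat 30 l)
        (s₄.nat 31 l) (stateOf (k := k) s₄ u)) π = pathWeight L W π := by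
      classical
      intro π
      unfold pathWeight
      congr 1
      exact Finset.filter_congr fun l hl => hWiff l (by simpa using hl) _
    rintro ⟨π₀, hπ₀⟩
    obtain ⟨π, h₁, h₂, h₃⟩ := hs' ⟨π₀, (hpath _ π₀).2 hπ₀⟩
    refine ⟨π, (hpath _ π).1 h₁, fun π' hπ' => ?_, fun j => (h₃ j).trans ?_⟩
    · rw [← hweight, ← hweight]
      exact h₂ π' ((hpath _ π').2 hπ')
    · refine exists_congr fun l => and_congr_right fun hl => ?_
      rw [(htab l hl).2.2]

end UniqueSquareCover

namespace UniqueSquareCover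

variable {k : ℕ} {P D : List (ℝ × ℝ)} {s : Store}

/-! ## Correctness -/

theorem getD_inj {l : List (ℝ × ℝ)} (hl : l.Nodup) {i j : ℕ} (hi : i < l.length)
    (hj : j < l.length) (h : l.getD i 0 = l.getD j 0) : i = j := by
  rw [List.getD_eq_getElem _ _ hi, List.getD_eq_getElem _ _ hj] at h
  exact (hl.getElem_inj_iff).1 h

theorem exists_getD {l : List (ℝ × ℝ)} {x : ℝ × ℝ} (h : x ∈ l) : ∃ i < l.length, l.getD i 0 = x := by
  obtain ⟨i, hi, rfl⟩ := List.getElem_of_mem h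
  exact ⟨i, hi, List.getD_eq_getElem _ _ hi⟩

theorem getD_mem {l : List (ℝ × ℝ)} {i : ℕ} (hi : i < l.length) : l.getD i 0 ∈ l := by
  rw [List.getD_eq_getElem _ _ hi]
  exact List.getElem_mem hi

/-- The memory describes the combinatorial structure of the instance `P`, `D`. -/
def Describes (k : ℕ) (P D : List (ℝ × ℝ)) (s : Store) : Prop :=
  Normalized k P.length D.length (fun i => (P.getD i 0).1) (fun i => (P.getD i 0).2)
    (fun i => (D.getD i 0).1) (fun i => (D.getD i 0).2) s ∧ s.nat 0 1 = D.length

/-- The positions in the sweep of the squares in `A`. -/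
def TimesOf (D : List (ℝ × ℝ)) (s : Store) (A : Finset (ℝ × ℝ)) (q : ℕ) : Prop :=
  q < s.nat 2 0 ∧ s.nat 12 q < D.length ∧ D.getD (s.nat 12 q) 0 ∈ A

theorem Describes.event_lt (hd : Describes k P D s) {t : ℕ} (ht : t < s.nat 2 0) :
    s.nat 12 t < P.length + D.length ∧ s.nat 11 (s.nat 12 t) = t := by
  rw [hd.1.size] at ht
  obtain ⟨e, he, rfl⟩ := hd.1.exists_rankX t ht
  rw [(hd.1.rankX e he).2]
  exact ⟨he, rfl⟩

theorem Describes.event_inj (hd : Describes k P D s) {t t' : ℕ}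
    (ht : t < s.nat 2 0) (ht' : t' < s.nat 2 0)
    (h : s.nat 12 t = s.nat 12 t') : t = t' := by
  rw [← (hd.event_lt ht).2, ← (hd.event_lt ht').2, h]

theorem Describes.bounded (hd : Describes k P D s) : (sweepOf s).Bounded k := by
  have hs : (sweepOf s).N = P.length + D.length := hd.1.size
  refine ⟨fun t ht => ?_, fun t ht => ?_, fun t ht => ?_⟩
  · rw [hs]; exact hd.1.rankY _ (hd.event_lt ht).1
  · rw [hs]; exact hd.1.blockX _ (hd.event_lt ht).1
  · rw [hs]; exact hd.1.blockY _ (hd.event_lt ht).1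

/-- Points are numbered after the squares, whence the subtraction of `D.length`. -/
theorem Describes.mem_unitSquare_iff (hd : Describes k P D s) {q p : ℕ}
    (hq : q < s.nat 2 0) (hp : p < s.nat 2 0)
    (hqD : s.nat 12 q < D.length) (hpD : ¬ s.nat 12 p < D.length) :
    P.getD (s.nat 12 p - D.length) 0 ∈ unitSquare (D.getD (s.nat 12 q) 0) ↔
      (sweepOf s).Cov q p := by
  obtain ⟨h₁, h₂⟩ := hd.event_lt hp
  have hx := hd.1.meetsX _ hqD (s.nat 12 p - D.length) (by omega)
  have hy := hd.1.meetsY _ hqD (s.nat 12 p - D.length) (by omega)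
  rw [show D.length + (s.nat 12 p - D.length) = s.nat 12 p by omega] at hx hy
  rw [(hd.event_lt hq).2, h₂] at hx
  exact and_congr hx hy

variable {A : Finset (ℝ × ℝ)}

theorem Describes.exists_time (hd : Describes k P D s) (hA : A ⊆ D.toFinset)
    {c : ℝ × ℝ} (hc : c ∈ A) :
    ∃ q, TimesOf D s A q ∧ D.getD (s.nat 12 q) 0 = c := by
  obtain ⟨j, hj, rfl⟩ := exists_getD (List.mem_toFinset.1 (hA hc))
  obtain ⟨h₁, h₂⟩ := hd.1.rankX j (by omega)
  refine ⟨s.nat 11 j, ⟨by rw [hd.1.size]; exact h₁, by rwa [h₂], by rwa [h₂]⟩, by rw [h₂]⟩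

theorem Describes.covered_iff (hd : Describes k P D s) (hA : A ⊆ D.toFinset)
    {p : ℕ} (hp : p < s.nat 2 0) (hpD : ¬ s.nat 12 p < D.length) :
    (∃ c ∈ A, P.getD (s.nat 12 p - D.length) 0 ∈ unitSquare c) ↔
      ∃ q, TimesOf D s A q ∧ (sweepOf s).Cov q p := by
  constructor
  · rintro ⟨c, hc, h⟩
    obtain ⟨q, hq, rfl⟩ := hd.exists_time hA hc
    exact ⟨q, hq, (hd.mem_unitSquare_iff hq.1 hp hq.2.1 hpD).1 h⟩
  · rintro ⟨q, hq, h⟩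
    exact ⟨_, hq.2.2, (hd.mem_unitSquare_iff hq.1 hp hq.2.1 hpD).2 h⟩

/-- Without repetitions in `D`, a centre occurs at one time of the sweep only, so uniqueness of the
centre passes to the time. -/
theorem Describes.unique_iff (hd : Describes k P D s) (hA : A ⊆ D.toFinset)
    (hD : D.Nodup) {p : ℕ} (hp : p < s.nat 2 0)
    (hpD : ¬ s.nat 12 p < D.length) :
    (∃! c, c ∈ A ∧ P.getD (s.nat 12 p - D.length) 0 ∈ unitSquare c) ↔
      ∃! q, TimesOf D s A q ∧ (sweepOf s).Cov q p := by
  constructor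
  · rintro ⟨c, ⟨hc, h⟩, hu⟩
    obtain ⟨q, hq, rfl⟩ := hd.exists_time hA hc
    refine ⟨q, ⟨hq, (hd.mem_unitSquare_iff hq.1 hp hq.2.1 hpD).1 h⟩, ?_⟩
    rintro q' ⟨hq', h'⟩
    have := hu _ ⟨hq'.2.2, (hd.mem_unitSquare_iff hq'.1 hp hq'.2.1 hpD).2 h'⟩
    exact hd.event_inj hq'.1 hq.1 (getD_inj hD hq'.2.1 hq.2.1 this)
  · rintro ⟨q, ⟨hq, h⟩, hu⟩
    refine ⟨_, ⟨hq.2.2, (hd.mem_unitSquare_iff hq.1 hp hq.2.1 hpD).2 h⟩, ?_⟩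
    rintro c ⟨hc, h'⟩
    obtain ⟨q', hq', rfl⟩ := hd.exists_time hA hc
    rw [hu q' ⟨hq', (hd.mem_unitSquare_iff hq'.1 hp hq'.2.1 hpD).1 h'⟩]

open Classical in
theorem Describes.card_uniquelyCovered (hd : Describes k P D s) (hA : A ⊆ D.toFinset)
    (hP : P.Nodup) (hD : D.Nodup) :
    (uniquelyCovered P.toFinset A).card = {p ∈ Finset.range (sweepOf s).N |
      ¬ (sweepOf s).sq p ∧ ∃! q, TimesOf D s A q ∧ (sweepOf s).Cov q p}.card := by
  have hsq : ∀ p, (sweepOf s).sq p ↔ s.nat 12 p < D.length := fun p => by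
    change s.nat 12 p < s.nat 0 1 ↔ _
    rw [hd.2]
  symm
  refine Finset.card_bij (fun p _ => P.getD (s.nat 12 p - D.length) 0) ?_ ?_ ?_
  · intro p hp
    obtain ⟨h₁, h₂, h₃⟩ := Finset.mem_filter.1 hp
    have h₁ : p < s.nat 2 0 := Finset.mem_range.1 h₁
    rw [hsq] at h₂
    have := (hd.event_lt h₁).1
    exact Finset.mem_filter.2 ⟨List.mem_toFinset.2 (getD_mem (by omega)),
      (hd.unique_iff hA hD h₁ h₂).2 h₃⟩
  · intro p hp p' hp' heq
    obtain ⟨h₁, h₂, -⟩ := Finset.mem_filter.1 hp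
    obtain ⟨h₁', h₂', -⟩ := Finset.mem_filter.1 hp'
    have h₁ : p < s.nat 2 0 := Finset.mem_range.1 h₁
    have h₁' : p' < s.nat 2 0 := Finset.mem_range.1 h₁'
    rw [hsq] at h₂ h₂'
    have := (hd.event_lt h₁).1
    have := (hd.event_lt h₁').1
    have := getD_inj hP (by omega) (by omega) heq
    exact hd.event_inj h₁ h₁' (by omega)
  · intro x hx
    obtain ⟨h₁, h₂⟩ := Finset.mem_filter.1 hx
    obtain ⟨i, hi, rfl⟩ := exists_getD (List.mem_toFinset.1 h₁)
    obtain ⟨h₃, h₄⟩ := hd.1.rankX (D.length + i) (by omega)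
    have hN : s.nat 11 (D.length + i) < s.nat 2 0 := by rw [hd.1.size]; exact h₃
    have hnd : ¬ s.nat 12 (s.nat 11 (D.length + i)) < D.length := by rw [h₄]; omega
    have hi' : s.nat 12 (s.nat 11 (D.length + i)) - D.length = i := by rw [h₄]; omega
    refine ⟨s.nat 11 (D.length + i), Finset.mem_filter.2 ⟨Finset.mem_range.2 hN, ?_, ?_⟩, ?_⟩
    · rwa [hsq]
    · rw [← hd.unique_iff hA hD hN hnd, hi']
      exact h₂
    · rw [hi']

theorem mem_outputSet (hD : D.Nodup) {j : ℕ} (hj : j < D.length) (s : Store) :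
    D.getD j 0 ∈ outputSet D s ↔ s.nat 1 j ≠ 0 := by
  simp only [outputSet, Finset.mem_image, Finset.mem_filter, Finset.mem_range]
  constructor
  · rintro ⟨i, ⟨hi, h⟩, heq⟩
    rwa [getD_inj hD hj hi heq.symm]
  · exact fun h => ⟨j, ⟨hj, h⟩, rfl⟩

theorem outputSet_subset (s : Store) : outputSet D s ⊆ D.toFinset := by
  intro c hc
  simp only [outputSet, Finset.mem_image, Finset.mem_filter, Finset.mem_range] at hc
  obtain ⟨j, ⟨hj, -⟩, rfl⟩ := hc
  exact List.mem_toFinset.2 (getD_mem hj)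

/-- For a good shift, the interior points that `T` covers uniquely are at most the weight of the
path of `T`, hence at most the weight of the path found, hence at most the unique coverage of the
output. -/
theorem wp_mainProg_approx {R : ℕ} (hk : 1 ≤ k) (hP : P.Nodup) (hD : D.Nodup)
    (hR : (2 * (P.length + D.length) + 2 + k) ^ (Fintype.card (Key k) + 3) ≤ R) :
    Wp R (mainProg k) (fun s => (∃ T, IsFeasible P.toFinset D.toFinset T) →
      IsFeasible P.toFinset D.toFinset (outputSet D s) ∧
      ∀ T, IsFeasible P.toFinset D.toFinset T → k * (uniquelyCovered P.toFinset T).card ≤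
        k * (uniquelyCovered P.toFinset (outputSet D s)).card +
          4 * (uniquelyCovered P.toFinset T).card) (inputStore P D) := by
  classical
  refine (wp_mainProg (n := P.length) (m := D.length) (inputStore P D) rfl rfl ?_ hR).mono ?_
  · intro a i ha
    obtain ⟨a, rfl⟩ := Nat.exists_eq_add_of_le' ha
    rfl
  rintro s' ⟨s, M, hnorm, hm, hstates, hpath⟩ ⟨T₀, hT₀⟩
  have hd : Describes k P D s := ⟨hnorm, hm⟩
  have hN : (sweepOf s).N = P.length + D.length := hnorm.size
  have hZ : 2 * (P.length + D.length) + 2 = 2 * (sweepOf s).N + 2 := by rw [hN]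
  have hsq : ∀ p, (sweepOf s).sq p ↔ s.nat 12 p < D.length := fun p => by
    change s.nat 12 p < s.nat 0 1 ↔ _
    rw [hm]
  have hbd := hd.bounded
  simp only at hpath
  generalize 2 * (P.length + D.length) + 2 = Z at hpath hZ
  -- All states of `statePath` are within the enumerated range, so it is realized by vertices of the
  -- graph.
  have hlift : ∀ T, IsFeasible P.toFinset D.toFinset T → ∀ t < k, ∃ π,
      IsPath M ((sweepOf s).layers Z) (fun l u v =>
        (sweepOf s).LayerStep (k := k) Z l (stateOf s u) (stateOf s v)) π ∧
      ∀ l, stateOf (k := k) s (π l) = (sweepOf s).statePath Z (TimesOf D s T) t l := by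
    intro T hT t ht
    have hTt : ∀ q, TimesOf D s T q → q < (sweepOf s).N ∧ (sweepOf s).sq q :=
      fun q hq => ⟨hq.1, (hsq q).2 hq.2.1⟩
    have := fun l => hstates ((sweepOf s).statePath Z (TimesOf D s T) t l) (fun χ => by
      rw [← hN]
      exact Sweep.statePath_le hbd (fun q hq => (hTt q hq).1) ht l χ)
    choose π hπ hπ' using this
    refine ⟨π, ⟨fun l _ => hπ l, fun l hl => ?_⟩, hπ'⟩
    beta_reduce
    rw [hπ' l, hπ' (l + 1)]
    refine Sweep.statePath_step hbd hTt (fun p hp hpsq => ?_) ht hl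
    rw [hsq] at hpsq
    have := (hd.event_lt hp).1
    exact (hd.covered_iff hT.1 hp hpsq).1 (hT.2 _ (List.mem_toFinset.2 (getD_mem (by omega))))
  obtain ⟨π, h₁, h₂, h₃⟩ := hpath (by
    obtain ⟨π, hπ, -⟩ := hlift T₀ hT₀ 0 (by omega)
    exact ⟨π, hπ⟩)
  have hσ : ∀ l < (sweepOf s).layers Z, (sweepOf s).LayerStep (k := k) Z l
      ((fun l => stateOf s (π l)) l) ((fun l => stateOf s (π l)) (l + 1)) := h₁.2
  have hout : outputSet D s' ⊆ D.toFinset := outputSet_subset s'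
  have hsel : ∀ q, TimesOf D s (outputSet D s') q ↔
      (sweepOf s).Sel (k := k) Z (fun l => stateOf s (π l)) q := by
    intro q
    constructor
    · rintro ⟨hq₁, hq₂, hq₃⟩
      rw [mem_outputSet hD hq₂, h₃] at hq₃
      obtain ⟨l, hl, hc, he⟩ := hq₃
      -- Clearing steps select nothing, so every mark in the output stems from a genuine event;
      -- otherwise `l % (N + 2) - 1` could name a wrong one.
      have hl' : l % ((sweepOf s).N + 2) ≠ 0 := fun h0 => by
        have := ((hσ l hl).2.2.1 (.inl h0)).2
        simp only [hc] at this
        omega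
      obtain ⟨-, -, h₄, -⟩ := Sweep.layer_decomp hl
      have h₅ : ¬ (sweepOf s).N < l % ((sweepOf s).N + 2) := fun h0 => by
        have := ((hσ l hl).2.2.1 (.inr h0)).2
        simp only [hc] at this
        omega
      rw [← hN] at he
      refine ⟨l, hl, hc, ?_⟩
      have hlt : l % ((sweepOf s).N + 2) - 1 < s.nat 2 0 := by
        change _ < (sweepOf s).N
        omega
      have := hd.event_inj hlt hq₁ he
      omega
    · intro hq
      obtain ⟨hq₁, hq₂, -⟩ := Sweep.sel_cell hσ hq
      rw [hsq] at hq₂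
      refine ⟨hq₁, hq₂, ?_⟩
      rw [mem_outputSet hD hq₂, h₃]
      obtain ⟨l, hl, hc, he⟩ := hq
      refine ⟨l, hl, hc, ?_⟩
      rw [← hN, he]
      rfl
  refine ⟨⟨hout, fun x hx => ?_⟩, fun T hT => ?_⟩
  · obtain ⟨i, hi, rfl⟩ := exists_getD (List.mem_toFinset.1 hx)
    obtain ⟨h₄, h₅⟩ := hnorm.rankX (D.length + i) (by omega)
    have hpN : s.nat 11 (D.length + i) < s.nat 2 0 := by rw [hnorm.size]; exact h₄
    have hnd : ¬ s.nat 12 (s.nat 11 (D.length + i)) < D.length := by rw [h₅]; omega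
    have hi' : s.nat 12 (s.nat 11 (D.length + i)) - D.length = i := by rw [h₅]; omega
    obtain ⟨q, hq, hcov⟩ := Sweep.sel_covers hσ hbd hk hZ hpN (by rwa [hsq])
    have := (hd.covered_iff hout hpN hnd).2 ⟨q, (hsel q).2 hq, hcov⟩
    rwa [hi'] at this
  -- The good shift depends on `T`, but the best path competes with the paths of all shifts.
  · obtain ⟨t, ht, hle⟩ := Sweep.exists_shift hbd hk {p ∈ Finset.range (sweepOf s).N |
      ¬ (sweepOf s).sq p ∧ ∃! q, TimesOf D s T q ∧ (sweepOf s).Cov q p}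
      (fun p hp => by simpa using (Finset.mem_filter.1 hp).1)
    rw [← hd.card_uniquelyCovered hT.1 hP hD, Finset.filter_filter] at hle
    obtain ⟨π', hπ', hst⟩ := hlift T hT t ht
    have hg := Sweep.unique_le_gain (T := TimesOf D s T) hbd hk hZ
      (fun q hq => ⟨hq.1, (hsq q).2 hq.2.1⟩) ht
    have hw := h₂ π' hπ'
    have hu := Sweep.gain_le_unique hσ hbd
    simp only [← hsel] at hu
    rw [← hd.card_uniquelyCovered hout hP hD] at hu
    simp only [← hst] at hg
    have : {p ∈ Finset.range (sweepOf s).N | (¬ (sweepOf s).sq p ∧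
        ∃! q, TimesOf D s T q ∧ (sweepOf s).Cov q p) ∧ (sweepOf s).Interior k t p}.card ≤
        (uniquelyCovered P.toFinset (outputSet D s')).card := (hg.trans hw).trans hu
    exact hle.trans (Nat.add_le_add_right (Nat.mul_le_mul_left k this) _)

end UniqueSquareCover

/-! ### Choice of the constant and the polynomial bound -/

theorem theorem4 (ε : ℝ) (hε : 0 < ε) :
    ∃ (c : UniqueSquareCover.Prog) (q : Polynomial ℕ),
      ∀ P D : List (ℝ × ℝ), P.Nodup → D.Nodup →
        ∃ (t : ℕ) (s : UniqueSquareCover.Store),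
          UniqueSquareCover.Runs c (UniqueSquareCover.inputStore P D) t s ∧
          t ≤ q.eval (P.length + D.length) ∧
          ((∃ T, UniqueSquareCover.IsFeasible P.toFinset D.toFinset T) →
            UniqueSquareCover.IsApproxSolution (1 + ε) P.toFinset D.toFinset
              (UniqueSquareCover.outputSet D s)) := by
  -- This choice gives `k ≤ (1 + ε) * (k - 4)`.
  obtain ⟨k, hk⟩ := exists_nat_gt (4 + 4 / ε)
  have hk4 : (4 : ℝ) < k := by linarith [div_pos four_pos hε]
  have hkε : 4 ≤ ε * (k - 4) := by
    have : 4 / ε < k - 4 := by linarith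
    rw [div_lt_iff₀ hε] at this
    linarith
  have hk1 : 1 ≤ k := by
    have : (1 : ℝ) ≤ k := by linarith
    exact_mod_cast this
  -- The program is fixed once `k` is, so its cost polynomial evaluated at the polynomial bound for
  -- the loops is again a polynomial in the input size.
  refine ⟨UniqueSquareCover.mainProg k, (UniqueSquareCover.mainProg k).costPoly.comp
    ((2 * Polynomial.X + Polynomial.C (2 + k)) ^
      (Fintype.card (UniqueSquareCover.Key k) + 3)), fun P D hP hD => ?_⟩
  obtain ⟨t, s, hrun, ht, hs⟩ := UniqueSquareCover.wp_mainProg_approx (k := k) hk1 hP hD le_rfl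
  refine ⟨t, s, hrun, ?_, fun hT => ?_⟩
  · refine ht.trans (le_of_eq ?_)
    rw [Polynomial.eval_comp, ← UniqueSquareCover.Prog.eval_costPoly]
    simp [add_assoc]
  · obtain ⟨hfeas, hopt⟩ := hs hT
    refine ⟨hfeas, fun T hT => ?_⟩
    have h : (k : ℝ) * (UniqueSquareCover.uniquelyCovered P.toFinset T).card ≤
        k * (UniqueSquareCover.uniquelyCovered P.toFinset
          (UniqueSquareCover.outputSet D s)).card +
        4 * (UniqueSquareCover.uniquelyCovered P.toFinset T).card := by
      exact_mod_cast hopt T hT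
    have hpos : (0 : ℝ) ≤ (UniqueSquareCover.uniquelyCovered P.toFinset
      (UniqueSquareCover.outputSet D s)).card := Nat.cast_nonneg _
    generalize ((UniqueSquareCover.uniquelyCovered P.toFinset T).card : ℝ) = x at *
    generalize ((UniqueSquareCover.uniquelyCovered P.toFinset
      (UniqueSquareCover.outputSet D s)).card : ℝ) = y at *
    have h₁ : (k - 4) * x ≤ (k - 4) * ((1 + ε) * y) := by
      have : 4 * y ≤ ε * (k - 4) * y := mul_le_mul_of_nonneg_right hkε hpos
      nlinarith
    exact le_of_mul_le_mul_left h₁ (by linarith)
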